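/- **Setting.** Let $\alpha>0$, $\alpha\neq1$, and let $U^\alpha=\{(z_1,z_2)\in\mathbb C^2:|z_1|^{2/\alpha}+|z_2|^2<1\}$ be the Thullen domain with Lebesgue measure $d\sigma$; $\langle\cdot,\cdot\rangle$ and $\|\cdot\|$ denote the inner product and the norm of $L^2(U^\alpha)$. Let $A^2(U^\alpha)\subset L^2(U^\alpha)$ be the closed subspace of square-integrable holomorphic functions, $P:L^2(U^\alpha)\to A^2(U^\alpha)$ the orthogonal projection, $K_z\in A^2(U^\alpha)$ the reproducing (Bergman) kernel at $z$, i.e. $f(z)=\langle f,K_z\rangle$ for $f\in A^2(U^\alpha)$, and $k_z=K_z/\|K_z\|$. $M_a$ denotes multiplication by $a$. For $|b|<1$ and $|a|<1$ let, for $w=(w_1,w_2)\in U^\alpha$, $$\varphi_b(w)=\Big(w_1\Big(\tfrac{\sqrt{1-|b|^2}}{1-\bar b w_2}\Big)^{\alpha},\ \tfrac{b-w_2}{1-\bar b w_2}\Big),$$ $$\phi_a(w)=\Big(m,\ w_2\,\tfrac{\sqrt{1-|a|^2}}{1-\bar a w_1}\sqrt{\tfrac{(1-|w_1|^2)(1-|m|^{2/\alpha})}{(1-|w_1|^{2/\alpha})(1-|m|^2)}}\Big),\qquad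 m=\tfrac{a-w_1}{1-\bar a w_1}.$$ Let $J\Phi=\det(\partial\Phi_i/\partial w_j)$ be the holomorphic Jacobian determinant (with $\partial/\partial w_j$ the Wirtinger derivatives), and for $z\in U^\alpha$ put $U_zf=(f\circ\varphi_{z_2})\,J\varphi_{z_2}$, $V_af=(f\circ\phi_a)\,J\phi_a$, and $f_\alpha(z)=z_1/(1-|z_2|^2)^{\alpha/2}$. Let $d(z,w)=(1-|\langle k_z,k_w\rangle|)^{1/2}$ be the Skwarczyński distance on $U^\alpha$. For $0<r<1$, call a countable family $\mathcal F_r=\{F_j\}$ of pairwise disjoint Borel sets with union $U^\alpha$ an *$(r,N,C)$-covering*, where $N\in\mathbb N$ and $C\in\mathbb R$, if every point of $U^\alpha$ belongs to at most $N$ of the sets $G_j=\{z\in U^\alpha: d(z,F_j)\le r\}$, and $\sup_j\operatorname{diam}_dF_j<C$. **Proposition 4.4.** Let $T$ and $T^*$ be linear maps from the linear span of $\{k_z:z\in U^\alpha\}$ to $A^2(U^\alpha)$ with $\langle Tk_z,k_w\rangle=\langle k_z,T^*k_w\rangle$ for all $z,w\in U^\alpha$. Suppose that for some real $p>4$ $$\sup_{z\in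 U^\alpha}\|V_{f_\alpha(z)}U_zTk_z\|_{L^p(U^\alpha)}<\infty\quad\text{and}\quad\sup_{z\in U^\alpha}\|V_{f_\alpha(z)}U_zT^*k_z\|_{L^p(U^\alpha)}<\infty .$$ Then $T$ extends to a bounded operator on $A^2(U^\alpha)$, still denoted $T$, and for every $\epsilon>0$ there is an $r\in(0,1)$ such that: 1. there is an $(r,N,C)$-covering of $U^\alpha$ for some $N\in\mathbb N$ and some $C<1$; and 2. for all $N$ and $C$ and every $(r,N,C)$-covering $\{F_j\}$, with $G_j=\{z\in U^\alpha:d(z,F_j)\le r\}$, the series $\sum_jM_{1_{F_j}}TPM_{1_{G_j}}$ converges pointwise (in the strong operator topology) to a bounded operator $A^2(U^\alpha)\to L^2(U^\alpha)$, and $$\Big\|T-\sum_jM_{1_{F_j}}TPM_{1_{G_j}}\Big\|_{A^2(U^\alpha)\to L^2(U^\alpha)}<\epsilon .$$ -/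

import Mathlib

open scoped ENNReal

noncomputable section

open MeasureTheory Metric Set Filter Topology
open TopologicalSpace (Opens)

/-! ## Interior estimates for holomorphic functions -/

theorem lintegral_ball_polar (F : ℂ → ℝ≥0∞) (hF : Measurable F) :
    ∫⁻ z, F z = ∫⁻ r in Ioi (0:ℝ), ENNReal.ofReal r *
      ∫⁻ θ in Ioo (-Real.pi) Real.pi, F (r * (Real.cos θ + Real.sin θ * Complex.I)) := by
  rw [← Complex.lintegral_comp_polarCoord_symm, polarCoord_target]
  have hm : Measurable fun p : ℝ × ℝ => F (p.1 * (Real.cos p.2 + Real.sin p.2 * Complex.I)) := by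
    apply hF.comp; fun_prop
  rw [Measure.volume_eq_prod, ← Measure.prod_restrict, lintegral_prod]
  · refine lintegral_congr fun r => ?_
    simp only [Complex.polarCoord_symm_apply, smul_eq_mul]
    rw [lintegral_const_mul]
    exact hm.comp measurable_prodMk_left
  · simp only [Complex.polarCoord_symm_apply, smul_eq_mul]
    exact (Measurable.mul (by fun_prop) hm).aemeasurable

theorem circle_submean (h : ℂ → ℂ) (c : ℂ) (R r : ℝ) (hr : 0 < r) (hrR : r < R)
    (hd : DifferentiableOn ℂ h (ball c R)) :
    ENNReal.ofReal (2 * Real.pi) * ‖h c‖ₑ ≤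
      ∫⁻ θ in Ioo (-Real.pi) Real.pi, ‖h (c + r * (Real.cos θ + Real.sin θ * Complex.I))‖ₑ := by
  have h1 : Real.circleAverage h c r = h c := by
    apply DiffContOnCl.circleAverage
    rw [abs_of_pos hr]
    exact (hd.mono (closedBall_subset_ball hrR)).diffContOnCl_ball subset_rfl
  rw [Real.circleAverage_eq_integral_add (-Real.pi),
    intervalIntegral.integral_comp_add_right (fun θ => h (circleMap c r θ))] at h1
  have e1 : (0:ℝ) + -Real.pi = -Real.pi := by ring
  have e2 : 2 * Real.pi + -Real.pi = Real.pi := by ring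
  have hpi := Real.pi_pos
  rw [e1, e2, intervalIntegral.integral_of_le (by linarith),
    ← setIntegral_congr_set (Ioo_ae_eq_Ioc)] at h1
  have h2 : (2 * Real.pi) • h c = ∫ θ in Ioo (-Real.pi) Real.pi, h (circleMap c r θ) := by
    rw [← h1, smul_smul, mul_inv_cancel₀ (by positivity), one_smul]
  have h3 : ENNReal.ofReal (2 * Real.pi) * ‖h c‖ₑ = ‖(2 * Real.pi) • h c‖ₑ := by
    rw [enorm_smul, Real.enorm_eq_ofReal (by positivity)]
  rw [h3, h2]
  refine (enorm_integral_le_lintegral_enorm _).trans (le_of_eq ?_)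
  refine lintegral_congr fun θ => ?_
  rw [circleMap, Complex.exp_mul_I, Complex.ofReal_cos, Complex.ofReal_sin]

/-- The sub-mean-value property of holomorphic functions on discs. -/
theorem disc_submean (h : ℂ → ℂ) (c : ℂ) (R : ℝ) (hd : DifferentiableOn ℂ h (ball c R)) :
    ‖h c‖ₑ * volume (ball c R) ≤ ∫⁻ ζ in ball c R, ‖h ζ‖ₑ := by
  classical
  have key : ∀ g : ℂ → ℂ, ContinuousOn g (ball c R) → ∫⁻ ζ in ball c R, ‖g ζ‖ₑ =
      ∫⁻ r in Ioi (0:ℝ), ENNReal.ofReal r * ∫⁻ θ in Ioo (-Real.pi) Real.pi,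
        (ball c R).indicator (fun ζ => ‖g ζ‖ₑ)
          (c + r * (Real.cos θ + Real.sin θ * Complex.I)) := by
    intro g hg
    have hm : Measurable ((ball c R).indicator (fun ζ => ‖g ζ‖ₑ)) := by
      have := (hg.enorm).measurable_piecewise (g := (0 : ℂ → ℝ≥0∞)) continuousOn_const
        measurableSet_ball
      rwa [Set.piecewise_eq_indicator] at this
    rw [← lintegral_indicator measurableSet_ball,
      ← lintegral_add_left_eq_self _ c, lintegral_ball_polar]
    exact hm.comp (by fun_prop)
  have k1 := key (fun _ => h c) continuousOn_const
  rw [setLIntegral_const] at k1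
  rw [k1, key h hd.continuousOn]
  refine setLIntegral_mono' measurableSet_Ioi fun r hr => ?_
  gcongr ENNReal.ofReal r * ?_
  have hr : 0 < r := hr
  have hmem : ∀ θ : ℝ, c + r * (Real.cos θ + Real.sin θ * Complex.I) ∈ ball c R ↔ r < R := by
    intro θ
    rw [mem_ball, dist_eq_norm, add_sub_cancel_left, norm_mul, Complex.ofReal_cos,
      Complex.ofReal_sin, ← Complex.exp_mul_I, Complex.norm_exp_ofReal_mul_I, mul_one,
      Complex.norm_real, Real.norm_of_nonneg hr.le]
  by_cases hrR : r < R
  · simp only [Set.indicator, hmem, hrR, if_true]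
    refine le_trans (le_of_eq ?_) (circle_submean h c R r hr hrR hd)
    rw [setLIntegral_const, mul_comm, Real.volume_Ioo]
    congr 2; ring
  · simp only [Set.indicator, hmem, hrR, if_false]
    simp

/-- The sub-mean-value property of holomorphic functions on bidiscs. -/
theorem bidisc_submean (h : ℂ × ℂ → ℂ) (c : ℂ × ℂ) (R : ℝ)
    (hd : DifferentiableOn ℂ h (ball c R)) :
    ‖h c‖ₑ * volume (ball c R) ≤ ∫⁻ ζ in ball c R, ‖h ζ‖ₑ := by
  rw [← ball_prod_same] at hd ⊢
  rcases lt_or_ge 0 R with hR | hR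
  swap
  · simp [ball_eq_empty.2 hR]
  have d1 : DifferentiableOn ℂ (fun a => h (a, c.2)) (ball c.1 R) :=
    hd.comp (by fun_prop) fun a ha => ⟨ha, mem_ball_self hR⟩
  have d2 : ∀ a ∈ ball c.1 R, DifferentiableOn ℂ (fun b => h (a, b)) (ball c.2 R) :=
    fun a ha => hd.comp (by fun_prop) fun b hb => ⟨ha, hb⟩
  have hae : AEMeasurable (fun ζ => ‖h ζ‖ₑ)
      (((volume : Measure ℂ).prod volume).restrict (ball c.1 R ×ˢ ball c.2 R)) :=
    (hd.continuousOn.enorm).aemeasurable (measurableSet_ball.prod measurableSet_ball)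
  rw [Measure.volume_eq_prod, Measure.prod_prod, setLIntegral_prod _ hae, ← mul_assoc]
  calc ‖h c‖ₑ * volume (ball c.1 R) * volume (ball c.2 R)
      ≤ (∫⁻ a in ball c.1 R, ‖h (a, c.2)‖ₑ) * volume (ball c.2 R) := by
        gcongr; exact disc_submean _ _ _ d1
    _ = ∫⁻ a in ball c.1 R, ‖h (a, c.2)‖ₑ * volume (ball c.2 R) := by
        rw [lintegral_mul_const']
        exact measure_ball_lt_top.ne
    _ ≤ _ := setLIntegral_mono' measurableSet_ball fun a ha => disc_submean _ _ _ (d2 a ha)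

/-- Point values of holomorphic functions are controlled by the `L²` norm. -/
theorem bergman_bound (Ω : Set (ℂ × ℂ)) (h : ℂ × ℂ → ℂ) (hd : DifferentiableOn ℂ h Ω)
    (c : ℂ × ℂ) (R : ℝ) (hR : 0 < R) (hb : ball c R ⊆ Ω) :
    ‖h c‖ₑ ≤ eLpNorm h 2 (volume.restrict Ω) * (volume (ball (0 : ℂ × ℂ) R)) ^ (-(1/2) : ℝ) := by
  have hv : volume (ball c R) = volume (ball (0 : ℂ × ℂ) R) := by
    rw [← ball_prod_same, ← ball_prod_same, Measure.volume_eq_prod, Measure.prod_prod,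
      Measure.prod_prod, Measure.addHaar_ball_center, Measure.addHaar_ball_center volume c.2]
    simp
  have v0 : volume (ball (0 : ℂ × ℂ) R) ≠ 0 := (measure_ball_pos _ _ hR).ne'
  have vt : volume (ball (0 : ℂ × ℂ) R) ≠ ∞ := measure_ball_lt_top.ne
  have h1 := bidisc_submean h c R (hd.mono hb)
  have hm : AEStronglyMeasurable h (volume.restrict (ball c R)) :=
    (hd.mono hb).continuousOn.aestronglyMeasurable measurableSet_ball
  have h2 := eLpNorm_le_eLpNorm_mul_rpow_measure_univ (p := 1) (q := 2) (by norm_num) hm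
  rw [eLpNorm_one_eq_lintegral_enorm, Measure.restrict_apply_univ, hv] at h2
  have h3 : eLpNorm h 2 (volume.restrict (ball c R)) ≤ eLpNorm h 2 (volume.restrict Ω) :=
    eLpNorm_mono_measure _ (Measure.restrict_mono hb le_rfl)
  rw [hv] at h1
  have h4 := (h1.trans h2).trans (mul_le_mul_left h3 _)
  have e : (1 / (1:ℝ≥0∞).toReal - 1 / (2:ℝ≥0∞).toReal) = 1 + (-(1/2) : ℝ) := by norm_num
  rw [e, ENNReal.rpow_add _ _ v0 vt, ENNReal.rpow_one, mul_left_comm, mul_comm] at h4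
  exact (ENNReal.mul_le_mul_iff_right v0 vt).1 h4

/-! ## Bergman spaces -/

/-- `L²(Ω)` with respect to Lebesgue measure on `ℂ²`. -/
abbrev L2 (Ω : Opens (ℂ × ℂ)) : Type := Lp ℂ 2 ((volume : Measure (ℂ × ℂ)).restrict Ω)

/-- The Bergman space `A²(Ω)`: the classes in `L²(Ω)` that have a representative which is
holomorphic on `Ω`. -/
def bergmanSpace (Ω : Opens (ℂ × ℂ)) : Submodule ℂ (L2 Ω) where
  carrier := {f | ∃ g : ℂ × ℂ → ℂ, DifferentiableOn ℂ g Ω ∧ f =ᵐ[volume.restrict Ω] g}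
  add_mem' := by
    rintro a b ⟨g, hg, hag⟩ ⟨k, hk, hbk⟩
    exact ⟨g + k, hg.add hk, (Lp.coeFn_add a b).trans (hag.add hbk)⟩
  zero_mem' := by
    have h : ((0 : L2 Ω) : ℂ × ℂ → ℂ) =ᵐ[volume.restrict Ω] 0 :=
      Lp.coeFn_zero ℂ 2 (volume.restrict (Ω : Set (ℂ × ℂ)))
    exact ⟨fun _ => 0, differentiableOn_const 0, h⟩
  smul_mem' := by
    rintro c a ⟨g, hg, hag⟩
    exact ⟨c • g, hg.const_smul c, (Lp.coeFn_smul c a).trans (hag.const_smul c)⟩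

namespace bergmanSpace

variable {Ω : Opens (ℂ × ℂ)}

/-- The holomorphic representative of an element of `A²(Ω)`; it is unique on `Ω`. -/
def rep (f : bergmanSpace Ω) : ℂ × ℂ → ℂ := f.2.choose

theorem differentiableOn_rep (f : bergmanSpace Ω) : DifferentiableOn ℂ (rep f) Ω :=
  f.2.choose_spec.1

theorem ae_eq_rep (f : bergmanSpace Ω) : (f : L2 Ω) =ᵐ[volume.restrict Ω] rep f :=
  f.2.choose_spec.2

theorem rep_unique (f : bergmanSpace Ω) {g : ℂ × ℂ → ℂ} (hg : DifferentiableOn ℂ g Ω)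
    (h : (f : L2 Ω) =ᵐ[volume.restrict Ω] g) : EqOn (rep f) g Ω :=
  Measure.eqOn_open_of_ae_eq ((ae_eq_rep f).symm.trans h) Ω.isOpen
    (differentiableOn_rep f).continuousOn hg.continuousOn

theorem rep_add (f g : bergmanSpace Ω) : EqOn (rep (f + g)) (rep f + rep g) Ω :=
  rep_unique _ ((differentiableOn_rep f).add (differentiableOn_rep g))
    ((Lp.coeFn_add (f : L2 Ω) (g : L2 Ω)).trans ((ae_eq_rep f).add (ae_eq_rep g)))

theorem rep_smul (c : ℂ) (f : bergmanSpace Ω) : EqOn (rep (c • f)) (c • rep f) Ω :=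
  rep_unique _ ((differentiableOn_rep f).const_smul c)
    ((Lp.coeFn_smul c (f : L2 Ω)).trans ((ae_eq_rep f).const_smul c))

theorem rep_sub (f g : bergmanSpace Ω) : EqOn (rep (f - g)) (rep f - rep g) Ω :=
  rep_unique _ ((differentiableOn_rep f).sub (differentiableOn_rep g))
    ((Lp.coeFn_sub (f : L2 Ω) (g : L2 Ω)).trans ((ae_eq_rep f).sub (ae_eq_rep g)))

theorem exists_bound (R : ℝ) (hR : 0 < R) : ∃ C : ℝ, 0 ≤ C ∧ ∀ (f : bergmanSpace Ω) (z : ℂ × ℂ),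
    ball z R ⊆ (Ω : Set (ℂ × ℂ)) → ‖rep f z‖ ≤ C * ‖f‖ := by
  have v0 : volume (ball (0 : ℂ × ℂ) R) ≠ 0 := (measure_ball_pos _ _ hR).ne'
  have vt : volume (ball (0 : ℂ × ℂ) R) ≠ ∞ := measure_ball_lt_top.ne
  refine ⟨((volume (ball (0 : ℂ × ℂ) R)) ^ (-(1/2) : ℝ)).toReal, ENNReal.toReal_nonneg,
    fun f z hz => ?_⟩
  have h1 := bergman_bound Ω (rep f) (differentiableOn_rep f) z R hR hz
  rw [← eLpNorm_congr_ae (ae_eq_rep f), ← Lp.enorm_def, mul_comm] at h1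
  have h2 := ENNReal.toReal_mono
    (ENNReal.mul_ne_top (ENNReal.rpow_ne_top_of_ne_zero v0 vt) enorm_ne_top) h1
  rwa [ENNReal.toReal_mul, toReal_enorm, toReal_enorm] at h2

/-- Evaluation at a point of `Ω`, a bounded linear functional on `A²(Ω)`. -/
def evalCLM (z : Ω) : bergmanSpace Ω →L[ℂ] ℂ :=
  LinearMap.mkContinuousOfExistsBound
    { toFun := fun f => rep f z
      map_add' := fun f g => rep_add f g z.2
      map_smul' := fun c f => rep_smul c f z.2 }
    (by
      obtain ⟨R, hR, hb⟩ := Metric.isOpen_iff.1 Ω.isOpen z z.2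
      obtain ⟨C, -, hC⟩ := exists_bound (Ω := Ω) R hR
      exact ⟨C, fun f => hC f z hb⟩)

theorem exists_fderiv_bound (R : ℝ) (hR : 0 < R) : ∃ C : ℝ, 0 ≤ C ∧
    ∀ (f : bergmanSpace Ω) (z : ℂ × ℂ),
    ball z (2 * R) ⊆ (Ω : Set (ℂ × ℂ)) → ‖fderiv ℂ (rep f) z‖ ≤ C * ‖f‖ := by
  obtain ⟨C, hC0, hC⟩ := exists_bound (Ω := Ω) R hR
  refine ⟨2 * C / R, by positivity, fun f z hz => ?_⟩
  have hb : ∀ w ∈ ball z R, ‖rep f w‖ ≤ C * ‖f‖ := fun w hw => by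
    refine hC f w (Subset.trans (ball_subset_ball' ?_) hz)
    have := mem_ball.1 hw
    linarith
  have h := Complex.norm_fderiv_le_div_of_mapsTo_ball (f := rep f) (c := z) (R₁ := R)
    (R₂ := 2 * (C * ‖f‖))
    ((differentiableOn_rep f).mono (Subset.trans (ball_subset_ball (by linarith)) hz))
    (fun w hw => by
      rw [mem_closedBall, dist_eq_norm]
      have := hb w hw
      have := hb z (mem_ball_self hR)
      have := norm_sub_le (rep f w) (rep f z)
      linarith) hR
  refine h.trans (le_of_eq ?_)
  ring

theorem isClosed : IsClosed (bergmanSpace Ω : Set (L2 Ω)) := by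
  refine IsSeqClosed.isClosed fun F f hF hlim => ?_
  let G : ℕ → bergmanSpace Ω := fun n => ⟨F n, hF n⟩
  have hGc : CauchySeq G := by
    have := hlim.cauchySeq
    rw [Metric.cauchySeq_iff] at this ⊢
    exact this
  have hpt : ∀ z ∈ Ω, ∃ a, Tendsto (fun n => rep (G n) z) atTop (𝓝 a) := fun z hz =>
    cauchySeq_tendsto_of_complete ((evalCLM ⟨z, hz⟩).uniformContinuous.comp_cauchySeq hGc)
  have hloc : ∀ z ∈ Ω, ∃ C : ℝ, 0 ≤ C ∧ ∃ t ∈ 𝓝 z, ∀ w ∈ t, ∀ k : bergmanSpace Ω,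
      ‖fderiv ℂ (rep k) w‖ ≤ C * ‖k‖ := by
    intro z hz
    obtain ⟨R, hR, hb⟩ := Metric.isOpen_iff.1 Ω.isOpen z hz
    obtain ⟨C, hC0, hC⟩ := exists_fderiv_bound (Ω := Ω) (R / 4) (by positivity)
    refine ⟨C, hC0, ball z (R / 2), ball_mem_nhds _ (by positivity), fun w hw k => ?_⟩
    refine hC k w (Subset.trans (ball_subset_ball' ?_) hb)
    have := mem_ball.1 hw
    linarith
  have hsub : ∀ (k l : bergmanSpace Ω), ∀ w ∈ Ω,
      fderiv ℂ (rep k) w - fderiv ℂ (rep l) w = fderiv ℂ (rep (k - l)) w := by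
    intro k l w hw
    have hn : (Ω : Set (ℂ × ℂ)) ∈ 𝓝 w := Ω.isOpen.mem_nhds hw
    rw [(Filter.eventuallyEq_of_mem hn (rep_sub k l)).fderiv_eq,
      fderiv_sub ((differentiableOn_rep k).differentiableAt hn)
        ((differentiableOn_rep l).differentiableAt hn)]
  have hloc' : ∀ z ∈ Ω, ∃ C : ℝ, 0 ≤ C ∧ ∃ t ∈ 𝓝 z, ∀ w ∈ t, ∀ m n,
      ‖fderiv ℂ (rep (G m)) w - fderiv ℂ (rep (G n)) w‖ ≤ C * ‖G m - G n‖ := by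
    intro z hz
    obtain ⟨C, hC0, t, ht, hC⟩ := hloc z hz
    refine ⟨C, hC0, t ∩ Ω, inter_mem ht (Ω.isOpen.mem_nhds hz), fun w hw m n => ?_⟩
    rw [hsub _ _ w hw.2]
    exact hC w hw.1 _
  have hUC : ∀ z ∈ Ω, ∃ t ∈ 𝓝 z,
      UniformCauchySeqOn (fun n => fderiv ℂ (rep (G n))) atTop t := by
    intro z hz
    obtain ⟨C, hC0, t, ht, hC⟩ := hloc' z hz
    refine ⟨t, ht, Metric.uniformCauchySeqOn_iff.2 fun ε hε => ?_⟩
    obtain ⟨N, hN⟩ := Metric.cauchySeq_iff.1 hGc (ε / (C + 1)) (by positivity)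
    refine ⟨N, fun m hm n hn w hw => ?_⟩
    have h1 := hN m hm n hn
    rw [dist_eq_norm] at h1 ⊢
    rw [lt_div_iff₀ (by positivity)] at h1
    have := hC w hw m n
    nlinarith [norm_nonneg (G m - G n)]
  choose! g hg using hpt
  have hpt' : ∀ z ∈ Ω, ∃ a, Tendsto (fun n => fderiv ℂ (rep (G n)) z) atTop (𝓝 a) := by
    intro z hz
    obtain ⟨t, ht, hU⟩ := hUC z hz
    exact cauchySeq_tendsto_of_complete (hU.cauchySeq (mem_of_mem_nhds ht))
  choose! g' hg' using hpt'
  have hLU : TendstoLocallyUniformlyOn (fun n => fderiv ℂ (rep (G n))) g' atTop Ω := by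
    intro u hu z hz
    obtain ⟨t, ht, hU⟩ := hUC z hz
    exact ⟨t ∩ Ω, mem_nhdsWithin_of_mem_nhds (inter_mem ht (Ω.isOpen.mem_nhds hz)),
      (hU.mono inter_subset_left).tendstoUniformlyOn_of_tendsto (fun w hw => hg' w hw.2) u hu⟩
  refine ⟨g, fun z hz => (hasFDerivAt_of_tendstoLocallyUniformlyOn Ω.isOpen hLU
    (fun n w hw => ((differentiableOn_rep (G n)).differentiableAt
      (Ω.isOpen.mem_nhds hw)).hasFDerivAt) hg hz).differentiableAt.differentiableWithinAt, ?_⟩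
  obtain ⟨ns, hns, hae⟩ := (tendstoInMeasure_of_tendsto_Lp hlim).exists_seq_tendsto_ae
  have hall : ∀ᵐ z ∂(volume.restrict (Ω : Set (ℂ × ℂ))), ∀ n, F n z = rep (G n) z :=
    ae_all_iff.2 fun n => ae_eq_rep (G n)
  filter_upwards [hae, hall, ae_restrict_mem Ω.isOpen.measurableSet] with z h1 h2 h3
  refine tendsto_nhds_unique h1 ?_
  simp only [h2]
  exact (hg z h3).comp hns.tendsto_atTop

instance : CompleteSpace (bergmanSpace Ω) := isClosed.completeSpace_coe

end bergmanSpace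

variable (Ω : Opens (ℂ × ℂ))

/-- The Bergman projection: the orthogonal projection of `L²(Ω)` onto the closed subspace
`A²(Ω)`. -/
def bergmanProjection : L2 Ω →L[ℂ] bergmanSpace Ω :=
  (bergmanSpace Ω).orthogonalProjectionOnto

/-- The Bergman kernel function `K_z = K(·; z̄)`: the element of `A²(Ω)` that represents
evaluation at `z`, so that `f(z) = ⟨f, K_z⟩` for all `f ∈ A²(Ω)`. (In Mathlib the inner product is
conjugate linear in the first variable, so `⟨f, g⟩` is written `inner ℂ g f`.) -/
def bergmanKernel (z : Ω) : bergmanSpace Ω :=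
  (InnerProductSpace.toDual ℂ (bergmanSpace Ω)).symm (bergmanSpace.evalCLM z)

theorem inner_bergmanKernel (z : Ω) (f : bergmanSpace Ω) :
    inner ℂ (bergmanKernel Ω z) f = bergmanSpace.rep f z := by
  simp [bergmanKernel, bergmanSpace.evalCLM]

/-- The normalized kernel function `k_z = K_z / ‖K_z‖`. -/
def normalizedKernel (z : Ω) : bergmanSpace Ω :=
  ((‖bergmanKernel Ω z‖⁻¹ : ℝ) : ℂ) • bergmanKernel Ω z

/-- The linear span of the normalized kernel functions. -/
def kernelSpan : Submodule ℂ (bergmanSpace Ω) :=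
  Submodule.span ℂ (Set.range (normalizedKernel Ω))

/-- The normalized kernel function `k_z`, as an element of the span. -/
def spanKernel (z : Ω) : kernelSpan Ω :=
  ⟨normalizedKernel Ω z, Submodule.subset_span (Set.mem_range_self z)⟩

/-- The Skwarczyński distance `d(z,w) = (1 - |⟨k_z, k_w⟩|)^{1/2}`. -/
def skwDist (z w : Ω) : ℝ :=
  √(1 - ‖(inner ℂ (normalizedKernel Ω w) (normalizedKernel Ω z) : ℂ)‖)

/-- The diameter of a set with respect to the Skwarczyński distance. -/
def skwDiam (s : Set Ω) : ℝ≥0∞ :=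
  ⨆ z ∈ s, ⨆ w ∈ s, ENNReal.ofReal (skwDist Ω z w)

/-- The set `{z ∈ Ω : d(z, s) ≤ r}`, where `d(z, s) = inf_{w ∈ s} d(z,w)` (and the distance to the
empty set is `∞`). -/
def skwThickening (r : ℝ) (s : Set Ω) : Set Ω :=
  {z | (⨅ w ∈ s, ENNReal.ofReal (skwDist Ω z w)) ≤ ENNReal.ofReal r}

/-- `F` is a covering of `Ω` by countably many pairwise disjoint Borel sets `F j` such that every
point of `Ω` lies in at most `N` of the sets `G j = {z : d(z, F j) ≤ r}`, and
`sup_j diam_d (F j) < C`. The sets `F j` may be empty, so finite coverings are included. -/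
structure IsSkwCovering (r : ℝ) (N : ℕ) (C : ℝ) (F : ℕ → Set Ω) : Prop where
  measurableSet : ∀ j, MeasurableSet (F j)
  pairwise_disjoint : Pairwise fun i j => Disjoint (F i) (F j)
  iUnion_eq : ⋃ j, F j = Set.univ
  overlap : ∀ z : Ω, {j | z ∈ skwThickening Ω r (F j)}.encard ≤ N
  diam_lt : (⨆ j, skwDiam Ω (F j)) < ENNReal.ofReal C

/-- Multiplication by the indicator function of a Borel set `t ⊆ ℂ²`, on `L²(Ω)`. -/
def indicatorLp {t : Set (ℂ × ℂ)} (ht : MeasurableSet t) : L2 Ω →L[ℂ] L2 Ω :=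
  LinearMap.mkContinuous
    { toFun := fun f => ((Lp.memLp f).indicator ht).toLp
      map_add' := fun f g => by
        rw [← MemLp.toLp_add]
        refine MemLp.toLp_congr _ _ ?_
        filter_upwards [Lp.coeFn_add f g] with x hx
        simp only [Set.indicator, Pi.add_apply]
        split_ifs
        · exact hx
        · exact (add_zero 0).symm
      map_smul' := fun c f => by
        rw [RingHom.id_apply, ← MemLp.toLp_const_smul]
        refine MemLp.toLp_congr _ _ ?_
        filter_upwards [Lp.coeFn_smul c f] with x hx
        simp only [Set.indicator, Pi.smul_apply]
        split_ifs
        · exact hx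
        · exact (smul_zero c).symm }
    1 (fun f => by
      rw [one_mul]
      change ‖((Lp.memLp f).indicator ht).toLp‖ ≤ ‖f‖
      rw [Lp.norm_toLp, Lp.norm_def]
      exact ENNReal.toReal_mono (Lp.eLpNorm_ne_top f) (eLpNorm_indicator_le _))

theorem indicatorLp_apply {t : Set (ℂ × ℂ)} (ht : MeasurableSet t) (f : L2 Ω) :
    indicatorLp Ω ht f = ((Lp.memLp f).indicator ht).toLp := rfl

open Classical in
/-- The operator `M_{1_s}` on `L²(Ω)` of multiplication by the indicator function of a Borel set
`s ⊆ Ω`. (The value for a set that is not Borel is irrelevant, and set to `0`.) -/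
def indicatorOp (s : Set Ω) : L2 Ω →L[ℂ] L2 Ω :=
  if hs : MeasurableSet ((↑) '' s : Set (ℂ × ℂ)) then indicatorLp Ω hs else 0

theorem indicatorOp_ae_eq {s : Set Ω} (hs : MeasurableSet s) (f : L2 Ω) :
    (indicatorOp Ω s f : ℂ × ℂ → ℂ) =ᵐ[volume.restrict Ω]
      ((↑) '' s : Set (ℂ × ℂ)).indicator (f : ℂ × ℂ → ℂ) := by
  have h : MeasurableSet ((↑) '' s : Set (ℂ × ℂ)) :=
    Ω.isOpen.measurableSet.subtype_image hs
  have e : indicatorOp Ω s = indicatorLp Ω h := dif_pos h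
  have hm : MemLp (((↑) '' s : Set (ℂ × ℂ)).indicator (f : ℂ × ℂ → ℂ)) 2 (volume.restrict Ω) :=
    (Lp.memLp f).indicator h
  rw [e, indicatorLp_apply]
  exact MemLp.coeFn_toLp hm

variable {Ω} in
/-- The operator `M_{1_F} T P M_{1_G} : A²(Ω) → L²(Ω)`. -/
def localizedOp (T : bergmanSpace Ω →L[ℂ] bergmanSpace Ω) (F G : Set Ω) :
    bergmanSpace Ω →L[ℂ] L2 Ω :=
  (indicatorOp Ω F).comp ((bergmanSpace Ω).subtypeL.comp (T.comp
    ((bergmanProjection Ω).comp ((indicatorOp Ω G).comp (bergmanSpace Ω).subtypeL))))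

/-! ## The Thullen domain -/

/-- The Thullen domain `{(z₁,z₂) : |z₁|^{2/α} + |z₂|² < 1}`. -/
def thullen (α : ℝ) (hα : 0 < α) : Opens (ℂ × ℂ) where
  carrier := {z | ‖z.1‖ ^ (2 / α) + ‖z.2‖ ^ 2 < 1}
  is_open' := by
    have : Continuous fun x : ℝ => x ^ (2 / α) := Real.continuous_rpow_const (by positivity)
    exact isOpen_lt (by fun_prop) continuous_const

open ComplexConjugate in
/-- The holomorphic automorphism `φ_b` of the Thullen domain, for `|b| < 1`:
`φ_b(w) = (w₁ (√(1-|b|²) / (1 - b̄ w₂))^α, (b - w₂) / (1 - b̄ w₂))`. -/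
def autoSnd (α : ℝ) (b : ℂ) (w : ℂ × ℂ) : ℂ × ℂ :=
  (w.1 * ((√(1 - ‖b‖ ^ 2) : ℂ) / (1 - conj b * w.2)) ^ (α : ℂ),
    (b - w.2) / (1 - conj b * w.2))

open ComplexConjugate in
/-- The disc automorphism `ζ ↦ (a - ζ) / (1 - ā ζ)`. -/
def mobius (a ζ : ℂ) : ℂ := (a - ζ) / (1 - conj a * ζ)

open ComplexConjugate in
/-- The (in general not holomorphic) involution `ϕ_a` of the Thullen domain, for `|a| < 1`. With
`m = (a - w₁) / (1 - ā w₁)`, it sends `w` to the point with first coordinate `m` and second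
coordinate
`w₂ (√(1-|a|²) / (1 - ā w₁)) √((1-|w₁|²)(1-|m|^{2/α}) / ((1-|w₁|^{2/α})(1-|m|²)))`. -/
def autoFst (α : ℝ) (a : ℂ) (w : ℂ × ℂ) : ℂ × ℂ :=
  (mobius a w.1,
    w.2 * ((√(1 - ‖a‖ ^ 2) : ℂ) / (1 - conj a * w.1)) *
      (√((1 - ‖w.1‖ ^ 2) * (1 - ‖mobius a w.1‖ ^ (2 / α)) /
        ((1 - ‖w.1‖ ^ (2 / α)) * (1 - ‖mobius a w.1‖ ^ 2))) : ℂ))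

/-- The Wirtinger derivative `∂g/∂ζ = (∂g/∂x - i ∂g/∂y) / 2`. -/
def wirtinger (g : ℂ → ℂ) (ζ : ℂ) : ℂ :=
  (fderiv ℝ g ζ 1 - Complex.I * fderiv ℝ g ζ Complex.I) / 2

/-- The holomorphic Jacobian determinant `J Φ = det (∂Φ_i/∂w_j)`. -/
def holJacobian (Φ : ℂ × ℂ → ℂ × ℂ) (w : ℂ × ℂ) : ℂ :=
  wirtinger (fun ζ => (Φ (ζ, w.2)).1) w.1 * wirtinger (fun ζ => (Φ (w.1, ζ)).2) w.2 -
    wirtinger (fun ζ => (Φ (w.1, ζ)).1) w.2 * wirtinger (fun ζ => (Φ (ζ, w.2)).2) w.1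

/-- `U_z f = (f ∘ φ_{z₂}) · J φ_{z₂}`. -/
def translU (α : ℝ) (z : ℂ × ℂ) (f : ℂ × ℂ → ℂ) (w : ℂ × ℂ) : ℂ :=
  f (autoSnd α z.2 w) * holJacobian (autoSnd α z.2) w

/-- `V_a f = (f ∘ ϕ_a) · J ϕ_a`. -/
def translV (α : ℝ) (a : ℂ) (f : ℂ × ℂ → ℂ) (w : ℂ × ℂ) : ℂ :=
  f (autoFst α a w) * holJacobian (autoFst α a) w

/-- `f_α(z) = z₁ / (1 - |z₂|²)^{α/2}`. -/
def fAlpha (α : ℝ) (z : ℂ × ℂ) : ℂ := z.1 / ((1 - ‖z.2‖ ^ 2) ^ (α / 2) : ℝ)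

/-- `sup_z ‖V_{f_α(z)} U_z T k_z‖_{L^p}`, the supremum over all `z` in the Thullen domain, for an
operator `T` that is defined on the span of the kernel functions. -/
def translSup (α : ℝ) (hα : 0 < α) (p : ℝ)
    (T : kernelSpan (thullen α hα) →ₗ[ℂ] bergmanSpace (thullen α hα)) : ℝ≥0∞ :=
  ⨆ z : thullen α hα,
    eLpNorm (translV α (fAlpha α z) (translU α z
      (bergmanSpace.rep (T (spanKernel (thullen α hα) z)))))
      (ENNReal.ofReal p) (volume.restrict (thullen α hα))

end

/-! Write Φ_z for `centerMap α z`, the composite φ_{z₂} ∘ ϕ_{f_α(z)}, which carries the origin to z,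
and J for its real Jacobian. Pointwise |V_{f_α(z)} U_z f| = |f ∘ Φ_z| J^{1/2}, so the hypotheses
bound the functions T k_z and T* k_z in L^p after recentring at z. Since (Tf)(z) = ⟨f, T* K_z⟩, the
operator T is dominated by the integral operator with kernel |T* K_z(w)|. Everything reduces to
Schur's test for this kernel and for its restriction to the pairs with d(z,w) > r.

For a row integral put w = Φ_z(u) and split the integrand as |T* k_z(Φ_z u)| J^{1/2} times ‖K_z‖
J^{1/2} h(Φ_z u), where h is the test function. If u is confined to a set V, Hölder's inequality
with exponents p, q and the leftover s = 1 - 1/p - 1/q > 0 on the indicator of V gives C |V|^s h(z)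
(`exists_row_bound`), provided that the second factor has L^q norm at most C h(z). Here h is a
product of powers of the defining function and of 1 - |z₂|², and the bound is of Forelli-Rudin type
(`exists_schur_pointwise_bound`, `exists_schurWeight_bound`). If h^q contains the defining function
to the power -t, integration over the fibres needs t < 1 and integration over the base needs t > 3q
- 3; hence q < 4/3, and 1/p + 1/q < 1 then forces p > 4. The columns of the matrix of T* are the
rows of that of T, which is why both hypotheses occur. With V the whole domain this yields the
bounded extension (`exists_extension`).

Smallness comes from the lower bound |⟨k_z, k_{Φ_z(u)}⟩|² ≥ c · defect(u)^{5+α}, uniform in z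
(`exists_overlap_lower_bound`): as r tends to 1, far pairs (z, Φ_z(u)) force u into a boundary layer
V of small measure (`exists_small_slices`), so the truncated kernel has small norm
(`exists_truncated_bound`). For z in F_j, the value at z of Tf - TPM_{1_{G_j}}f involves only points
w outside G_j, all of them far from z. Hence the error of the localized sum is dominated by the
truncated kernel, whatever the covering (`exists_localized_sum`).

Coverings exist by a packing argument: for the measure ‖K_w‖² dσ(w), balls of radius below 1 have
volume bounded above, and balls of any fixed radius have volume bounded below, uniformly in the
centre. All kernel formulas come from the disc z₂ = 0, where the kernel is a power series in z₁, and
are transported by the holomorphic automorphisms φ_b. -/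

noncomputable section

open MeasureTheory Metric Set Filter Topology
open TopologicalSpace (Opens)

/-! ## Disc automorphisms -/

section Mobius

open ComplexConjugate

/-- The modulus of the derivative of the disc automorphism `mobius a`. -/
def mobiusDensity (a ζ : ℂ) : ℝ := (1 - ‖a‖ ^ 2) / ‖1 - conj a * ζ‖ ^ 2

theorem one_sub_norm_sq_pos {a : ℂ} (ha : ‖a‖ < 1) : 0 < 1 - ‖a‖ ^ 2 := by
  nlinarith [norm_nonneg a]

theorem one_sub_conj_mul_ne_zero {a ζ : ℂ} (ha : ‖a‖ < 1) (hζ : ‖ζ‖ ≤ 1) :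
    1 - conj a * ζ ≠ 0 := by
  intro h
  have h1 : ‖conj a * ζ‖ = 1 := by
    rw [← sub_eq_zero.1 h]; simp
  rw [norm_mul, RCLike.norm_conj] at h1
  nlinarith [norm_nonneg a, norm_nonneg ζ]

theorem norm_one_sub_conj_mul_pos {a ζ : ℂ} (ha : ‖a‖ < 1) (hζ : ‖ζ‖ ≤ 1) :
    0 < ‖1 - conj a * ζ‖ := norm_pos_iff.2 (one_sub_conj_mul_ne_zero ha hζ)

theorem mobiusDensity_pos {a ζ : ℂ} (ha : ‖a‖ < 1) (hζ : ‖ζ‖ ≤ 1) : 0 < mobiusDensity a ζ :=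
  div_pos (one_sub_norm_sq_pos ha) (pow_pos (norm_one_sub_conj_mul_pos ha hζ) 2)

theorem conj_mul_self_eq (a : ℂ) : conj a * a = ((‖a‖ ^ 2 : ℝ) : ℂ) := by
  rw [mul_comm, Complex.mul_conj, Complex.normSq_eq_norm_sq]

theorem one_sub_conj_mul_mobius {a ζ : ℂ} (ha : ‖a‖ < 1) (hζ : ‖ζ‖ ≤ 1) :
    1 - conj a * mobius a ζ = ((1 - ‖a‖ ^ 2 : ℝ) : ℂ) / (1 - conj a * ζ) := by
  have h := one_sub_conj_mul_ne_zero ha hζ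
  have e := conj_mul_self_eq a
  rw [mobius, eq_div_iff h, sub_mul, mul_assoc, div_mul_cancel₀ _ h, Complex.ofReal_sub, ← e]
  push_cast
  ring

theorem one_sub_norm_mobius_sq {a ζ : ℂ} (ha : ‖a‖ < 1) (hζ : ‖ζ‖ ≤ 1) :
    1 - ‖mobius a ζ‖ ^ 2 = mobiusDensity a ζ * (1 - ‖ζ‖ ^ 2) := by
  have h := (norm_one_sub_conj_mul_pos ha hζ).ne'
  rw [mobius, mobiusDensity, norm_div, div_pow, div_mul_eq_mul_div, eq_div_iff (pow_ne_zero 2 h),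
    sub_mul, div_mul_cancel₀ _ (pow_ne_zero 2 h)]
  simp only [← Complex.normSq_eq_norm_sq, Complex.normSq_apply, Complex.sub_re, Complex.sub_im,
    Complex.mul_re, Complex.mul_im, Complex.conj_re, Complex.conj_im, Complex.one_re,
    Complex.one_im]
  ring

theorem norm_mobius_lt {a ζ : ℂ} (ha : ‖a‖ < 1) (hζ : ‖ζ‖ < 1) : ‖mobius a ζ‖ < 1 := by
  have h1 := one_sub_norm_mobius_sq ha hζ.le
  have h2 := mul_pos (mobiusDensity_pos ha hζ.le) (one_sub_norm_sq_pos hζ)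
  nlinarith [norm_nonneg (mobius a ζ)]

theorem mobius_mobius {a ζ : ℂ} (ha : ‖a‖ < 1) (hζ : ‖ζ‖ < 1) :
    mobius a (mobius a ζ) = ζ := by
  have h := one_sub_conj_mul_ne_zero ha hζ.le
  have h2 : ((1 - ‖a‖ ^ 2 : ℝ) : ℂ) ≠ 0 := by exact_mod_cast (one_sub_norm_sq_pos ha).ne'
  conv_lhs => rw [mobius, one_sub_conj_mul_mobius ha hζ.le]
  rw [div_div_eq_mul_div, div_eq_iff h2, mobius, sub_mul, div_mul_cancel₀ _ h, Complex.ofReal_sub,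
    ← conj_mul_self_eq]
  push_cast
  ring

theorem hasDerivAt_mobius {a ζ : ℂ} (ha : ‖a‖ < 1) (hζ : ‖ζ‖ ≤ 1) :
    HasDerivAt (mobius a) (-((1 - ‖a‖ ^ 2 : ℝ) : ℂ) / (1 - conj a * ζ) ^ 2) ζ := by
  have h := one_sub_conj_mul_ne_zero ha hζ
  have h1 : HasDerivAt (fun ζ => a - ζ) (-1) ζ := by
    simpa using (hasDerivAt_id ζ).const_sub a
  have h2 : HasDerivAt (fun ζ => 1 - conj a * ζ) (-conj a) ζ := by
    simpa using ((hasDerivAt_id ζ).const_mul (conj a)).const_sub 1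
  refine (h1.div h2 h).congr_deriv ?_
  rw [Complex.ofReal_sub, ← conj_mul_self_eq]
  push_cast
  ring

theorem norm_deriv_mobius {a ζ : ℂ} (ha : ‖a‖ < 1) :
    ‖-((1 - ‖a‖ ^ 2 : ℝ) : ℂ) / (1 - conj a * ζ) ^ 2‖ = mobiusDensity a ζ := by
  rw [norm_div, norm_neg, Complex.norm_real, Real.norm_of_nonneg (one_sub_norm_sq_pos ha).le,
    norm_pow, mobiusDensity]

theorem mobius_zero_right (a : ℂ) : mobius a 0 = a := by simp [mobius]

theorem det_restrictScalars_mul (d : ℂ) :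
    ((ContinuousLinearMap.toSpanSingleton ℂ d).restrictScalars ℝ).det = ‖d‖ ^ 2 := by
  have : (((ContinuousLinearMap.toSpanSingleton ℂ d).restrictScalars ℝ : ℂ →L[ℝ] ℂ) : ℂ →ₗ[ℝ] ℂ) =
      ((LinearMap.toSpanSingleton ℂ ℂ d).restrictScalars ℝ) := by
    ext; simp
  rw [ContinuousLinearMap.det, this, LinearMap.det_restrictScalars, LinearMap.det_ring]
  simp [Algebra.norm_complex_apply, Complex.normSq_eq_norm_sq]

theorem lintegral_image_complex {s : Set ℂ} {f f' : ℂ → ℂ} (hs : MeasurableSet s)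
    (hf : ∀ x ∈ s, HasDerivAt f (f' x) x) (hi : InjOn f s) (g : ℂ → ℝ≥0∞) :
    ∫⁻ x in f '' s, g x = ∫⁻ x in s, ENNReal.ofReal (‖f' x‖ ^ 2) * g (f x) := by
  rw [lintegral_image_eq_lintegral_abs_det_fderiv_mul volume hs
    (f' := fun x => (ContinuousLinearMap.toSpanSingleton ℂ (f' x)).restrictScalars ℝ)
    (fun x hx => ((hf x hx).hasFDerivAt.restrictScalars ℝ).hasFDerivWithinAt) hi]
  simp_rw [det_restrictScalars_mul, abs_pow, abs_norm]

theorem lintegral_mobius {a : ℂ} (ha : ‖a‖ < 1) (g : ℂ → ℝ≥0∞) :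
    ∫⁻ ζ in ball (0 : ℂ) 1, ENNReal.ofReal (mobiusDensity a ζ ^ 2) * g (mobius a ζ) =
      ∫⁻ ζ in ball (0 : ℂ) 1, g ζ := by
  have hm : MapsTo (mobius a) (ball 0 1) (ball 0 1) := fun ζ hζ => by
    rw [mem_ball_zero_iff] at *
    exact norm_mobius_lt ha hζ
  have hinv : ∀ ζ ∈ ball (0 : ℂ) 1, mobius a (mobius a ζ) = ζ := fun ζ hζ =>
    mobius_mobius ha (mem_ball_zero_iff.1 hζ)
  have him : mobius a '' ball 0 1 = ball 0 1 :=
    Subset.antisymm hm.image_subset fun ζ hζ => ⟨_, hm hζ, hinv ζ hζ⟩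
  have h := lintegral_image_complex (f := mobius a) measurableSet_ball
    (fun ζ hζ => hasDerivAt_mobius ha (mem_ball_zero_iff.1 hζ).le)
    (fun x hx y hy hxy => by rw [← hinv x hx, hxy, hinv y hy]) g
  rw [him] at h
  rw [h]
  simp_rw [norm_deriv_mobius ha]

theorem lintegral_comp_mul_complex {c : ℂ} (hc : c ≠ 0) (g : ℂ → ℝ≥0∞) :
    ENNReal.ofReal (‖c‖ ^ 2) * ∫⁻ ζ, g (ζ * c) = ∫⁻ ζ, g ζ := by
  have h := lintegral_image_complex (f := fun ζ => ζ * c) (f' := fun _ => c) MeasurableSet.univ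
    (fun ζ _ => by simpa using (hasDerivAt_id ζ).mul_const c)
    (mul_left_injective₀ hc).injOn g
  rw [image_univ, (mul_right_surjective₀ hc).range_eq, Measure.restrict_univ,
    lintegral_const_mul' _ _ ENNReal.ofReal_ne_top] at h
  exact h.symm

end Mobius

theorem wirtinger_of_hasDerivAt {g : ℂ → ℂ} {g' ζ : ℂ} (h : HasDerivAt g g' ζ) :
    wirtinger g ζ = g' := by
  have h1 : HasFDerivAt g ((ContinuousLinearMap.toSpanSingleton ℂ g').restrictScalars ℝ) ζ :=
    h.hasFDerivAt.restrictScalars ℝ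
  rw [wirtinger, h1.fderiv]
  simp only [ContinuousLinearMap.coe_restrictScalars', ContinuousLinearMap.toSpanSingleton_apply,
    smul_eq_mul, one_mul]
  rw [← mul_assoc, Complex.I_mul_I]
  ring

/-! ## The defining functions of the Thullen domain -/

/-- `1 - |ζ|^{2/α}`: the square of the radius of the fibre of the Thullen domain over `ζ`. -/
def fiberSq (α : ℝ) (ζ : ℂ) : ℝ := 1 - ‖ζ‖ ^ (2 / α)

/-- The defining function `1 - |z₁|^{2/α} - |z₂|²` of the Thullen domain. -/
def defect (α : ℝ) (z : ℂ × ℂ) : ℝ := fiberSq α z.1 - ‖z.2‖ ^ 2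

theorem rpow_two_div (α x : ℝ) (hx : 0 ≤ x) : x ^ (2 / α) = (x ^ 2) ^ (1 / α) := by
  rw [← Real.rpow_natCast, ← Real.rpow_mul hx]
  congr 1
  push_cast
  ring

/-- Bernoulli's inequality if e ≤ 1, and x ^ e ≤ x if e ≥ 1. -/
theorem min_mul_le_one_sub_rpow {e x : ℝ} (he : 0 ≤ e) (hx : 0 ≤ x) (hx1 : x ≤ 1) :
    min 1 e * (1 - x) ≤ 1 - x ^ e := by
  rcases le_total 1 e with h | h
  · rw [min_eq_left h]
    have := Real.rpow_le_rpow_of_exponent_ge' hx hx1 zero_le_one h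
    rw [Real.rpow_one] at this
    linarith
  · rw [min_eq_right h]
    have := rpow_one_add_le_one_add_mul_self (s := x - 1) (by linarith) he h
    rw [add_sub_cancel] at this
    linarith

theorem one_sub_rpow_le_max_mul {e x : ℝ} (he : 0 ≤ e) (hx : 0 ≤ x) (hx1 : x ≤ 1) :
    1 - x ^ e ≤ max 1 e * (1 - x) := by
  rcases le_total 1 e with h | h
  · rw [max_eq_right h]
    have := one_add_mul_self_le_rpow_one_add (s := x - 1) (by linarith) h
    rw [add_sub_cancel] at this
    linarith
  · rw [max_eq_left h]
    have := Real.rpow_le_rpow_of_exponent_ge' hx hx1 he h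
    rw [Real.rpow_one] at this
    linarith

/-- With the companion upper bound, this compares the fibres with those of the unit ball. On the
ball the Möbius maps act exactly; on the Thullen domain they act up to these constants. -/
theorem min_mul_le_fiberSq {α : ℝ} (hα : 0 < α) {ζ : ℂ} (hζ : ‖ζ‖ ≤ 1) :
    min 1 (1 / α) * (1 - ‖ζ‖ ^ 2) ≤ fiberSq α ζ := by
  rw [fiberSq, rpow_two_div α _ (norm_nonneg ζ)]
  exact min_mul_le_one_sub_rpow (by positivity) (by positivity) (pow_le_one₀ (norm_nonneg _) hζ)

theorem fiberSq_le_max_mul {α : ℝ} (hα : 0 < α) {ζ : ℂ} (hζ : ‖ζ‖ ≤ 1) :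
    fiberSq α ζ ≤ max 1 (1 / α) * (1 - ‖ζ‖ ^ 2) := by
  rw [fiberSq, rpow_two_div α _ (norm_nonneg ζ)]
  exact one_sub_rpow_le_max_mul (by positivity) (by positivity) (pow_le_one₀ (norm_nonneg _) hζ)

theorem min_one_div_pos {α : ℝ} (hα : 0 < α) : 0 < min 1 (1 / α) := by positivity

theorem max_one_div_pos (α : ℝ) : 0 < max 1 (1 / α) := by positivity

theorem fiberSq_pos {α : ℝ} (hα : 0 < α) {ζ : ℂ} (hζ : ‖ζ‖ < 1) : 0 < fiberSq α ζ :=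
  (mul_pos (min_one_div_pos hα) (one_sub_norm_sq_pos hζ)).trans_le (min_mul_le_fiberSq hα hζ.le)

theorem fiberSq_le_one (α : ℝ) (ζ : ℂ) : fiberSq α ζ ≤ 1 := by
  rw [fiberSq]
  linarith [Real.rpow_nonneg (norm_nonneg ζ) (2 / α)]

theorem mem_thullen_iff {α : ℝ} {hα : 0 < α} {z : ℂ × ℂ} : z ∈ thullen α hα ↔ 0 < defect α z := by
  change ‖z.1‖ ^ (2 / α) + ‖z.2‖ ^ 2 < 1 ↔ _
  rw [defect, fiberSq]
  constructor <;> intro h <;> linarith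

theorem norm_fst_lt_of_mem {α : ℝ} {hα : 0 < α} {z : ℂ × ℂ} (hz : z ∈ thullen α hα) :
    ‖z.1‖ < 1 := by
  by_contra! h
  have h1 := Real.one_le_rpow h (z := 2 / α) (by positivity)
  rw [mem_thullen_iff, defect, fiberSq] at hz
  nlinarith [sq_nonneg ‖z.2‖]

theorem norm_snd_lt_of_mem {α : ℝ} {hα : 0 < α} {z : ℂ × ℂ} (hz : z ∈ thullen α hα) :
    ‖z.2‖ < 1 := by
  rw [mem_thullen_iff, defect, fiberSq] at hz
  have := Real.rpow_nonneg (norm_nonneg z.1) (2 / α)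
  nlinarith [norm_nonneg z.2]

theorem continuous_fiberSq {α : ℝ} (hα : 0 < α) : Continuous (fiberSq α) := by
  have : Continuous fun x : ℝ => x ^ (2 / α) := Real.continuous_rpow_const (by positivity)
  unfold fiberSq
  fun_prop

theorem continuous_defect {α : ℝ} (hα : 0 < α) : Continuous (defect α) := by
  have := continuous_fiberSq hα
  unfold defect
  fun_prop

theorem measurable_mobius (a : ℂ) : Measurable (mobius a) := by
  unfold mobius
  fun_prop

theorem measurable_mobiusDensity (a : ℂ) : Measurable (mobiusDensity a) := by
  unfold mobiusDensity
  fun_prop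

/-! ## Fibred changes of variables -/

/-- Fubini: a disc automorphism in the base and, over each base point, multiplication by a nonzero
number in the fibre. -/
theorem lintegral_skew_snd {b : ℂ} (hb : ‖b‖ < 1) {c : ℂ → ℂ} (hc : Measurable c)
    (hc0 : ∀ ζ, ‖ζ‖ < 1 → c ζ ≠ 0) {G : ℂ × ℂ → ℝ≥0∞} (hG : Measurable G) :
    ∫⁻ w in univ ×ˢ ball (0 : ℂ) 1, ENNReal.ofReal (‖c w.2‖ ^ 2) *
      ENNReal.ofReal (mobiusDensity b w.2 ^ 2) * G (w.1 * c w.2, mobius b w.2) =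
    ∫⁻ w in univ ×ˢ ball (0 : ℂ) 1, G w := by
  have := measurable_mobius b
  have := measurable_mobiusDensity b
  rw [Measure.volume_eq_prod, setLIntegral_prod_symm _ (by fun_prop),
    setLIntegral_prod_symm _ (by fun_prop)]
  simp only [Measure.restrict_univ]
  rw [← lintegral_mobius hb fun ζ => ∫⁻ x, G (x, ζ)]
  refine setLIntegral_congr_fun measurableSet_ball fun ζ hζ => ?_
  rw [lintegral_const_mul' _ _ (by finiteness), mul_right_comm, mul_comm,
    lintegral_comp_mul_complex (hc0 ζ (mem_ball_zero_iff.1 hζ)) (fun x => G (x, mobius b ζ))]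

theorem lintegral_skew_fst {a : ℂ} (ha : ‖a‖ < 1) {c : ℂ → ℂ} (hc : Measurable c)
    (hc0 : ∀ ζ, ‖ζ‖ < 1 → c ζ ≠ 0) {G : ℂ × ℂ → ℝ≥0∞} (hG : Measurable G) :
    ∫⁻ w in ball (0 : ℂ) 1 ×ˢ univ, ENNReal.ofReal (‖c w.1‖ ^ 2) *
      ENNReal.ofReal (mobiusDensity a w.1 ^ 2) * G (mobius a w.1, w.2 * c w.1) =
    ∫⁻ w in ball (0 : ℂ) 1 ×ˢ univ, G w := by
  have := measurable_mobius a
  have := measurable_mobiusDensity a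
  rw [Measure.volume_eq_prod, setLIntegral_prod _ (by fun_prop),
    setLIntegral_prod _ (by fun_prop)]
  simp only [Measure.restrict_univ]
  rw [← lintegral_mobius ha fun ζ => ∫⁻ x, G (ζ, x)]
  refine setLIntegral_congr_fun measurableSet_ball fun ζ hζ => ?_
  rw [lintegral_const_mul' _ _ (by finiteness), mul_right_comm, mul_comm,
    lintegral_comp_mul_complex (hc0 ζ (mem_ball_zero_iff.1 hζ)) (fun x => G (mobius a ζ, x))]

/-! ## The automorphisms `autoSnd` -/

section AutoSnd

open ComplexConjugate

variable {α : ℝ} {b : ℂ}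

/-- The factor by which `autoSnd α b` multiplies the first coordinate. -/
def sndFactor (α : ℝ) (b ζ : ℂ) : ℂ := ((√(1 - ‖b‖ ^ 2) : ℂ) / (1 - conj b * ζ)) ^ (α : ℂ)

theorem autoSnd_eq (w : ℂ × ℂ) :
    autoSnd α b w = (w.1 * sndFactor α b w.2, mobius b w.2) := rfl

theorem norm_sqrt_div_sq (hb : ‖b‖ < 1) (ζ : ℂ) :
    ‖(√(1 - ‖b‖ ^ 2) : ℂ) / (1 - conj b * ζ)‖ ^ 2 = mobiusDensity b ζ := by
  rw [norm_div, Complex.norm_real, Real.norm_of_nonneg (Real.sqrt_nonneg _), div_pow,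
    Real.sq_sqrt (one_sub_norm_sq_pos hb).le, mobiusDensity]

theorem norm_sndFactor (hb : ‖b‖ < 1) (ζ : ℂ) :
    ‖sndFactor α b ζ‖ = mobiusDensity b ζ ^ (α / 2) := by
  rw [sndFactor, Complex.norm_cpow_real, ← norm_sqrt_div_sq hb]
  generalize (√(1 - ‖b‖ ^ 2) : ℂ) / (1 - conj b * ζ) = x
  rw [← Real.rpow_natCast, ← Real.rpow_mul (norm_nonneg _)]
  congr 1
  push_cast
  ring

theorem sndFactor_ne_zero (hb : ‖b‖ < 1) {ζ : ℂ} (hζ : ‖ζ‖ ≤ 1) : sndFactor α b ζ ≠ 0 := by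
  rw [← norm_pos_iff, norm_sndFactor hb]
  exact Real.rpow_pos_of_pos (mobiusDensity_pos hb hζ) _

theorem sndFactor_base_re_pos (hb : ‖b‖ < 1) {ζ : ℂ} (hζ : ‖ζ‖ ≤ 1) :
    0 < ((√(1 - ‖b‖ ^ 2) : ℂ) / (1 - conj b * ζ)).re := by
  have h := one_sub_conj_mul_ne_zero hb hζ
  have h1 : 0 < (1 - conj b * ζ).re := by
    have h2 : (conj b * ζ).re ≤ ‖conj b * ζ‖ := Complex.re_le_norm _
    rw [norm_mul, RCLike.norm_conj] at h2
    rw [Complex.sub_re, Complex.one_re]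
    nlinarith [norm_nonneg b, norm_nonneg ζ]
  rw [Complex.div_re, Complex.ofReal_im, Complex.ofReal_re]
  have := Real.sqrt_pos.2 (one_sub_norm_sq_pos hb)
  have := Complex.normSq_pos.2 h
  simp only [zero_mul, zero_div, add_zero]
  positivity

/-- The two bases are inverse to each other and lie in the open right half-plane, away from the
branch cut, so the principal power commutes with inversion. -/
theorem sndFactor_mobius_mul (hb : ‖b‖ < 1) {ζ : ℂ} (hζ : ‖ζ‖ < 1) :
    sndFactor α b ζ * sndFactor α b (mobius b ζ) = 1 := by
  have h := one_sub_conj_mul_ne_zero hb hζ.le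
  have h0 := one_sub_norm_sq_pos hb
  have hs : (√(1 - ‖b‖ ^ 2) : ℂ) ≠ 0 := by
    exact_mod_cast (Real.sqrt_pos.2 h0).ne'
  have e : (√(1 - ‖b‖ ^ 2) : ℂ) / (1 - conj b * mobius b ζ) =
      ((√(1 - ‖b‖ ^ 2) : ℂ) / (1 - conj b * ζ))⁻¹ := by
    rw [one_sub_conj_mul_mobius hb hζ.le]
    have : ((1 - ‖b‖ ^ 2 : ℝ) : ℂ) = (√(1 - ‖b‖ ^ 2) : ℂ) ^ 2 := by
      rw [← Complex.ofReal_pow, Real.sq_sqrt h0.le]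
    rw [this]
    field_simp
  have hp := sndFactor_base_re_pos hb hζ.le
  rw [sndFactor, sndFactor, e, Complex.inv_cpow, mul_inv_cancel₀]
  · rw [Complex.cpow_ne_zero_iff]
    exact Or.inl (div_ne_zero hs h)
  · intro h1
    rw [Complex.arg_eq_pi_iff] at h1
    linarith [h1.1]

theorem autoSnd_autoSnd (hb : ‖b‖ < 1) {w : ℂ × ℂ} (hw : ‖w.2‖ < 1) :
    autoSnd α b (autoSnd α b w) = w := by
  rw [autoSnd_eq, autoSnd_eq]
  refine Prod.ext ?_ (mobius_mobius hb hw)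
  simp only
  rw [mul_assoc, sndFactor_mobius_mul hb hw, mul_one]

theorem differentiableAt_sndFactor (hb : ‖b‖ < 1) {ζ : ℂ} (hζ : ‖ζ‖ < 1) :
    DifferentiableAt ℂ (sndFactor α b) ζ := by
  have h := one_sub_conj_mul_ne_zero hb hζ.le
  unfold sndFactor
  refine DifferentiableAt.cpow (by fun_prop (disch := assumption)) (by fun_prop) ?_
  exact Or.inl (sndFactor_base_re_pos hb hζ.le)

theorem measurable_sndFactor : Measurable (sndFactor α b) := by
  unfold sndFactor
  fun_prop

theorem fiberSq_mul_rpow (hα : 0 < α) {x : ℝ} (hx : 0 ≤ x) {ζ : ℂ} {s : ℂ}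
    (hs : ‖s‖ = x ^ (α / 2)) : ‖ζ * s‖ ^ (2 / α) = ‖ζ‖ ^ (2 / α) * x := by
  rw [norm_mul, Real.mul_rpow (norm_nonneg _) (norm_nonneg _), hs, ← Real.rpow_mul hx]
  congr 1
  rw [div_mul_div_comm, mul_comm, div_self (by positivity), Real.rpow_one]

/-- The exponent α of the factor is undone by the exponent 2/α of the domain, so both terms of the
defining function pick up the same Möbius density. -/
theorem defect_autoSnd (hα : 0 < α) (hb : ‖b‖ < 1) {w : ℂ × ℂ} (hw : ‖w.2‖ < 1) :
    defect α (autoSnd α b w) = mobiusDensity b w.2 * defect α w := by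
  have h1 := one_sub_norm_mobius_sq hb hw.le
  rw [autoSnd_eq, defect, defect, fiberSq, fiberSq]
  simp only
  rw [fiberSq_mul_rpow hα (mobiusDensity_pos hb hw.le).le (norm_sndFactor hb _)]
  linarith

theorem autoSnd_mem_iff {hα : 0 < α} (hb : ‖b‖ < 1) {w : ℂ × ℂ} (hw : ‖w.2‖ < 1) :
    autoSnd α b w ∈ thullen α hα ↔ w ∈ thullen α hα := by
  rw [mem_thullen_iff, mem_thullen_iff, defect_autoSnd hα hb hw]
  exact mul_pos_iff_of_pos_left (mobiusDensity_pos hb hw.le)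

theorem holJacobian_autoSnd (hb : ‖b‖ < 1) {w : ℂ × ℂ} (hw : ‖w.2‖ < 1) :
    holJacobian (autoSnd α b) w =
      sndFactor α b w.2 * (-((1 - ‖b‖ ^ 2 : ℝ) : ℂ) / (1 - conj b * w.2) ^ 2) := by
  rw [holJacobian]
  simp only [autoSnd_eq]
  rw [wirtinger_of_hasDerivAt (g' := sndFactor α b w.2)
      (by simpa using (hasDerivAt_id w.1).mul_const (sndFactor α b w.2)),
    wirtinger_of_hasDerivAt (hasDerivAt_mobius hb hw.le),
    wirtinger_of_hasDerivAt (hasDerivAt_const w.1 (mobius b w.2)), mul_zero, sub_zero]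

/-- The real Jacobian determinant of `autoSnd α b`. -/
def sndDensity (α : ℝ) (b : ℂ) (w : ℂ × ℂ) : ℝ := mobiusDensity b w.2 ^ (α + 2)

theorem sndDensity_eq (hb : ‖b‖ < 1) {w : ℂ × ℂ} (hw : ‖w.2‖ ≤ 1) :
    sndDensity α b w = ‖sndFactor α b w.2‖ ^ 2 * mobiusDensity b w.2 ^ 2 := by
  have h := mobiusDensity_pos hb hw
  rw [norm_sndFactor hb, sndDensity, ← Real.rpow_natCast, ← Real.rpow_mul h.le, ← Real.rpow_natCast,
    ← Real.rpow_add h]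
  congr 1
  push_cast
  ring

theorem norm_holJacobian_autoSnd_sq (hb : ‖b‖ < 1) {w : ℂ × ℂ} (hw : ‖w.2‖ < 1) :
    ‖holJacobian (autoSnd α b) w‖ ^ 2 = sndDensity α b w := by
  rw [holJacobian_autoSnd hb hw, norm_mul, mul_pow, norm_deriv_mobius hb, sndDensity_eq hb hw.le]

theorem holJacobian_autoSnd_mul (hb : ‖b‖ < 1) {w : ℂ × ℂ} (hw : ‖w.2‖ < 1) :
    holJacobian (autoSnd α b) (autoSnd α b w) * holJacobian (autoSnd α b) w = 1 := by
  have h := one_sub_conj_mul_ne_zero hb hw.le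
  have h0 : ((1 - ‖b‖ ^ 2 : ℝ) : ℂ) ≠ 0 := by exact_mod_cast (one_sub_norm_sq_pos hb).ne'
  have hw' : ‖(autoSnd α b w).2‖ < 1 := norm_mobius_lt hb hw
  rw [holJacobian_autoSnd hb hw, holJacobian_autoSnd hb hw']
  simp only [autoSnd_eq]
  rw [one_sub_conj_mul_mobius hb hw.le, mul_mul_mul_comm, mul_comm (sndFactor α b (mobius b w.2)),
    sndFactor_mobius_mul hb hw]
  field_simp

theorem measurable_sndDensity : Measurable (sndDensity α b) := by
  have := measurable_mobiusDensity b
  unfold sndDensity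
  fun_prop

theorem measurable_autoSnd : Measurable (autoSnd α b) := by
  have := measurable_mobius b
  have := measurable_sndFactor (α := α) (b := b)
  have e : autoSnd α b = fun w => (w.1 * sndFactor α b w.2, mobius b w.2) := rfl
  rw [e]
  fun_prop

/-- Measurability is asked only of the cut-off of G, because holomorphic representatives are
arbitrary outside the domain. -/
theorem lintegral_autoSnd {hα : 0 < α} (hb : ‖b‖ < 1) {G : ℂ × ℂ → ℝ≥0∞}
    (hG : Measurable ((thullen α hα : Set (ℂ × ℂ)).indicator G)) :
    ∫⁻ w in thullen α hα, ENNReal.ofReal (sndDensity α b w) * G (autoSnd α b w) =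
      ∫⁻ w in thullen α hα, G w := by
  have hm := (thullen α hα).isOpen.measurableSet
  have hsub : (thullen α hα : Set (ℂ × ℂ)) ⊆ univ ×ˢ ball (0 : ℂ) 1 := fun w hw =>
    ⟨mem_univ _, mem_ball_zero_iff.2 (norm_snd_lt_of_mem hw)⟩
  have key : ∀ H : ℂ × ℂ → ℝ≥0∞, ∫⁻ w in thullen α hα, H w =
      ∫⁻ w in univ ×ˢ ball (0 : ℂ) 1, (thullen α hα : Set (ℂ × ℂ)).indicator H w := fun H => by
    rw [setLIntegral_indicator hm, inter_eq_left.2 hsub]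
  rw [key, key, ← lintegral_skew_snd hb measurable_sndFactor
    (fun ζ hζ => sndFactor_ne_zero (α := α) hb hζ.le) hG]
  refine setLIntegral_congr_fun (MeasurableSet.univ.prod measurableSet_ball) fun w hw => ?_
  have hw2 : ‖w.2‖ < 1 := mem_ball_zero_iff.1 hw.2
  have hiff := autoSnd_mem_iff (hα := hα) hb hw2
  rw [autoSnd_eq] at hiff
  by_cases h : w ∈ (thullen α hα : Set (ℂ × ℂ))
  · rw [indicator_of_mem h, indicator_of_mem (hiff.2 h), sndDensity_eq hb hw2.le,
      ENNReal.ofReal_mul (by positivity), autoSnd_eq]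
  · rw [indicator_of_notMem h, indicator_of_notMem (fun h' => h (hiff.1 h')), mul_zero]

end AutoSnd

/-! ## The involutions `autoFst` -/

section AutoFst

open ComplexConjugate

variable {α : ℝ} {a : ℂ}

/-- The factor by which `autoFst α a` multiplies the second coordinate. -/
def fstFactor (α : ℝ) (a ζ : ℂ) : ℂ :=
  ((√(1 - ‖a‖ ^ 2) : ℂ) / (1 - conj a * ζ)) *
      (√((1 - ‖ζ‖ ^ 2) * (1 - ‖mobius a ζ‖ ^ (2 / α)) /
        ((1 - ‖ζ‖ ^ (2 / α)) * (1 - ‖mobius a ζ‖ ^ 2))) : ℂ)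

theorem autoFst_eq (w : ℂ × ℂ) :
    autoFst α a w = (mobius a w.1, w.2 * fstFactor α a w.1) := by
  rw [autoFst, fstFactor, mul_assoc]

/-- The quotient `R(m) / R(ζ)` of the squared fibre radii over `m = mobius a ζ` and `ζ`. -/
def fiberRatio (α : ℝ) (a ζ : ℂ) : ℝ := fiberSq α (mobius a ζ) / fiberSq α ζ

theorem fiberRatio_pos (hα : 0 < α) (ha : ‖a‖ < 1) {ζ : ℂ} (hζ : ‖ζ‖ < 1) :
    0 < fiberRatio α a ζ :=
  div_pos (fiberSq_pos hα (norm_mobius_lt ha hζ)) (fiberSq_pos hα hζ)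

/-- The square root in the definition corrects the ratio of fibre radii from that of the ball to
that of the Thullen domain, so that fibres are mapped onto fibres. -/
theorem norm_fstFactor_sq (hα : 0 < α) (ha : ‖a‖ < 1) {ζ : ℂ} (hζ : ‖ζ‖ < 1) :
    ‖fstFactor α a ζ‖ ^ 2 = fiberRatio α a ζ := by
  have h1 := fiberSq_pos hα hζ
  have h2 := fiberSq_pos hα (norm_mobius_lt ha hζ)
  have h3 := one_sub_norm_sq_pos hζ
  have h4 := one_sub_norm_sq_pos (norm_mobius_lt ha hζ)
  rw [fiberSq] at h1 h2
  rw [fstFactor, norm_mul, mul_pow, norm_sqrt_div_sq ha, Complex.norm_real,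
    Real.norm_of_nonneg (Real.sqrt_nonneg _), Real.sq_sqrt (by positivity),
    one_sub_norm_mobius_sq ha hζ.le, fiberRatio, fiberSq, fiberSq]
  have h5 := mobiusDensity_pos ha hζ.le
  field_simp

theorem fstFactor_ne_zero (hα : 0 < α) (ha : ‖a‖ < 1) {ζ : ℂ} (hζ : ‖ζ‖ < 1) :
    fstFactor α a ζ ≠ 0 := by
  intro h
  have := norm_fstFactor_sq hα ha hζ
  rw [h] at this
  simp only [norm_zero, ne_eq, OfNat.ofNat_ne_zero, not_false_eq_true, zero_pow] at this
  linarith [fiberRatio_pos hα ha hζ]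

theorem norm_autoFst_snd_sq (hα : 0 < α) (ha : ‖a‖ < 1) {w : ℂ × ℂ} (hw : ‖w.1‖ < 1) :
    ‖(autoFst α a w).2‖ ^ 2 = ‖w.2‖ ^ 2 * fiberRatio α a w.1 := by
  rw [autoFst_eq]
  simp only
  rw [norm_mul, mul_pow, norm_fstFactor_sq hα ha hw]

theorem defect_autoFst (hα : 0 < α) (ha : ‖a‖ < 1) {w : ℂ × ℂ} (hw : ‖w.1‖ < 1) :
    defect α (autoFst α a w) = fiberRatio α a w.1 * defect α w := by
  have h1 := fiberSq_pos hα hw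
  rw [defect, norm_autoFst_snd_sq hα ha hw, defect, autoFst_eq, fiberRatio]
  field_simp

theorem autoFst_mem_iff {hα : 0 < α} (ha : ‖a‖ < 1) {w : ℂ × ℂ} (hw : ‖w.1‖ < 1) :
    autoFst α a w ∈ thullen α hα ↔ w ∈ thullen α hα := by
  rw [mem_thullen_iff, mem_thullen_iff, defect_autoFst hα ha hw]
  exact mul_pos_iff_of_pos_left (fiberRatio_pos hα ha hw)

/-- The second coordinate depends on w₁ in a non-holomorphic way, but that derivative is multiplied
by ∂m/∂w₂ = 0. -/
theorem holJacobian_autoFst (ha : ‖a‖ < 1) {w : ℂ × ℂ} (hw : ‖w.1‖ < 1) :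
    holJacobian (autoFst α a) w =
      (-((1 - ‖a‖ ^ 2 : ℝ) : ℂ) / (1 - conj a * w.1) ^ 2) * fstFactor α a w.1 := by
  rw [holJacobian]
  simp only [autoFst_eq]
  rw [wirtinger_of_hasDerivAt (hasDerivAt_mobius ha hw.le),
    wirtinger_of_hasDerivAt (g' := fstFactor α a w.1)
      (by simpa using (hasDerivAt_id w.2).mul_const (fstFactor α a w.1)),
    wirtinger_of_hasDerivAt (hasDerivAt_const w.2 (mobius a w.1)), zero_mul, sub_zero]

/-- The real Jacobian determinant of `autoFst α a`. -/
def fstDensity (α : ℝ) (a : ℂ) (w : ℂ × ℂ) : ℝ := mobiusDensity a w.1 ^ 2 * fiberRatio α a w.1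

/-- The identity |J|² = real Jacobian survives without holomorphy: the real derivative is block
triangular with complex-linear diagonal blocks. Together with `lintegral_autoFst` it makes V_a
preserve L² norms. -/
theorem norm_holJacobian_autoFst_sq (hα : 0 < α) (ha : ‖a‖ < 1) {w : ℂ × ℂ} (hw : ‖w.1‖ < 1) :
    ‖holJacobian (autoFst α a) w‖ ^ 2 = fstDensity α a w := by
  rw [holJacobian_autoFst ha hw, norm_mul, mul_pow, norm_deriv_mobius ha,
    norm_fstFactor_sq hα ha hw, fstDensity]

theorem measurable_fiberRatio (hα : 0 < α) : Measurable (fiberRatio α a) := by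
  have := (continuous_fiberSq hα).measurable
  have := measurable_mobius a
  unfold fiberRatio
  fun_prop

theorem measurable_fstDensity (hα : 0 < α) : Measurable (fstDensity α a) := by
  have := measurable_mobiusDensity a
  have := measurable_fiberRatio (a := a) hα
  unfold fstDensity
  fun_prop

theorem measurable_fstFactor : Measurable (fstFactor α a) := by
  have := measurable_mobius a
  unfold fstFactor
  fun_prop

theorem measurable_autoFst : Measurable (autoFst α a) := by
  have := measurable_mobius a
  have := measurable_fstFactor (α := α) (a := a)
  have e : autoFst α a = fun w => (mobius a w.1, w.2 * fstFactor α a w.1) :=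
    funext fun w => autoFst_eq w
  rw [e]
  fun_prop

theorem lintegral_autoFst {hα : 0 < α} (ha : ‖a‖ < 1) {G : ℂ × ℂ → ℝ≥0∞}
    (hG : Measurable ((thullen α hα : Set (ℂ × ℂ)).indicator G)) :
    ∫⁻ w in thullen α hα, ENNReal.ofReal (fstDensity α a w) * G (autoFst α a w) =
      ∫⁻ w in thullen α hα, G w := by
  have hm := (thullen α hα).isOpen.measurableSet
  have hsub : (thullen α hα : Set (ℂ × ℂ)) ⊆ ball (0 : ℂ) 1 ×ˢ univ := fun w hw =>
    ⟨mem_ball_zero_iff.2 (norm_fst_lt_of_mem hw), mem_univ _⟩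
  have key : ∀ H : ℂ × ℂ → ℝ≥0∞, ∫⁻ w in thullen α hα, H w =
      ∫⁻ w in ball (0 : ℂ) 1 ×ˢ univ, (thullen α hα : Set (ℂ × ℂ)).indicator H w := fun H => by
    rw [setLIntegral_indicator hm, inter_eq_left.2 hsub]
  rw [key, key, ← lintegral_skew_fst ha measurable_fstFactor
    (fun ζ hζ => fstFactor_ne_zero hα ha hζ) hG]
  refine setLIntegral_congr_fun (measurableSet_ball.prod MeasurableSet.univ) fun w hw => ?_
  have hw2 : ‖w.1‖ < 1 := mem_ball_zero_iff.1 hw.1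
  have hiff := autoFst_mem_iff (hα := hα) ha hw2
  rw [autoFst_eq] at hiff
  by_cases h : w ∈ (thullen α hα : Set (ℂ × ℂ))
  · rw [indicator_of_mem h, indicator_of_mem (hiff.2 h), fstDensity,
      ENNReal.ofReal_mul (by positivity), autoFst_eq, norm_fstFactor_sq hα ha hw2,
      mul_comm (ENNReal.ofReal _) (ENNReal.ofReal _)]
  · rw [indicator_of_notMem h, indicator_of_notMem (fun h' => h (hiff.1 h')), mul_zero]

end AutoFst

/-! ## The composite maps that send the origin to a given point -/

section CenterMap

variable {α : ℝ}

theorem norm_fAlpha {z : ℂ × ℂ} (hz : ‖z.2‖ < 1) :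
    ‖fAlpha α z‖ = ‖z.1‖ / (1 - ‖z.2‖ ^ 2) ^ (α / 2) := by
  have := Real.rpow_pos_of_pos (one_sub_norm_sq_pos hz) (α / 2)
  rw [fAlpha, norm_div, Complex.norm_real, Real.norm_of_nonneg this.le]

/-- The point (f_α(z), 0) is the one that φ_{z₂} carries to z; this is the transformation law of the
defining function at that point. -/
theorem fiberSq_fAlpha (hα : 0 < α) {z : ℂ × ℂ} (hz : ‖z.2‖ < 1) :
    fiberSq α (fAlpha α z) * (1 - ‖z.2‖ ^ 2) = defect α z := by
  have h := one_sub_norm_sq_pos hz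
  have e : α / 2 * (2 / α) = 1 := by field_simp
  rw [fiberSq, norm_fAlpha hz, Real.div_rpow (norm_nonneg _) (by positivity), ← Real.rpow_mul h.le,
    e, Real.rpow_one, defect, fiberSq]
  field_simp
  ring

theorem norm_fAlpha_lt {hα : 0 < α} {z : ℂ × ℂ} (hz : z ∈ thullen α hα) : ‖fAlpha α z‖ < 1 := by
  have h2 := norm_snd_lt_of_mem hz
  have h := one_sub_norm_sq_pos h2
  have h3 := fiberSq_fAlpha hα h2
  rw [mem_thullen_iff, ← h3] at hz
  by_contra! h1
  have h4 := Real.one_le_rpow h1 (z := 2 / α) (by positivity)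
  have : fiberSq α (fAlpha α z) ≤ 0 := by rw [fiberSq]; linarith
  nlinarith

/-- The map `φ_{z₂} ∘ ϕ_{f_α(z)}` of the Thullen domain, which sends the origin to `z`. -/
def centerMap (α : ℝ) (z u : ℂ × ℂ) : ℂ × ℂ := autoSnd α z.2 (autoFst α (fAlpha α z) u)

/-- The real Jacobian determinant of `centerMap α z`. -/
def centerDensity (α : ℝ) (z u : ℂ × ℂ) : ℝ :=
  sndDensity α z.2 (autoFst α (fAlpha α z) u) * fstDensity α (fAlpha α z) u

variable {hα : 0 < α} {z u : ℂ × ℂ}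

theorem autoFst_fAlpha_mem (hz : z ∈ thullen α hα) (hu : u ∈ thullen α hα) :
    autoFst α (fAlpha α z) u ∈ thullen α hα :=
  (autoFst_mem_iff (norm_fAlpha_lt hz) (norm_fst_lt_of_mem hu)).2 hu

theorem centerMap_mem (hz : z ∈ thullen α hα) (hu : u ∈ thullen α hα) :
    centerMap α z u ∈ thullen α hα :=
  (autoSnd_mem_iff (norm_snd_lt_of_mem hz)
    (norm_snd_lt_of_mem (autoFst_fAlpha_mem hz hu))).2 (autoFst_fAlpha_mem hz hu)

theorem centerDensity_pos (hz : z ∈ thullen α hα) (hu : u ∈ thullen α hα) :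
    0 < centerDensity α z u := by
  have ha := norm_fAlpha_lt hz
  have hu1 := norm_fst_lt_of_mem hu
  refine mul_pos (Real.rpow_pos_of_pos (mobiusDensity_pos (norm_snd_lt_of_mem hz)
    (norm_snd_lt_of_mem (autoFst_fAlpha_mem hz hu)).le) _) (mul_pos (pow_pos
    (mobiusDensity_pos ha hu1.le) 2) (fiberRatio_pos hα ha hu1))

/-- The link with the hypotheses: U and V enter only through moduli, as recentring by `centerMap`
and the square root of its Jacobian. -/
theorem norm_translV_translU (hz : z ∈ thullen α hα) (hu : u ∈ thullen α hα)
    (f : ℂ × ℂ → ℂ) :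
    ‖translV α (fAlpha α z) (translU α z f) u‖ =
      ‖f (centerMap α z u)‖ * √(centerDensity α z u) := by
  rw [translV, translU, centerDensity, ← norm_holJacobian_autoSnd_sq (norm_snd_lt_of_mem hz)
    (norm_snd_lt_of_mem (autoFst_fAlpha_mem hz hu)),
    ← norm_holJacobian_autoFst_sq hα (norm_fAlpha_lt hz) (norm_fst_lt_of_mem hu), ← mul_pow,
    Real.sqrt_sq (by positivity), norm_mul, norm_mul, mul_assoc]
  rfl

theorem measurable_centerMap (z : ℂ × ℂ) : Measurable (centerMap α z) :=
  measurable_autoSnd.comp measurable_autoFst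

theorem measurable_centerDensity (hα : 0 < α) (z : ℂ × ℂ) : Measurable (centerDensity α z) :=
  (measurable_sndDensity.comp measurable_autoFst).mul (measurable_fstDensity hα)

theorem lintegral_centerMap (hz : z ∈ thullen α hα) {G : ℂ × ℂ → ℝ≥0∞}
    (hG : Measurable ((thullen α hα : Set (ℂ × ℂ)).indicator G)) :
    ∫⁻ u in thullen α hα, ENNReal.ofReal (centerDensity α z u) * G (centerMap α z u) =
      ∫⁻ w in thullen α hα, G w := by
  have hm := (thullen α hα).isOpen.measurableSet
  have hb := norm_snd_lt_of_mem hz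
  have ha := norm_fAlpha_lt hz
  rw [← lintegral_autoSnd hb hG, ← lintegral_autoFst ha
    (G := fun w => ENNReal.ofReal (sndDensity α z.2 w) * G (autoSnd α z.2 w))]
  · refine setLIntegral_congr_fun hm fun u hu => ?_
    have h0 : 0 ≤ fstDensity α (fAlpha α z) u := by
      rw [← norm_holJacobian_autoFst_sq hα ha (norm_fst_lt_of_mem hu)]; positivity
    rw [centerDensity, ENNReal.ofReal_mul' h0, ← mul_assoc, centerMap,
      mul_comm (ENNReal.ofReal (sndDensity _ _ _))]
  · have h1 := measurable_sndDensity (α := α) (b := z.2)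
    have h2 := hG.comp (measurable_autoSnd (α := α) (b := z.2))
    have e : (thullen α hα : Set (ℂ × ℂ)).indicator (fun w =>
        ENNReal.ofReal (sndDensity α z.2 w) * G (autoSnd α z.2 w)) =
        (thullen α hα : Set (ℂ × ℂ)).indicator (fun w => ENNReal.ofReal (sndDensity α z.2 w) *
          (((thullen α hα : Set (ℂ × ℂ)).indicator G) ∘ autoSnd α z.2) w) := by
      refine indicator_congr fun w hw => ?_
      rw [Function.comp, indicator_of_mem ((autoSnd_mem_iff hb (norm_snd_lt_of_mem hw)).2 hw)]
    rw [e]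
    exact (h1.ennreal_ofReal.mul h2).indicator hm

end CenterMap

/-! ## Integral estimates on the disc -/

section DiscIntegrals

open ComplexConjugate

/-- For |θ| ≤ π/2 the distance from 1 to the ray of angle θ is |sin θ| ≥ 2|θ|/π; for larger angles
the point has nonpositive real part, so its distance to 1 is at least 1. -/
theorem abs_le_norm_one_sub_mul_exp {r θ : ℝ} (hr : 0 ≤ r) (hθ : θ ∈ Ioo (-Real.pi) Real.pi) :
    |θ| / Real.pi ≤ ‖1 - (r : ℂ) * (Real.cos θ + Real.sin θ * Complex.I)‖ := by
  have hpi := Real.pi_pos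
  have habs : |θ| ≤ Real.pi := abs_le.2 ⟨hθ.1.le, hθ.2.le⟩
  have e : ‖1 - (r : ℂ) * (Real.cos θ + Real.sin θ * Complex.I)‖ ^ 2 =
      (1 - r * Real.cos θ) ^ 2 + (r * Real.sin θ) ^ 2 := by
    have : 1 - (r : ℂ) * (Real.cos θ + Real.sin θ * Complex.I) =
      ((1 - r * Real.cos θ : ℝ) : ℂ) + ((-(r * Real.sin θ) : ℝ) : ℂ) * Complex.I := by
      push_cast; ring
    rw [this, ← Complex.normSq_eq_norm_sq, Complex.normSq_add_mul_I]
    ring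
  have hsc := Real.sin_sq_add_cos_sq θ
  refine abs_le_of_sq_le_sq' ?_ (norm_nonneg _) |>.2
  rw [e, div_pow, div_le_iff₀ (by positivity)]
  rcases le_total |θ| (Real.pi / 2) with h | h
  · have h1 := Real.mul_le_sin (abs_nonneg θ) h
    have h2 : Real.sin |θ| ^ 2 = Real.sin θ ^ 2 := by
      rcases abs_choice θ with h | h <;> rw [h]
      rw [Real.sin_neg, neg_sq]
    have h3 : 2 / Real.pi * |θ| * Real.pi = 2 * |θ| := by field_simp
    have h4 : (2 * |θ|) ≤ Real.sin |θ| * Real.pi := by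
      rw [← h3]; gcongr
    have h5 : (2 * |θ|) ^ 2 ≤ (Real.sin |θ| * Real.pi) ^ 2 := by gcongr
    rw [mul_pow (Real.sin |θ|), h2] at h5
    have h6 : Real.sin θ ^ 2 ≤ (1 - r * Real.cos θ) ^ 2 + (r * Real.sin θ) ^ 2 := by
      nlinarith [sq_nonneg (r - Real.cos θ)]
    nlinarith [sq_nonneg θ, sq_abs θ, sq_nonneg Real.pi]
  · have hc : Real.cos θ ≤ 0 := by
      rw [← Real.cos_abs]
      exact Real.cos_nonpos_of_pi_div_two_le_of_le h (by linarith)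
    have h1 : 1 ≤ (1 - r * Real.cos θ) ^ 2 + (r * Real.sin θ) ^ 2 := by
      nlinarith [mul_nonneg hr (neg_nonneg.2 hc), sq_nonneg (r * Real.sin θ)]
    have h2 : |θ| ^ 2 ≤ Real.pi ^ 2 := by gcongr
    nlinarith [sq_nonneg Real.pi]

theorem lintegral_abs_rpow_lt_top {s : ℝ} (hs : s < 1) :
    ∫⁻ θ in Ioo (-Real.pi) Real.pi, ENNReal.ofReal ((|θ| / Real.pi) ^ (-s)) < ∞ := by
  have hpi := Real.pi_pos
  have h : IntegrableOn (fun θ : ℝ => (|θ| / Real.pi) ^ (-s)) (ball 0 Real.pi) := by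
    refine integrableOn_ball_of_norm_le_rpow (C := Real.pi ^ s) (α := s) (by simp)
      (by simpa using hs) (ae_of_all _ fun θ => ?_) ?_
    swap
    · exact Measurable.aestronglyMeasurable (by fun_prop)
    · rw [Real.norm_of_nonneg (by positivity), Real.div_rpow (abs_nonneg _) hpi.le,
        Real.rpow_neg hpi.le, div_inv_eq_mul, mul_comm, Real.norm_eq_abs]
  have e : ball (0 : ℝ) Real.pi = Ioo (-Real.pi) Real.pi := by simp [Real.ball_eq_Ioo]
  rw [e] at h
  have := h.lintegral_lt_top
  exact this

theorem lintegral_one_sub_rpow_lt_top {s : ℝ} (hs : s < 1) :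
    ∫⁻ r in Ioo (0 : ℝ) 1, ENNReal.ofReal ((1 - r) ^ (-s)) < ∞ := by
  have h := (intervalIntegral.intervalIntegrable_rpow' (a := 0) (b := 1) (r := -s)
    (by linarith)).comp_sub_left 1
  simp only [sub_zero, sub_self] at h
  have h2 := h.symm.1.mono_set Ioo_subset_Ioc_self
  exact h2.lintegral_lt_top

/-- The set of complex numbers of modulus one acts on integrals over the plane. -/
theorem exists_norm_eq_mul (c : ℂ) : ∃ e : ℂ, ‖e‖ = 1 ∧ e * c = ‖c‖ := by
  rcases eq_or_ne c 0 with rfl | h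
  · exact ⟨1, by simp⟩
  · have h' : (‖c‖ : ℂ) ≠ 0 := by exact_mod_cast norm_ne_zero_iff.2 h
    refine ⟨‖c‖ / c, ?_, by field_simp⟩
    rw [norm_div, Complex.norm_real, norm_norm, div_self (norm_ne_zero_iff.2 h)]

/-- After a rotation making c nonnegative, polar coordinates bound the integrand by |θ/π|^(-2/3)
(1-r)^(-s), a product of integrable functions not depending on c. -/
theorem exists_disc_fiber_bound {s : ℝ} (hs0 : 0 ≤ s) (hs : s < 1) : ∃ C : ℝ≥0∞, C < ∞ ∧
    ∀ c : ℂ, ‖c‖ ≤ 1 → ∫⁻ ξ in ball (0 : ℂ) 1,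
      ENNReal.ofReal (‖1 - c * ξ‖ ^ (-(2 / 3) : ℝ) * (1 - ‖ξ‖ ^ 2) ^ (-s)) ≤ C := by
  refine ⟨(∫⁻ r in Ioo (0 : ℝ) 1, ENNReal.ofReal ((1 - r) ^ (-s))) *
    ∫⁻ θ in Ioo (-Real.pi) Real.pi, ENNReal.ofReal ((|θ| / Real.pi) ^ (-(2 / 3) : ℝ)),
    ENNReal.mul_lt_top (lintegral_one_sub_rpow_lt_top hs)
      (lintegral_abs_rpow_lt_top (by norm_num)), fun c hc => ?_⟩
  obtain ⟨e, he, hec⟩ := exists_norm_eq_mul c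
  have he0 : e ≠ 0 := by rw [← norm_pos_iff, he]; exact one_pos
  rw [← lintegral_indicator measurableSet_ball, ← lintegral_comp_mul_complex he0,
    lintegral_ball_polar]
  swap
  · refine (Measurable.indicator ?_ measurableSet_ball).comp (by fun_prop)
    fun_prop
  rw [he, one_pow, ENNReal.ofReal_one, one_mul, ← lintegral_mul_const']
  swap
  · exact (lintegral_abs_rpow_lt_top (by norm_num)).ne
  rw [← lintegral_indicator measurableSet_Ioi, ← lintegral_indicator measurableSet_Ioo]
  refine lintegral_mono fun r => ?_
  by_cases hr : 0 < r
  swap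
  · rw [indicator_of_notMem (show r ∉ Ioi 0 from hr)]
    exact zero_le
  rw [indicator_of_mem (show r ∈ Ioi 0 from hr)]
  have hn : ∀ θ : ℝ, ‖(r : ℂ) * (Real.cos θ + Real.sin θ * Complex.I) * e‖ = r := fun θ => by
    rw [norm_mul, he, mul_one, norm_mul, Complex.ofReal_cos,
      Complex.ofReal_sin, ← Complex.exp_mul_I, Complex.norm_exp_ofReal_mul_I, mul_one,
      Complex.norm_real, Real.norm_of_nonneg hr.le]
  by_cases hr1 : r < 1
  swap
  · have : ∀ θ : ℝ, (r : ℂ) * (Real.cos θ + Real.sin θ * Complex.I) * e ∉ ball (0 : ℂ) 1 :=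
      fun θ => by rw [mem_ball_zero_iff, hn]; exact hr1
    simp only [indicator_of_notMem (this _), lintegral_zero, mul_zero]
    exact zero_le
  rw [indicator_of_mem (show r ∈ Ioo 0 1 from ⟨hr, hr1⟩), ← lintegral_const_mul' _ _ (by finiteness),
    ← lintegral_const_mul' _ _ (by finiteness)]
  refine setLIntegral_mono_ae' measurableSet_Ioo ?_
  -- The angle 0 is discarded because negative powers are decreasing only on positive bases.
  filter_upwards [compl_mem_ae_iff.2 (measure_singleton (0 : ℝ))] with θ hθ0 hθ
  replace hθ0 : θ ≠ 0 := hθ0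
  have hmem : (r : ℂ) * (Real.cos θ + Real.sin θ * Complex.I) * e ∈ ball (0 : ℂ) 1 := by
    rw [mem_ball_zero_iff, hn]; exact hr1
  rw [indicator_of_mem hmem, hn, ← ENNReal.ofReal_mul hr.le,
    ← ENNReal.ofReal_mul (Real.rpow_nonneg (by linarith) _)]
  refine ENNReal.ofReal_le_ofReal ?_
  have hc2 : c * ((r : ℂ) * (Real.cos θ + Real.sin θ * Complex.I) * e) =
      ((‖c‖ * r : ℝ) : ℂ) * (Real.cos θ + Real.sin θ * Complex.I) := by
    push_cast
    rw [← hec]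
    ring
  rw [hc2]
  have h1 := abs_le_norm_one_sub_mul_exp (mul_nonneg (norm_nonneg c) hr.le) hθ
  have h2 : ‖1 - ((‖c‖ * r : ℝ) : ℂ) * (Real.cos θ + Real.sin θ * Complex.I)‖ ^ (-(2 / 3) : ℝ) ≤
      (|θ| / Real.pi) ^ (-(2 / 3) : ℝ) :=
    Real.rpow_le_rpow_of_nonpos (div_pos (abs_pos.2 hθ0) Real.pi_pos) h1 (by norm_num)
  have h3 : (1 - r ^ 2) ^ (-s) ≤ (1 - r) ^ (-s) :=
    Real.rpow_le_rpow_of_nonpos (by linarith) (by nlinarith) (by linarith)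
  have h4 : 0 ≤ (1 - r ^ 2) ^ (-s) := Real.rpow_nonneg (by nlinarith) _
  calc r * (_ * (1 - r ^ 2) ^ (-s)) ≤ 1 * ((|θ| / Real.pi) ^ (-(2 / 3) : ℝ) * (1 - r) ^ (-s)) := by
        gcongr
    _ = _ := by ring

theorem lintegral_norm_rpow_ball_lt_top {s : ℝ} (hs : s < 2) :
    ∫⁻ ζ in ball (0 : ℂ) 1, ENNReal.ofReal (‖ζ‖ ^ (-s)) < ∞ := by
  have h : IntegrableOn (fun ζ : ℂ => ‖ζ‖ ^ (-s)) (ball 0 1) := by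
    refine integrableOn_ball_of_norm_le_rpow (C := 1) (α := s) (by simp)
      (by simpa using hs) (ae_of_all _ fun θ => ?_) ?_
    swap
    · exact Measurable.aestronglyMeasurable (by fun_prop)
    · rw [Real.norm_of_nonneg (by positivity), one_mul]
  exact h.lintegral_lt_top

/-- Where |1 - āζ| ≥ 1/2 the integrand is at most 2^s. Elsewhere |a| > 1/2 and |1 - āζ| = |a||ζ -
1/ā|, with ζ - 1/ā in the unit disc; translation then leads to the integral of |ζ|^(-s), uniformly
in a. -/
theorem exists_one_sub_conj_mul_bound {s : ℝ} (hs0 : 0 ≤ s) (hs : s < 2) : ∃ C : ℝ≥0∞, C < ∞ ∧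
    ∀ a : ℂ, ‖a‖ < 1 → ∫⁻ ζ in ball (0 : ℂ) 1, ENNReal.ofReal (‖1 - conj a * ζ‖ ^ (-s)) ≤ C := by
  have hI := lintegral_norm_rpow_ball_lt_top hs
  refine ⟨ENNReal.ofReal (2 ^ s) * (volume (ball (0 : ℂ) 1) +
    ∫⁻ ζ in ball (0 : ℂ) 1, ENNReal.ofReal (‖ζ‖ ^ (-s))), ?_, fun a ha => ?_⟩
  · exact ENNReal.mul_lt_top ENNReal.ofReal_lt_top
      (ENNReal.add_lt_top.2 ⟨measure_ball_lt_top, hI⟩)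
  have hpt : ∀ ζ ∈ ball (0 : ℂ) 1, ENNReal.ofReal (‖1 - conj a * ζ‖ ^ (-s)) ≤
      ENNReal.ofReal (2 ^ s) * (1 + (ball (0 : ℂ) 1).indicator
        (fun ζ => ENNReal.ofReal (‖ζ‖ ^ (-s))) (ζ - (conj a)⁻¹)) := by
    intro ζ hζ
    rw [mem_ball_zero_iff] at hζ
    by_cases h : 1 / 2 ≤ ‖1 - conj a * ζ‖
    · refine le_mul_of_le_of_one_le (ENNReal.ofReal_le_ofReal ?_) le_self_add
      calc ‖1 - conj a * ζ‖ ^ (-s) ≤ (1 / 2) ^ (-s) :=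
            Real.rpow_le_rpow_of_nonpos (by norm_num) h (by linarith)
        _ = 2 ^ s := by rw [one_div, Real.inv_rpow (by norm_num), Real.rpow_neg (by norm_num),
            inv_inv]
    · push Not at h
      have ha2 : 1 / 2 < ‖a‖ := by
        have h1 : ‖(1 : ℂ)‖ ≤ ‖1 - conj a * ζ‖ + ‖conj a * ζ‖ := by
          simpa using norm_add_le (1 - conj a * ζ) (conj a * ζ)
        rw [norm_one, norm_mul, RCLike.norm_conj] at h1
        nlinarith [norm_nonneg a, norm_nonneg ζ]
      have ha0 : conj a ≠ 0 := by
        rw [← norm_pos_iff, RCLike.norm_conj]; linarith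
      have e : ‖1 - conj a * ζ‖ = ‖a‖ * ‖ζ - (conj a)⁻¹‖ := by
        rw [← RCLike.norm_conj a, ← norm_mul, mul_sub, mul_inv_cancel₀ ha0, norm_sub_rev]
      have hpos := norm_one_sub_conj_mul_pos ha hζ.le
      have hpos2 : 0 < ‖ζ - (conj a)⁻¹‖ := by
        rw [e] at hpos
        exact pos_of_mul_pos_right hpos (norm_nonneg _)
      have hmem : ζ - (conj a)⁻¹ ∈ ball (0 : ℂ) 1 := by
        rw [mem_ball_zero_iff]
        rw [e] at h
        nlinarith
      rw [indicator_of_mem hmem]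
      refine le_trans ?_ (mul_le_mul_right le_add_self _)
      rw [← ENNReal.ofReal_mul (by positivity)]
      refine ENNReal.ofReal_le_ofReal ?_
      rw [e]
      calc (‖a‖ * ‖ζ - (conj a)⁻¹‖) ^ (-s) ≤ ((1 / 2) * ‖ζ - (conj a)⁻¹‖) ^ (-s) :=
            Real.rpow_le_rpow_of_nonpos (by positivity) (by gcongr) (by linarith)
        _ = 2 ^ s * ‖ζ - (conj a)⁻¹‖ ^ (-s) := by
            rw [Real.mul_rpow (by norm_num) (norm_nonneg _), one_div, Real.inv_rpow (by norm_num),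
              Real.rpow_neg (by norm_num), inv_inv]
  refine (setLIntegral_mono' measurableSet_ball hpt).trans ?_
  rw [lintegral_const_mul' _ _ ENNReal.ofReal_ne_top, lintegral_add_left measurable_const,
    setLIntegral_const, one_mul]
  refine mul_le_mul_right (add_le_add_right ?_ _) _
  refine (setLIntegral_le_lintegral _ _).trans ?_
  rw [lintegral_sub_right_eq_self (fun x => (ball (0 : ℂ) 1).indicator
    (fun ζ => ENNReal.ofReal (‖ζ‖ ^ (-s))) x), lintegral_indicator measurableSet_ball]

/-- Let m = `mobius a ζ`. If |m| ≥ 1/2, the bound 1 - |ζ|² ≤ 2|1 - āζ| lowers the critical power 2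
of 1/|1 - āζ| to 2 - 3κ. If |m| < 1/2, then |1 - ām| ≥ 1/2, so |1 - āζ|^(-2) is at most four times
the Jacobian of the Möbius map, and changing variables leaves the integral of |ζ|^(-q). -/
theorem exists_mobius_weight_bound {κ q : ℝ} (hκ : 0 < κ) (hκ1 : 3 * κ ≤ 2) (hq0 : 0 ≤ q)
    (hq : q < 2) : ∃ C : ℝ≥0∞, C < ∞ ∧ ∀ a : ℂ, ‖a‖ < 1 → ∫⁻ ζ in ball (0 : ℂ) 1,
      ENNReal.ofReal (‖mobius a ζ‖ ^ (-q) * (1 - ‖ζ‖ ^ 2) ^ (3 * κ) *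
        ‖1 - conj a * ζ‖ ^ (-2 : ℝ)) ≤ C := by
  obtain ⟨C, hC, hCb⟩ := exists_one_sub_conj_mul_bound (s := 2 - 3 * κ) (by linarith) (by linarith)
  have hI := lintegral_norm_rpow_ball_lt_top hq
  refine ⟨ENNReal.ofReal (2 ^ q * 2 ^ (3 * κ)) * C + ENNReal.ofReal 4 *
    ∫⁻ ζ in ball (0 : ℂ) 1, ENNReal.ofReal (‖ζ‖ ^ (-q)), ?_, fun a ha => ?_⟩
  · exact ENNReal.add_lt_top.2 ⟨ENNReal.mul_lt_top ENNReal.ofReal_lt_top hC,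
      ENNReal.mul_lt_top ENNReal.ofReal_lt_top hI⟩
  have hpt : ∀ ζ ∈ ball (0 : ℂ) 1, ENNReal.ofReal (‖mobius a ζ‖ ^ (-q) *
      (1 - ‖ζ‖ ^ 2) ^ (3 * κ) * ‖1 - conj a * ζ‖ ^ (-2 : ℝ)) ≤
      ENNReal.ofReal (2 ^ q * 2 ^ (3 * κ)) * ENNReal.ofReal (‖1 - conj a * ζ‖ ^ (-(2 - 3 * κ))) +
      ENNReal.ofReal 4 * (ENNReal.ofReal (mobiusDensity a ζ ^ 2) *
        ENNReal.ofReal (‖mobius a ζ‖ ^ (-q))) := by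
    intro ζ hζ
    rw [mem_ball_zero_iff] at hζ
    have hpos := norm_one_sub_conj_mul_pos ha hζ.le
    have h1 := one_sub_norm_sq_pos hζ
    rw [← ENNReal.ofReal_mul (by positivity), ← ENNReal.ofReal_mul (by positivity),
      ← ENNReal.ofReal_mul (by positivity)]
    by_cases h : 1 / 2 ≤ ‖mobius a ζ‖
    · refine le_trans (ENNReal.ofReal_le_ofReal ?_) le_self_add
      have h2 : ‖mobius a ζ‖ ^ (-q) ≤ 2 ^ q := by
        calc ‖mobius a ζ‖ ^ (-q) ≤ (1 / 2) ^ (-q) :=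
            Real.rpow_le_rpow_of_nonpos (by norm_num) h (by linarith)
        _ = 2 ^ q := by rw [one_div, Real.inv_rpow (by norm_num), Real.rpow_neg (by norm_num),
            inv_inv]
      have h3 : 1 - ‖ζ‖ ^ 2 ≤ 2 * ‖1 - conj a * ζ‖ := by
        have h5 : ‖(1 : ℂ)‖ ≤ ‖1 - conj a * ζ‖ + ‖conj a * ζ‖ := by
          simpa using norm_add_le (1 - conj a * ζ) (conj a * ζ)
        rw [norm_one, norm_mul, RCLike.norm_conj] at h5
        nlinarith [norm_nonneg a, norm_nonneg ζ]
      have h4 : (1 - ‖ζ‖ ^ 2) ^ (3 * κ) ≤ 2 ^ (3 * κ) * ‖1 - conj a * ζ‖ ^ (3 * κ) := by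
        rw [← Real.mul_rpow (by norm_num) hpos.le]
        exact Real.rpow_le_rpow h1.le h3 (by linarith)
      have e : ‖1 - conj a * ζ‖ ^ (-(2 - 3 * κ)) =
          ‖1 - conj a * ζ‖ ^ (3 * κ) * ‖1 - conj a * ζ‖ ^ (-2 : ℝ) := by
        rw [← Real.rpow_add hpos]; congr 1; ring
      rw [e]
      calc _ ≤ 2 ^ q * (2 ^ (3 * κ) * ‖1 - conj a * ζ‖ ^ (3 * κ)) *
            ‖1 - conj a * ζ‖ ^ (-2 : ℝ) := by gcongr
        _ = _ := by ring
    · push Not at h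
      refine le_trans (ENNReal.ofReal_le_ofReal ?_) le_add_self
      have h2 : 1 / 2 ≤ ‖1 - conj a * mobius a ζ‖ := by
        have h5 : ‖(1 : ℂ)‖ ≤ ‖1 - conj a * mobius a ζ‖ + ‖conj a * mobius a ζ‖ := by
          simpa using norm_add_le (1 - conj a * mobius a ζ) (conj a * mobius a ζ)
        rw [norm_one, norm_mul, RCLike.norm_conj] at h5
        nlinarith [norm_nonneg a, norm_nonneg (mobius a ζ)]
      have h0 := one_sub_norm_sq_pos ha
      rw [one_sub_conj_mul_mobius ha hζ.le, norm_div, Complex.norm_real,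
        Real.norm_of_nonneg h0.le, le_div_iff₀ hpos] at h2
      have h3 : ‖1 - conj a * ζ‖ ^ (-2 : ℝ) ≤ 4 * mobiusDensity a ζ ^ 2 := by
        rw [Real.rpow_neg hpos.le, Real.rpow_two, mobiusDensity, div_pow, ← mul_div_assoc,
          le_div_iff₀ (by positivity), inv_mul_eq_div, div_le_iff₀ (by positivity)]
        have : (1 / 2 * ‖1 - conj a * ζ‖) ^ 2 ≤ (1 - ‖a‖ ^ 2) ^ 2 := by gcongr
        nlinarith [sq_nonneg (‖1 - conj a * ζ‖)]
      have h4 : (1 - ‖ζ‖ ^ 2) ^ (3 * κ) ≤ 1 :=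
        Real.rpow_le_one h1.le (by nlinarith [norm_nonneg ζ]) (by linarith)
      calc _ ≤ ‖mobius a ζ‖ ^ (-q) * 1 * (4 * mobiusDensity a ζ ^ 2) := by gcongr
        _ = _ := by ring
  have hm1 := measurable_mobiusDensity a
  have hm2 := measurable_mobius a
  refine (setLIntegral_mono' measurableSet_ball hpt).trans ?_
  rw [lintegral_add_left (by fun_prop), lintegral_const_mul' _ _ ENNReal.ofReal_ne_top,
    lintegral_const_mul' _ _ ENNReal.ofReal_ne_top,
    lintegral_mobius ha fun ζ => ENNReal.ofReal (‖ζ‖ ^ (-q))]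
  gcongr
  exact hCb a ha

end DiscIntegrals

/-! ## The weight of the Schur test -/

section SchurWeight

open ComplexConjugate

/-- The integrand to which the Schur test reduces after a change of variables. -/
def schurWeight (α κ : ℝ) (a b : ℂ) (u : ℂ × ℂ) : ℝ :=
  ‖1 - conj b * (autoFst α a u).2‖ ^ (-(2 / 3) : ℝ) * ‖1 - conj a * u.1‖ ^ (-2 : ℝ) *
    defect α u ^ (-(1 - 3 * κ)) * (1 - ‖(autoFst α a u).2‖ ^ 2) ^ (-(κ + (2 / 3 - κ) * α))

/-- The `(4/3 - 2κ)`-th power of the test function of the Schur test. -/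
def schurPow (α κ : ℝ) (w : ℂ × ℂ) : ℝ :=
  defect α w ^ (-(1 - 3 * κ)) * (1 - ‖w.2‖ ^ 2) ^ (-(κ + (2 / 3 - κ) * α))

variable {α κ : ℝ}

/-- Rescaling by √R gives the area factor R and the weight R^(-(1-3κ)), whose product is R^(3κ); on
the unit disc the boundary exponents add up to 1 - 2κ < 1. The power R^(3κ) is what makes the base
integral converge. -/
theorem exists_fiber_bound (hκ : 0 < κ) (hκ1 : κ < 1 / 6) : ∃ C : ℝ≥0∞, C < ∞ ∧
    ∀ (R : ℝ) (c : ℂ), 0 < R → ‖c‖ ^ 2 * R ≤ 1 →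
      ∫⁻ v in {v : ℂ | ‖v‖ ^ 2 < R}, ENNReal.ofReal (‖1 - c * v‖ ^ (-(2 / 3) : ℝ) *
        (R - ‖v‖ ^ 2) ^ (-(1 - 3 * κ)) * ((R - ‖v‖ ^ 2) / R) ^ (-κ)) ≤
      ENNReal.ofReal (R ^ (3 * κ)) * C := by
  obtain ⟨C, hC, hCb⟩ := exists_disc_fiber_bound (s := 1 - 2 * κ) (by linarith) (by linarith)
  refine ⟨C, hC, fun R c hR hc => ?_⟩
  have hs : MeasurableSet {v : ℂ | ‖v‖ ^ 2 < R} := measurableSet_lt (by fun_prop) (by fun_prop)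
  have hsq := Real.sqrt_pos.2 hR
  have h0 : ((√R : ℝ) : ℂ) ≠ 0 := by exact_mod_cast hsq.ne'
  have hn : ∀ ξ : ℂ, ‖ξ * (√R : ℝ)‖ ^ 2 = ‖ξ‖ ^ 2 * R := fun ξ => by
    rw [norm_mul, mul_pow, Complex.norm_real, Real.norm_of_nonneg hsq.le, Real.sq_sqrt hR.le]
  rw [← lintegral_indicator hs, ← lintegral_comp_mul_complex h0, Complex.norm_real,
    Real.norm_of_nonneg hsq.le, Real.sq_sqrt hR.le]
  have hcR : ‖c * (√R : ℝ)‖ ≤ 1 := by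
    have := hn c
    nlinarith [norm_nonneg (c * (√R : ℝ))]
  have e : ∀ ξ : ℂ, ({v : ℂ | ‖v‖ ^ 2 < R}.indicator (fun v => ENNReal.ofReal
      (‖1 - c * v‖ ^ (-(2 / 3) : ℝ) * (R - ‖v‖ ^ 2) ^ (-(1 - 3 * κ)) *
        ((R - ‖v‖ ^ 2) / R) ^ (-κ))) (ξ * (√R : ℝ))) =
      ENNReal.ofReal (R ^ (-(1 - 3 * κ))) * (ball (0 : ℂ) 1).indicator (fun ξ => ENNReal.ofReal
        (‖1 - (c * (√R : ℝ)) * ξ‖ ^ (-(2 / 3) : ℝ) * (1 - ‖ξ‖ ^ 2) ^ (-(1 - 2 * κ)))) ξ := by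
    intro ξ
    by_cases h : ‖ξ‖ < 1
    · have h1 := one_sub_norm_sq_pos h
      have hm : ξ * (√R : ℝ) ∈ {v : ℂ | ‖v‖ ^ 2 < R} := by
        rw [mem_ofPred_eq, hn]; nlinarith
      rw [indicator_of_mem hm, indicator_of_mem (mem_ball_zero_iff.2 h), hn,
        ← ENNReal.ofReal_mul (by positivity)]
      congr 1
      have e1 : R - ‖ξ‖ ^ 2 * R = R * (1 - ‖ξ‖ ^ 2) := by ring
      have e2 : -(1 - 2 * κ) = -(1 - 3 * κ) + -κ := by ring
      rw [e1, mul_div_cancel_left₀ _ hR.ne', Real.mul_rpow hR.le h1.le, e2, Real.rpow_add h1,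
        mul_assoc c, mul_comm ξ]
      ring
    · have hm : ξ * (√R : ℝ) ∉ {v : ℂ | ‖v‖ ^ 2 < R} := by
        rw [mem_ofPred_eq, hn, not_lt]
        push Not at h
        have : 1 ≤ ‖ξ‖ ^ 2 := by nlinarith
        nlinarith
      rw [indicator_of_notMem hm, indicator_of_notMem (by rwa [mem_ball_zero_iff]), mul_zero]
  simp_rw [e]
  rw [lintegral_const_mul' _ _ ENNReal.ofReal_ne_top, lintegral_indicator measurableSet_ball,
    ← mul_assoc, ← ENNReal.ofReal_mul hR.le]
  have e3 : R * R ^ (-(1 - 3 * κ)) = R ^ (3 * κ) := by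
    nth_rw 1 [← Real.rpow_one R]
    rw [← Real.rpow_add hR]
    congr 1; ring
  rw [e3]
  gcongr
  exact hCb _ hcR

/-- Let y = `autoFst α a u`. The quantity 1 - |y₂|² has two lower bounds: |m|^(2/α), as y lies in
the domain, and the height of u relative to its fibre. The exponent κ + (2/3-κ)α is split between
them, giving the powers 4/3 - 2κ of 1/|m| and κ of the inverse relative height. -/
theorem schurWeight_le (hα : 0 < α) (hκ : 0 < κ) (hκ1 : κ < 1 / 6) {a b : ℂ} (ha : ‖a‖ < 1)
    {u : ℂ × ℂ} (hu : u ∈ thullen α hα) (hm : mobius a u.1 ≠ 0) :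
    schurWeight α κ a b u ≤ ‖mobius a u.1‖ ^ (-(4 / 3 - 2 * κ)) * ‖1 - conj a * u.1‖ ^ (-2 : ℝ) *
      (‖1 - conj b * fstFactor α a u.1 * u.2‖ ^ (-(2 / 3) : ℝ) *
        (fiberSq α u.1 - ‖u.2‖ ^ 2) ^ (-(1 - 3 * κ)) *
        ((fiberSq α u.1 - ‖u.2‖ ^ 2) / fiberSq α u.1) ^ (-κ)) := by
  have hu1 := norm_fst_lt_of_mem hu
  have hy := (autoFst_mem_iff (hα := hα) ha hu1).2 hu
  have hy2 := one_sub_norm_sq_pos (norm_snd_lt_of_mem hy)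
  have hR := fiberSq_pos hα hu1
  have hd := mem_thullen_iff.1 hu
  have h1 : ‖mobius a u.1‖ ^ (2 / α) ≤ 1 - ‖(autoFst α a u).2‖ ^ 2 := by
    rw [mem_thullen_iff, defect, fiberSq, autoFst_eq] at hy
    rw [autoFst_eq]
    simp only at hy ⊢
    linarith
  have h2 : defect α u / fiberSq α u.1 ≤ 1 - ‖(autoFst α a u).2‖ ^ 2 := by
    rw [norm_autoFst_snd_sq hα ha hu1, fiberRatio, div_le_iff₀ hR, sub_mul, mul_assoc,
      div_mul_cancel₀ _ hR.ne', defect]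
    nlinarith [fiberSq_le_one α (mobius a u.1), sq_nonneg ‖u.2‖]
  have hmpos : 0 < ‖mobius a u.1‖ := norm_pos_iff.2 hm
  have h3 : (1 - ‖(autoFst α a u).2‖ ^ 2) ^ (-((2 / 3 - κ) * α)) ≤
      ‖mobius a u.1‖ ^ (-(4 / 3 - 2 * κ)) := by
    refine (Real.rpow_le_rpow_of_nonpos (Real.rpow_pos_of_pos hmpos _) h1 ?_).trans (le_of_eq ?_)
    · have : 0 < (2 / 3 - κ) * α := mul_pos (by linarith) hα
      linarith
    · rw [← Real.rpow_mul hmpos.le]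
      congr 1
      field_simp
      ring
  have h4 : (1 - ‖(autoFst α a u).2‖ ^ 2) ^ (-κ) ≤ (defect α u / fiberSq α u.1) ^ (-κ) :=
    Real.rpow_le_rpow_of_nonpos (div_pos hd hR) h2 (by linarith)
  have e : -(κ + (2 / 3 - κ) * α) = -((2 / 3 - κ) * α) + -κ := by ring
  rw [schurWeight, e, Real.rpow_add hy2]
  have e2 : conj b * (autoFst α a u).2 = conj b * fstFactor α a u.1 * u.2 := by
    rw [autoFst_eq]; ring
  rw [← e2]
  change _ ≤ _ * _ * (_ * defect α u ^ _ * (defect α u / fiberSq α u.1) ^ (-κ))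
  have hd0 := hd.le
  calc _ ≤ ‖1 - conj b * (autoFst α a u).2‖ ^ (-(2 / 3) : ℝ) * ‖1 - conj a * u.1‖ ^ (-2 : ℝ) *
        defect α u ^ (-(1 - 3 * κ)) * (‖mobius a u.1‖ ^ (-(4 / 3 - 2 * κ)) *
          (defect α u / fiberSq α u.1) ^ (-κ)) := by gcongr
    _ = _ := by ring

/-- Fubini: the fibre integrals are uniform by `exists_fiber_bound`, and the resulting function on
the base is the one of `exists_mobius_weight_bound`. -/
theorem exists_schurWeight_bound (hα : 0 < α) (hκ : 0 < κ) (hκ1 : κ < 1 / 6) :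
    ∃ C : ℝ≥0∞, C < ∞ ∧ ∀ a b : ℂ, ‖a‖ < 1 → ‖b‖ < 1 →
      ∫⁻ u in thullen α hα, ENNReal.ofReal (schurWeight α κ a b u) ≤ C := by
  obtain ⟨C₁, hC₁, hb₁⟩ := exists_fiber_bound hκ hκ1
  obtain ⟨C₂, hC₂, hb₂⟩ := exists_mobius_weight_bound (κ := κ) (q := 4 / 3 - 2 * κ) hκ
    (by linarith) (by linarith) (by linarith)
  have hA := max_one_div_pos α
  refine ⟨ENNReal.ofReal (max 1 (1 / α) ^ (3 * κ)) * C₂ * C₁, by finiteness, fun a b ha hb => ?_⟩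
  have hmo := measurable_mobius a
  have hff := measurable_fstFactor (α := α) (a := a)
  have hfs := (continuous_fiberSq hα).measurable
  have hΩ := (thullen α hα).isOpen.measurableSet
  set W : ℂ × ℂ → ℝ := fun u =>
    ‖mobius a u.1‖ ^ (-(4 / 3 - 2 * κ)) * ‖1 - conj a * u.1‖ ^ (-2 : ℝ) *
      (‖1 - conj b * fstFactor α a u.1 * u.2‖ ^ (-(2 / 3) : ℝ) *
        (fiberSq α u.1 - ‖u.2‖ ^ 2) ^ (-(1 - 3 * κ)) *
        ((fiberSq α u.1 - ‖u.2‖ ^ 2) / fiberSq α u.1) ^ (-κ)) with hW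
  have hWm : Measurable W := by fun_prop
  -- The fibre over a is a null set to be removed: there m = 0, and `Real.rpow` gives a negative
  -- power of 0 the value 0 in place of infinity.
  have hae : ∀ᵐ u : ℂ × ℂ, u.1 ≠ a := by
    rw [ae_iff]
    have : {u : ℂ × ℂ | ¬ u.1 ≠ a} = {a} ×ˢ univ := by ext; simp
    rw [this, Measure.volume_eq_prod, Measure.prod_prod, measure_singleton, zero_mul]
  calc ∫⁻ u in thullen α hα, ENNReal.ofReal (schurWeight α κ a b u)
      ≤ ∫⁻ u in thullen α hα, ENNReal.ofReal (W u) := by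
        refine setLIntegral_mono_ae' hΩ ?_
        filter_upwards [hae] with u hua hu
        refine ENNReal.ofReal_le_ofReal (schurWeight_le hα hκ hκ1 ha hu ?_)
        intro h0
        rw [mobius, div_eq_zero_iff] at h0
        rcases h0 with h0 | h0
        · exact hua (sub_eq_zero.1 h0).symm
        · exact one_sub_conj_mul_ne_zero ha (norm_fst_lt_of_mem hu).le h0
    _ = ∫⁻ ζ, ∫⁻ v, (thullen α hα : Set (ℂ × ℂ)).indicator (fun u => ENNReal.ofReal (W u)) (ζ, v) := by
        rw [← lintegral_indicator hΩ, Measure.volume_eq_prod, lintegral_prod]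
        exact (hWm.ennreal_ofReal.indicator hΩ).aemeasurable
    _ ≤ ∫⁻ ζ, (ball (0 : ℂ) 1).indicator (fun ζ => ENNReal.ofReal (max 1 (1 / α) ^ (3 * κ)) *
          ENNReal.ofReal (‖mobius a ζ‖ ^ (-(4 / 3 - 2 * κ)) * (1 - ‖ζ‖ ^ 2) ^ (3 * κ) *
            ‖1 - conj a * ζ‖ ^ (-2 : ℝ)) * C₁) ζ := by
        refine lintegral_mono fun ζ => ?_
        by_cases hζ : ‖ζ‖ < 1
        swap
        · have : ∀ v : ℂ, (ζ, v) ∉ (thullen α hα : Set (ℂ × ℂ)) := fun v hv =>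
            hζ (norm_fst_lt_of_mem hv)
          simp only [indicator_of_notMem (this _), lintegral_zero]
          exact zero_le
        rw [indicator_of_mem (mem_ball_zero_iff.2 hζ)]
        have hR := fiberSq_pos hα hζ
        have h1 := one_sub_norm_sq_pos hζ
        have hs : MeasurableSet {v : ℂ | ‖v‖ ^ 2 < fiberSq α ζ} :=
          measurableSet_lt (by fun_prop) (by fun_prop)
        -- The left side is |b|² times the squared fibre radius over m.
        have hc : ‖conj b * fstFactor α a ζ‖ ^ 2 * fiberSq α ζ ≤ 1 := by
          rw [norm_mul, mul_pow, norm_fstFactor_sq hα ha hζ, fiberRatio, mul_assoc,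
            div_mul_cancel₀ _ hR.ne', RCLike.norm_conj]
          have := fiberSq_le_one α (mobius a ζ)
          have := (fiberSq_pos hα (norm_mobius_lt ha hζ)).le
          have : ‖b‖ ^ 2 ≤ 1 := pow_le_one₀ (norm_nonneg _) hb.le
          nlinarith
        have h2 := hb₁ _ _ hR hc
        have e : ∀ v : ℂ, (thullen α hα : Set (ℂ × ℂ)).indicator
            (fun u => ENNReal.ofReal (W u)) (ζ, v) =
            ENNReal.ofReal (‖mobius a ζ‖ ^ (-(4 / 3 - 2 * κ)) * ‖1 - conj a * ζ‖ ^ (-2 : ℝ)) *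
            {v : ℂ | ‖v‖ ^ 2 < fiberSq α ζ}.indicator (fun v => ENNReal.ofReal
              (‖1 - conj b * fstFactor α a ζ * v‖ ^ (-(2 / 3) : ℝ) *
              (fiberSq α ζ - ‖v‖ ^ 2) ^ (-(1 - 3 * κ)) *
              ((fiberSq α ζ - ‖v‖ ^ 2) / fiberSq α ζ) ^ (-κ))) v := by
          intro v
          have hiff : (ζ, v) ∈ (thullen α hα : Set (ℂ × ℂ)) ↔ v ∈ {v : ℂ | ‖v‖ ^ 2 < fiberSq α ζ} := by
            rw [SetLike.mem_coe, mem_thullen_iff, defect, sub_pos, mem_ofPred_eq]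
          by_cases hv : v ∈ {v : ℂ | ‖v‖ ^ 2 < fiberSq α ζ}
          · rw [indicator_of_mem (hiff.2 hv), indicator_of_mem hv,
              ← ENNReal.ofReal_mul (by positivity)]
          · rw [indicator_of_notMem (fun h => hv (hiff.1 h)), indicator_of_notMem hv, mul_zero]
        simp_rw [e]
        rw [lintegral_const_mul' _ _ ENNReal.ofReal_ne_top, lintegral_indicator hs]
        refine (mul_le_mul_right h2 _).trans ?_
        rw [← mul_assoc]
        refine mul_le_mul_left ?_ _
        rw [← ENNReal.ofReal_mul (by positivity), ← ENNReal.ofReal_mul (by positivity)]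
        refine ENNReal.ofReal_le_ofReal ?_
        have h3 : fiberSq α ζ ^ (3 * κ) ≤ max 1 (1 / α) ^ (3 * κ) * (1 - ‖ζ‖ ^ 2) ^ (3 * κ) := by
          rw [← Real.mul_rpow hA.le h1.le]
          exact Real.rpow_le_rpow hR.le (fiberSq_le_max_mul hα hζ.le) (by linarith)
        calc _ ≤ ‖mobius a ζ‖ ^ (-(4 / 3 - 2 * κ)) * ‖1 - conj a * ζ‖ ^ (-2 : ℝ) *
              (max 1 (1 / α) ^ (3 * κ) * (1 - ‖ζ‖ ^ 2) ^ (3 * κ)) := by gcongr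
          _ = _ := by ring
    _ ≤ _ := by
        rw [lintegral_indicator measurableSet_ball, lintegral_mul_const' _ _ hC₁.ne,
          lintegral_const_mul' _ _ ENNReal.ofReal_ne_top]
        gcongr
        exact hb₂ a ha

/-- For the ball the ratio of squared fibre radii is exactly the Möbius density; the comparison of
fibres costs the constant. `le_fiberRatio` is the reverse bound. -/
theorem fiberRatio_le (hα : 0 < α) {a ζ : ℂ} (ha : ‖a‖ < 1) (hζ : ‖ζ‖ < 1) :
    fiberRatio α a ζ ≤ max 1 (1 / α) / min 1 (1 / α) * mobiusDensity a ζ := by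
  have h0 := min_one_div_pos hα
  have h1 := fiberSq_le_max_mul hα (norm_mobius_lt ha hζ).le
  have h2 := min_mul_le_fiberSq hα hζ.le
  have h3 := one_sub_norm_sq_pos hζ
  have h4 := mobiusDensity_pos ha hζ.le
  rw [one_sub_norm_mobius_sq ha hζ.le] at h1
  rw [fiberRatio, div_le_iff₀ (fiberSq_pos hα hζ)]
  refine h1.trans ?_
  calc _ = max 1 (1 / α) / min 1 (1 / α) * mobiusDensity a ζ *
        (min 1 (1 / α) * (1 - ‖ζ‖ ^ 2)) := by
        field_simp
    _ ≤ _ := by gcongr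

theorem le_fiberRatio (hα : 0 < α) {a ζ : ℂ} (ha : ‖a‖ < 1) (hζ : ‖ζ‖ < 1) :
    min 1 (1 / α) / max 1 (1 / α) * mobiusDensity a ζ ≤ fiberRatio α a ζ := by
  have h0 := max_one_div_pos α
  have h1 := min_mul_le_fiberSq hα (norm_mobius_lt ha hζ).le
  have h2 := fiberSq_le_max_mul hα hζ.le
  have h3 := one_sub_norm_sq_pos hζ
  have h4 := mobiusDensity_pos ha hζ.le
  have h5 := min_one_div_pos hα
  rw [one_sub_norm_mobius_sq ha hζ.le] at h1
  rw [fiberRatio, le_div_iff₀ (fiberSq_pos hα hζ)]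
  refine le_trans ?_ h1
  calc _ ≤ min 1 (1 / α) / max 1 (1 / α) * mobiusDensity a ζ *
        (max 1 (1 / α) * (1 - ‖ζ‖ ^ 2)) := by gcongr
    _ = _ := by field_simp

theorem schurPow_pos {hα : 0 < α} {w : ℂ × ℂ} (hw : w ∈ thullen α hα) : 0 < schurPow α κ w :=
  mul_pos (Real.rpow_pos_of_pos (mem_thullen_iff.1 hw) _)
    (Real.rpow_pos_of_pos (one_sub_norm_sq_pos (norm_snd_lt_of_mem hw)) _)

/-- The size of the squared norm of the Bergman kernel at `z`, up to bounded factors. -/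
def kernelSize (α : ℝ) (z : ℂ × ℂ) : ℝ :=
  (1 - ‖z.2‖ ^ 2) ^ (-(2 + α)) * (1 - ‖fAlpha α z‖ ^ 2) ^ (-3 : ℝ)

theorem kernelSize_pos {hα : 0 < α} {z : ℂ × ℂ} (hz : z ∈ thullen α hα) : 0 < kernelSize α z :=
  mul_pos (Real.rpow_pos_of_pos (one_sub_norm_sq_pos (norm_snd_lt_of_mem hz)) _)
    (Real.rpow_pos_of_pos (one_sub_norm_sq_pos (norm_fAlpha_lt hz)) _)

/-- The powers of 1 - |z₂|² and 1 - |f_α(z)|² in the kernel size cancel those in the Jacobian, so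
only denominators of Möbius densities remain. -/
theorem kernelSize_mul_centerDensity_le {hα : 0 < α} {z u : ℂ × ℂ} (hz : z ∈ thullen α hα)
    (hu : u ∈ thullen α hα) :
    kernelSize α z * centerDensity α z u ≤ max 1 (1 / α) / min 1 (1 / α) *
      ‖1 - conj z.2 * (autoFst α (fAlpha α z) u).2‖ ^ (-(2 * (α + 2))) *
      ‖1 - conj (fAlpha α z) * u.1‖ ^ (-6 : ℝ) := by
  have ha := norm_fAlpha_lt hz
  have hb := norm_snd_lt_of_mem hz
  have hu1 := norm_fst_lt_of_mem hu
  have hy2 := norm_snd_lt_of_mem (autoFst_fAlpha_mem hz hu)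
  have hQ := fiberRatio_le hα ha hu1
  have hA := norm_one_sub_conj_mul_pos ha hu1.le
  have hB := norm_one_sub_conj_mul_pos hb hy2.le
  have hca := one_sub_norm_sq_pos ha
  have hcb := one_sub_norm_sq_pos hb
  rw [kernelSize, centerDensity, sndDensity, fstDensity]
  have hD := mobiusDensity_pos ha hu1.le
  have hDb := mobiusDensity_pos hb hy2.le
  have hk := min_one_div_pos hα
  calc _ ≤ (1 - ‖z.2‖ ^ 2) ^ (-(2 + α)) * (1 - ‖fAlpha α z‖ ^ 2) ^ (-3 : ℝ) *
        (mobiusDensity z.2 (autoFst α (fAlpha α z) u).2 ^ (α + 2) *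
          (mobiusDensity (fAlpha α z) u.1 ^ 2 * (max 1 (1 / α) / min 1 (1 / α) *
          mobiusDensity (fAlpha α z) u.1))) := by gcongr
    _ = _ := by
      rw [mobiusDensity, mobiusDensity, Real.div_rpow hcb.le (by positivity),
        Real.rpow_neg hcb.le, Real.rpow_neg hca.le, ← Real.rpow_natCast ‖_ - _ * (autoFst _ _ _).2‖ 2,
        ← Real.rpow_mul hB.le, Real.rpow_neg hB.le, Real.rpow_neg hA.le, add_comm 2 α,
        Nat.cast_ofNat]
      norm_cast
      have h1 : (1 - ‖z.2‖ ^ 2) ^ (α + 2) ≠ 0 := (Real.rpow_pos_of_pos hcb _).ne'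
      field_simp

/-- Both factors of the test function are nearly multiplicative under recentring: 1 - |z₂|²
transforms by an identity, the defining function by an inequality up to constants. -/
theorem schurPow_centerMap_le {hα : 0 < α} (hκ : 0 < κ) (hκ1 : κ < 1 / 6) {z u : ℂ × ℂ}
    (hz : z ∈ thullen α hα) (hu : u ∈ thullen α hα) :
    schurPow α κ (centerMap α z u) ≤ schurPow α κ z *
      ((min 1 (1 / α) / max 1 (1 / α) ^ 2) ^ (-(1 - 3 * κ)) *
      ‖1 - conj z.2 * (autoFst α (fAlpha α z) u).2‖ ^ (2 * ((1 - 3 * κ) + (κ + (2 / 3 - κ) * α))) *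
      ‖1 - conj (fAlpha α z) * u.1‖ ^ (2 * (1 - 3 * κ)) * defect α u ^ (-(1 - 3 * κ)) *
      (1 - ‖(autoFst α (fAlpha α z) u).2‖ ^ 2) ^ (-(κ + (2 / 3 - κ) * α))) := by
  have ha := norm_fAlpha_lt hz
  have hb := norm_snd_lt_of_mem hz
  have hu1 := norm_fst_lt_of_mem hu
  have hy := autoFst_fAlpha_mem hz hu
  have hy2 := norm_snd_lt_of_mem hy
  have hQ := le_fiberRatio hα ha hu1
  have hA := norm_one_sub_conj_mul_pos ha hu1.le
  have hB := norm_one_sub_conj_mul_pos hb hy2.le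
  have hca := one_sub_norm_sq_pos ha
  have hcb := one_sub_norm_sq_pos hb
  have hd := mem_thullen_iff.1 hu
  have hdz := mem_thullen_iff.1 hz
  have hδ := one_sub_norm_sq_pos hy2
  have hk := min_one_div_pos hα
  have hK := max_one_div_pos α
  have hy1 : 0 < (1 - 3 * κ) := by linarith
  have hRa := fiberSq_le_max_mul hα ha.le
  have hRa0 := fiberSq_pos hα ha
  have e1 : 1 - ‖(centerMap α z u).2‖ ^ 2 = (1 - ‖z.2‖ ^ 2) *
      (1 - ‖(autoFst α (fAlpha α z) u).2‖ ^ 2) *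
      ‖1 - conj z.2 * (autoFst α (fAlpha α z) u).2‖ ^ (-2 : ℝ) := by
    rw [centerMap, autoSnd_eq]
    simp only
    rw [one_sub_norm_mobius_sq hb hy2.le, mobiusDensity, Real.rpow_neg hB.le]
    norm_cast
    field_simp
  -- One factor min/max comes from `le_fiberRatio`; the further 1/max replaces the fibre radius over
  -- f_α(z) by 1 - |f_α(z)|².
  have e2 : min 1 (1 / α) / max 1 (1 / α) ^ 2 * defect α z *
      ‖1 - conj z.2 * (autoFst α (fAlpha α z) u).2‖ ^ (-2 : ℝ) *
      ‖1 - conj (fAlpha α z) * u.1‖ ^ (-2 : ℝ) * defect α u ≤ defect α (centerMap α z u) := by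
    rw [centerMap, defect_autoSnd hα hb hy2, defect_autoFst hα ha hu1, ← fiberSq_fAlpha hα hb]
    rw [Real.rpow_neg hA.le, Real.rpow_neg hB.le]
    calc _ ≤ min 1 (1 / α) / max 1 (1 / α) ^ 2 * ((max 1 (1 / α) * (1 - ‖fAlpha α z‖ ^ 2)) *
          (1 - ‖z.2‖ ^ 2)) *
          (‖1 - conj z.2 * (autoFst α (fAlpha α z) u).2‖ ^ (2 : ℝ))⁻¹ *
          (‖1 - conj (fAlpha α z) * u.1‖ ^ (2 : ℝ))⁻¹ * defect α u := by gcongr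
      _ = mobiusDensity z.2 (autoFst α (fAlpha α z) u).2 * (min 1 (1 / α) / max 1 (1 / α) *
          mobiusDensity (fAlpha α z) u.1 * defect α u) := by
        rw [mobiusDensity, mobiusDensity]
        norm_cast
        field_simp
      _ ≤ _ := by
        have := mobiusDensity_pos hb hy2.le
        gcongr
  have h1 : defect α (centerMap α z u) ^ (-(1 - 3 * κ)) ≤ (min 1 (1 / α) / max 1 (1 / α) ^ 2 *
      defect α z * ‖1 - conj z.2 * (autoFst α (fAlpha α z) u).2‖ ^ (-2 : ℝ) *
      ‖1 - conj (fAlpha α z) * u.1‖ ^ (-2 : ℝ) * defect α u) ^ (-(1 - 3 * κ)) :=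
    Real.rpow_le_rpow_of_nonpos (by positivity) e2 (by linarith)
  rw [schurPow, e1]
  have hp : 0 ≤ ((1 - ‖z.2‖ ^ 2) * (1 - ‖(autoFst α (fAlpha α z) u).2‖ ^ 2) *
      ‖1 - conj z.2 * (autoFst α (fAlpha α z) u).2‖ ^ (-2 : ℝ)) ^ (-(κ + (2 / 3 - κ) * α)) := by
    positivity
  refine (mul_le_mul_of_nonneg_right h1 hp).trans (le_of_eq ?_)
  have e3 : ∀ x : ℝ, 0 < x → ∀ t : ℝ, (x ^ (-2 : ℝ)) ^ (-t) = x ^ (2 * t) := fun x hx t => by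
    rw [← Real.rpow_mul hx.le]; congr 1; ring
  rw [Real.mul_rpow (by positivity) (by positivity), Real.mul_rpow (by positivity) (by positivity),
    Real.mul_rpow (by positivity) (by positivity), Real.mul_rpow (by positivity) (by positivity),
    Real.mul_rpow (by positivity) (by positivity), Real.mul_rpow (by positivity) (by positivity),
    e3 _ hA, e3 _ hB, e3 _ hB, schurPow]
  generalize κ + (2 / 3 - κ) * α = y
  generalize 1 - 3 * κ = t
  rw [mul_add 2 t y, Real.rpow_add hB]
  ring

/-- With q/2 = 2/3 - κ, the exponents of the test function are such that the total power of |1 -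
b̄y₂| is -2/3, free of α and κ, and that of |1 - āu₁| is -2. -/
theorem exists_schur_pointwise_bound (hα : 0 < α) (hκ : 0 < κ) (hκ1 : κ < 1 / 6) :
    ∃ C : ℝ, 0 ≤ C ∧ ∀ z ∈ thullen α hα, ∀ u ∈ thullen α hα,
      (kernelSize α z * centerDensity α z u) ^ ((4 / 3 - 2 * κ) / 2) *
        schurPow α κ (centerMap α z u) ≤ schurPow α κ z *
          (C * schurWeight α κ (fAlpha α z) z.2 u) := by
  have hk := min_one_div_pos hα
  have hK := max_one_div_pos α
  refine ⟨(max 1 (1 / α) / min 1 (1 / α)) ^ ((4 / 3 - 2 * κ) / 2) *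
    (min 1 (1 / α) / max 1 (1 / α) ^ 2) ^ (-(1 - 3 * κ)), by positivity, fun z hz u hu => ?_⟩
  have ha := norm_fAlpha_lt hz
  have hb := norm_snd_lt_of_mem hz
  have hu1 := norm_fst_lt_of_mem hu
  have hy2 := norm_snd_lt_of_mem (autoFst_fAlpha_mem hz hu)
  have hA := norm_one_sub_conj_mul_pos ha hu1.le
  have hB := norm_one_sub_conj_mul_pos hb hy2.le
  have h1 := Real.rpow_le_rpow (mul_pos (kernelSize_pos hz) (centerDensity_pos hz hu)).le
    (kernelSize_mul_centerDensity_le hz hu) (z := (4 / 3 - 2 * κ) / 2) (by linarith)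
  have h2 := schurPow_centerMap_le hκ hκ1 hz hu
  generalize kernelSize α z * centerDensity α z u = X at *
  rw [Real.mul_rpow (by positivity) (by positivity), Real.mul_rpow (by positivity) (by positivity),
    ← Real.rpow_mul hA.le, ← Real.rpow_mul hB.le] at h1
  refine (mul_le_mul h1 h2 (schurPow_pos (centerMap_mem hz hu)).le (by positivity)).trans
    (le_of_eq ?_)
  have e1 : (-(2 / 3) : ℝ) = -(2 * (α + 2)) * ((4 / 3 - 2 * κ) / 2) +
    2 * ((1 - 3 * κ) + (κ + (2 / 3 - κ) * α)) := by ring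
  have e2 : (-2 : ℝ) = -6 * ((4 / 3 - 2 * κ) / 2) + 2 * (1 - 3 * κ) := by ring
  rw [schurWeight, e1, Real.rpow_add hB, e2, Real.rpow_add hA]
  ring

end SchurWeight

/-! ## Bergman space generalities -/

namespace bergmanSpace

variable {Ω : Opens (ℂ × ℂ)}

theorem ext_rep {f g : bergmanSpace Ω} (h : EqOn (rep f) (rep g) Ω) : f = g := by
  refine Subtype.ext (Lp.ext ?_)
  filter_upwards [ae_eq_rep f, ae_eq_rep g, ae_restrict_mem Ω.isOpen.measurableSet] with z h1 h2 h3
  rw [h1, h2, h h3]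

/-- The element of the Bergman space given by a square-integrable holomorphic function. -/
def ofHol (g : ℂ × ℂ → ℂ) (hg : DifferentiableOn ℂ g Ω) (h2 : MemLp g 2 (volume.restrict Ω)) :
    bergmanSpace Ω := ⟨h2.toLp, g, hg, h2.coeFn_toLp⟩

theorem rep_ofHol {g : ℂ × ℂ → ℂ} (hg : DifferentiableOn ℂ g Ω)
    (h2 : MemLp g 2 (volume.restrict Ω)) : EqOn (rep (ofHol g hg h2)) g Ω :=
  rep_unique _ hg h2.coeFn_toLp

theorem memLp_rep (f : bergmanSpace Ω) : MemLp (rep f) 2 (volume.restrict Ω) :=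
  (Lp.memLp (f : L2 Ω)).ae_eq (ae_eq_rep f)

theorem enorm_sq_eq_lintegral (f : bergmanSpace Ω) :
    ‖f‖ₑ ^ 2 = ∫⁻ w in Ω, ‖rep f w‖ₑ ^ 2 := by
  have h : ‖f‖ₑ = eLpNorm (rep f) 2 (volume.restrict Ω) := by
    rw [← eLpNorm_congr_ae (ae_eq_rep f), ← Lp.enorm_def]
    rfl
  rw [h, eLpNorm_eq_lintegral_rpow_enorm_toReal (by norm_num) (by norm_num)]
  simp only [ENNReal.toReal_ofNat, ENNReal.rpow_ofNat, one_div]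
  rw [← ENNReal.rpow_natCast, ← ENNReal.rpow_mul]
  simp

theorem inner_eq_integral (f g : bergmanSpace Ω) :
    inner ℂ f g = ∫ w in Ω, inner ℂ (rep f w) (rep g w) := by
  change inner ℂ (f : L2 Ω) (g : L2 Ω) = _
  rw [L2.inner_def]
  refine integral_congr_ae ?_
  filter_upwards [ae_eq_rep f, ae_eq_rep g] with z h1 h2
  rw [h1, h2]

theorem measurable_indicator_of_continuousOn {g : ℂ × ℂ → ℂ} (hg : ContinuousOn g Ω) :
    Measurable ((Ω : Set (ℂ × ℂ)).indicator g) := by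
  classical
  have := hg.measurable_piecewise (g := (0 : ℂ × ℂ → ℂ)) continuousOn_const
    Ω.isOpen.measurableSet
  rwa [Set.piecewise_eq_indicator] at this

theorem evalCLM_apply (z : Ω) (f : bergmanSpace Ω) : evalCLM z f = rep f z := rfl

end bergmanSpace

theorem eq_bergmanKernel_of_inner {Ω : Opens (ℂ × ℂ)} {z : Ω} {k : bergmanSpace Ω}
    (h : ∀ f, inner ℂ k f = bergmanSpace.rep f z) : k = bergmanKernel Ω z := by
  refine ext_inner_right ℂ fun f => ?_
  rw [h, inner_bergmanKernel]

/-! ## Averaging over circle actions -/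

/-- Invariance of the measure under each rotation, and Fubini over the circle. It permits replacing
an integrand by its average, which kills all but one Fourier mode. -/
theorem integral_circleAverage_action {A : ℂ → ℂ × ℂ → ℂ × ℂ} (hA : Measurable (Function.uncurry A))
    (hmp : ∀ ζ : ℂ, ‖ζ‖ = 1 → MeasurePreserving (A ζ)) {ψ : ℂ × ℂ → ℂ} (hm : Measurable ψ)
    (hi : Integrable ψ) :
    Integrable (fun w => Real.circleAverage (fun ζ => ψ (A ζ w)) 0 1) ∧
      ∫ w, Real.circleAverage (fun ζ => ψ (A ζ w)) 0 1 = ∫ w, ψ w := by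
  have hpi := Real.pi_pos
  have hn : ∀ θ : ℝ, ‖circleMap 0 1 θ‖ = 1 := fun θ => by simp
  have hmeas : Measurable (fun p : ℝ × (ℂ × ℂ) => ψ (A (circleMap 0 1 p.1) p.2)) := by
    refine hm.comp (hA.comp (Measurable.prodMk ?_ measurable_snd))
    exact (continuous_circleMap 0 1).measurable.comp measurable_fst
  have hprod : Integrable (fun p : ℝ × (ℂ × ℂ) => ψ (A (circleMap 0 1 p.1) p.2))
      ((volume.restrict (Ioc 0 (2 * Real.pi))).prod volume) := by
    rw [integrable_prod_iff hmeas.aestronglyMeasurable]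
    refine ⟨ae_of_all _ fun θ => (hmp _ (hn θ)).integrable_comp_of_integrable hi, ?_⟩
    have : ∀ θ : ℝ, ∫ w, ‖ψ (A (circleMap 0 1 θ) w)‖ = ∫ w, ‖ψ w‖ := fun θ => by
      have h := (hmp _ (hn θ))
      rw [← h.map_eq, integral_map h.measurable.aemeasurable
        (hm.norm.aestronglyMeasurable), h.map_eq]
    simp only [this]
    exact integrable_const _
  have e : ∀ w, Real.circleAverage (fun ζ => ψ (A ζ w)) 0 1 =
      (2 * Real.pi)⁻¹ • ∫ θ in Ioc 0 (2 * Real.pi), ψ (A (circleMap 0 1 θ) w) := fun w => by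
    rw [Real.circleAverage, intervalIntegral.integral_of_le (by positivity)]
  simp only [e]
  refine ⟨hprod.integral_prod_right.smul ((2 * Real.pi)⁻¹ : ℝ), ?_⟩
  rw [integral_smul, ← integral_integral_swap hprod]
  have : ∀ θ : ℝ, ∫ w, ψ (A (circleMap 0 1 θ) w) = ∫ w, ψ w := fun θ => by
    have h := (hmp _ (hn θ))
    conv_rhs => rw [← h.map_eq]
    rw [integral_map h.measurable.aemeasurable hm.aestronglyMeasurable]
  simp only [this]
  rw [integral_const, smul_smul]
  have h1 : (volume.restrict (Ioc 0 (2 * Real.pi))).real univ = 2 * Real.pi := by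
    simp [hpi.le]
  rw [h1, inv_mul_cancel₀ (by positivity), one_smul]

theorem measurePreserving_mul_left {ζ : ℂ} (hζ : ‖ζ‖ = 1) :
    MeasurePreserving (fun w : ℂ => ζ * w) := by
  have := (rotation ⟨ζ, by simp [Submonoid.unitSphere, hζ]⟩).measurePreserving
  exact this

/-- On the unit circle ζ̄ = ζ⁻¹, so the average is Cauchy's formula for the j-th Taylor coefficient
of ζ ↦ g(cζ). -/
theorem circleAverage_conj_pow_mul {g : ℂ → ℂ} (hg : DifferentiableOn ℂ g (ball 0 1)) {c : ℂ}
    (hc : ‖c‖ < 1) (j : ℕ) :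
    Real.circleAverage (fun ζ => (starRingEnd ℂ ζ) ^ j * g (ζ * c)) 0 1 =
      c ^ j * ((j.factorial : ℂ)⁻¹ * iteratedDeriv j g 0) := by
  have hmaps : MapsTo (fun ζ => c * ζ) (closedBall (0 : ℂ) 1) (ball 0 1) := fun ζ hζ => by
    rw [mem_closedBall_zero_iff] at hζ
    rw [mem_ball_zero_iff, norm_mul]
    nlinarith [norm_nonneg c, norm_nonneg ζ]
  have hG : DifferentiableOn ℂ (fun ζ => g (c * ζ)) (closedBall 0 1) :=
    hg.comp (by fun_prop) hmaps
  have h1 := DiffContOnCl.circleIntegral_one_div_sub_center_pow_smul (f := fun ζ => g (c * ζ))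
    (c := 0) one_pos j (hG.diffContOnCl_ball subset_rfl)
  have h2 : iteratedDeriv j (fun ζ => g (c * ζ)) 0 = c ^ j * iteratedDeriv j g 0 := by
    have h0 : (0 : ℂ) ∈ ball (0 : ℂ) 1 := mem_ball_self one_pos
    have := iteratedDerivWithin_comp_const_smul (n := j) h0 isOpen_ball.uniqueDiffOn
      (hg.contDiffOn isOpen_ball) c (hmaps.mono_left ball_subset_closedBall)
    rw [iteratedDerivWithin_of_isOpen isOpen_ball h0, mul_zero,
      iteratedDerivWithin_of_isOpen isOpen_ball h0] at this
    exact this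
  rw [Real.circleAverage_eq_circleIntegral one_ne_zero]
  have h3 : (∮ z in C(0, 1), (z - 0)⁻¹ • ((starRingEnd ℂ z) ^ j * g (z * c))) =
      ∮ z in C(0, 1), (1 / (z - 0) ^ (j + 1)) • g (c * z) := by
    refine circleIntegral.integral_congr zero_le_one fun z hz => ?_
    have hz1 : ‖z‖ = 1 := mem_sphere_zero_iff_norm.1 hz
    have hz0 : z ≠ 0 := by rw [← norm_pos_iff, hz1]; exact one_pos
    have hc : starRingEnd ℂ z = z⁻¹ := by
      rw [Complex.inv_def, Complex.normSq_eq_norm_sq, hz1]; simp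
    simp only [hc, sub_zero, smul_eq_mul]
    rw [mul_comm z c, pow_succ, inv_pow]
    field_simp
  have hpi : (Real.pi : ℂ) ≠ 0 := by exact_mod_cast Real.pi_ne_zero
  have hfac : (j.factorial : ℂ) ≠ 0 := by exact_mod_cast j.factorial_ne_zero
  rw [h3, h1, h2, smul_eq_mul, smul_eq_mul]
  field_simp

/-! ## Monomials in the first variable -/

section Monomials

open ComplexConjugate bergmanSpace

variable {α : ℝ} (hα : 0 < α)

theorem thullen_subset_ball : (thullen α hα : Set (ℂ × ℂ)) ⊆ ball 0 1 := fun w hw => by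
  rw [mem_ball_zero_iff, Prod.norm_def]
  exact max_lt (norm_fst_lt_of_mem hw) (norm_snd_lt_of_mem hw)

theorem volume_thullen_lt_top : volume (thullen α hα : Set (ℂ × ℂ)) < ∞ :=
  (measure_mono (thullen_subset_ball hα)).trans_lt measure_ball_lt_top

instance isFiniteMeasure_thullen :
    IsFiniteMeasure (volume.restrict (thullen α hα : Set (ℂ × ℂ))) :=
  ⟨by rw [Measure.restrict_apply_univ]; exact volume_thullen_lt_top hα⟩

theorem memLp_pow_fst (j : ℕ) :
    MemLp (fun w : ℂ × ℂ => w.1 ^ j) 2 (volume.restrict (thullen α hα : Set (ℂ × ℂ))) := by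
  refine MemLp.of_bound (Measurable.aestronglyMeasurable (by fun_prop)) 1 ?_
  filter_upwards [ae_restrict_mem (thullen α hα).isOpen.measurableSet] with w hw
  rw [norm_pow]
  exact pow_le_one₀ (norm_nonneg _) (norm_fst_lt_of_mem hw).le

/-- The monomial `z₁ ^ j` as an element of the Bergman space of the Thullen domain. -/
def monomialFst (j : ℕ) : bergmanSpace (thullen α hα) :=
  ofHol (fun w => w.1 ^ j) (by fun_prop) (memLp_pow_fst hα j)

variable {hα}

theorem rep_monomialFst (j : ℕ) {w : ℂ × ℂ} (hw : w ∈ thullen α hα) :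
    rep (monomialFst hα j) w = w.1 ^ j := rep_ofHol _ _ hw

theorem mk_zero_mem {c : ℂ} (hc : ‖c‖ < 1) : (c, (0 : ℂ)) ∈ thullen α hα := by
  rw [mem_thullen_iff, defect]
  simpa using fiberSq_pos hα hc

theorem mk_mul_mem {w : ℂ × ℂ} {s t : ℂ} (hw : w ∈ thullen α hα) (hs : ‖s‖ ≤ 1) (ht : ‖t‖ ≤ 1) :
    (s * w.1, t * w.2) ∈ thullen α hα := by
  rw [mem_thullen_iff, defect, fiberSq] at *
  have h1 : ‖s * w.1‖ ^ (2 / α) ≤ ‖w.1‖ ^ (2 / α) := by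
    refine Real.rpow_le_rpow (norm_nonneg _) ?_ (by positivity)
    rw [norm_mul]
    exact mul_le_of_le_one_left (norm_nonneg _) hs
  have h2 : ‖t * w.2‖ ^ 2 ≤ ‖w.2‖ ^ 2 := by
    rw [norm_mul]
    gcongr
    exact mul_le_of_le_one_left (norm_nonneg _) ht
  simp only at *
  linarith

theorem mk_mul_mem_iff {w : ℂ × ℂ} {s t : ℂ} (hs : ‖s‖ = 1) (ht : ‖t‖ = 1) :
    (s * w.1, t * w.2) ∈ thullen α hα ↔ w ∈ thullen α hα := by
  simp only [mem_thullen_iff, defect, fiberSq, norm_mul, hs, ht, one_mul]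

/-- Orthogonality of monomials without expanding f on the domain: averaging over rotations of w₂
restricts f to w₂ = 0 by the mean value property, and averaging over rotations of w₁ then extracts
the j-th Taylor coefficient. -/
theorem integral_conj_pow_mul (f : bergmanSpace (thullen α hα)) (j : ℕ) :
    ∫ w in (thullen α hα : Set (ℂ × ℂ)), conj w.1 ^ j * rep f w =
      ((j.factorial : ℂ)⁻¹ * iteratedDeriv j (fun ζ => rep f (ζ, 0)) 0) *
        ∫ w in (thullen α hα : Set (ℂ × ℂ)), conj w.1 ^ j * w.1 ^ j := by
  have hΩ := (thullen α hα).isOpen.measurableSet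
  have hfd := differentiableOn_rep f
  set Ω : Set (ℂ × ℂ) := (thullen α hα : Set (ℂ × ℂ)) with hΩdef
  have hg : DifferentiableOn ℂ (fun ζ => rep f (ζ, 0)) (ball 0 1) :=
    hfd.comp (by fun_prop) fun ζ hζ => mk_zero_mem (mem_ball_zero_iff.1 hζ)
  have hint : IntegrableOn (fun w => conj w.1 ^ j * rep f w) Ω := by
    have h1 : Integrable (rep f) (volume.restrict Ω) := (memLp_rep f).integrable (by norm_num)
    refine h1.bdd_mul (c := 1) (Measurable.aestronglyMeasurable (by fun_prop)) ?_
    filter_upwards [ae_restrict_mem hΩ] with w hw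
    rw [norm_pow, RCLike.norm_conj]
    exact pow_le_one₀ (norm_nonneg _) (norm_fst_lt_of_mem hw).le
  have hc1 : Continuous fun w : ℂ × ℂ => conj w.1 ^ j :=
    (Complex.continuous_conj.comp continuous_fst).pow j
  have hm : Measurable (Ω.indicator fun w => conj w.1 ^ j * rep f w) :=
    measurable_indicator_of_continuousOn (hc1.continuousOn.mul hfd.continuousOn)
  have hmp2 : ∀ ζ : ℂ, ‖ζ‖ = 1 → MeasurePreserving (fun w : ℂ × ℂ => (w.1, ζ * w.2)) := fun ζ hζ =>
    (MeasurePreserving.id volume).prod (measurePreserving_mul_left hζ)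
  have hmp1 : ∀ ζ : ℂ, ‖ζ‖ = 1 → MeasurePreserving (fun w : ℂ × ℂ => (ζ * w.1, w.2)) := fun ζ hζ =>
    (measurePreserving_mul_left hζ).prod (MeasurePreserving.id volume)
  have s2 := integral_circleAverage_action (A := fun ζ w => (w.1, ζ * w.2))
    (by fun_prop) hmp2 hm ((integrable_indicator_iff hΩ).2 hint)
  have e2 : ∀ w, Real.circleAverage (fun ζ => Ω.indicator (fun w => conj w.1 ^ j * rep f w)
      (w.1, ζ * w.2)) 0 1 = Ω.indicator (fun w => conj w.1 ^ j * rep f (w.1, 0)) w := by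
    intro w
    by_cases hw : w ∈ Ω
    · rw [indicator_of_mem hw]
      have h1 : ∀ ζ : ℂ, ‖ζ‖ ≤ 1 → (w.1, ζ * w.2) ∈ Ω := fun ζ hζ => by
        have := mk_mul_mem (s := 1) hw (by simp) hζ
        rwa [one_mul] at this
      have h2 : Real.circleAverage (fun ζ => Ω.indicator (fun w => conj w.1 ^ j * rep f w)
          (w.1, ζ * w.2)) 0 1 =
          Real.circleAverage (fun ζ => conj w.1 ^ j * rep f (w.1, ζ * w.2)) 0 1 := by
        refine Real.circleAverage_congr_sphere fun ζ hζ => ?_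
        rw [abs_one, mem_sphere_zero_iff_norm] at hζ
        rw [indicator_of_mem (h1 ζ hζ.le)]
      rw [h2]
      have h3 : DifferentiableOn ℂ (fun ζ => conj w.1 ^ j * rep f (w.1, ζ * w.2))
          (closedBall 0 1) :=
        (hfd.comp (f := fun ζ : ℂ => (w.1, ζ * w.2)) (by fun_prop)
          fun ζ hζ => h1 ζ (mem_closedBall_zero_iff.1 hζ)).const_mul _
      rw [DiffContOnCl.circleAverage]
      · simp
      · rw [abs_one]
        exact h3.diffContOnCl_ball subset_rfl
    · rw [indicator_of_notMem hw]
      rw [Real.circleAverage_congr_sphere (f₂ := fun _ => (0 : ℂ)), Real.circleAverage_const]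
      intro ζ hζ
      rw [abs_one, mem_sphere_zero_iff_norm] at hζ
      simp only
      rw [indicator_of_notMem]
      have := mk_mul_mem_iff (hα := hα) (w := w) (s := 1) (t := ζ) (by simp) hζ
      rw [one_mul] at this
      exact fun h => hw (this.1 h)
  simp only [e2] at s2
  have hm1 : Measurable (Ω.indicator fun w => conj w.1 ^ j * rep f (w.1, 0)) := by
    refine measurable_indicator_of_continuousOn (hc1.continuousOn.mul ?_)
    exact hg.continuousOn.comp (by fun_prop)
      fun w hw => mem_ball_zero_iff.2 (norm_fst_lt_of_mem hw)
  have s1 := integral_circleAverage_action (A := fun ζ w => (ζ * w.1, w.2))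
    (by fun_prop) hmp1 hm1 s2.1
  have e1 : ∀ w, Real.circleAverage (fun ζ => Ω.indicator (fun w => conj w.1 ^ j * rep f (w.1, 0))
      (ζ * w.1, w.2)) 0 1 = Ω.indicator (fun w => ((j.factorial : ℂ)⁻¹ *
        iteratedDeriv j (fun ζ => rep f (ζ, 0)) 0) * (conj w.1 ^ j * w.1 ^ j)) w := by
    intro w
    by_cases hw : w ∈ Ω
    · rw [indicator_of_mem hw]
      have h2 : Real.circleAverage (fun ζ => Ω.indicator (fun w => conj w.1 ^ j * rep f (w.1, 0))
          (ζ * w.1, w.2)) 0 1 = Real.circleAverage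
          (fun ζ => conj w.1 ^ j • (conj ζ ^ j * (fun ζ => rep f (ζ, 0)) (ζ * w.1))) 0 1 := by
        refine Real.circleAverage_congr_sphere fun ζ hζ => ?_
        rw [abs_one, mem_sphere_zero_iff_norm] at hζ
        simp only
        have := (mk_mul_mem_iff (hα := hα) (w := w) (s := ζ) (t := 1) hζ (by simp)).2 hw
        rw [one_mul] at this
        rw [indicator_of_mem this, map_mul, smul_eq_mul]
        ring
      rw [h2, Real.circleAverage_fun_smul, circleAverage_conj_pow_mul hg (norm_fst_lt_of_mem hw),
        smul_eq_mul]
      ring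
    · rw [indicator_of_notMem hw]
      rw [Real.circleAverage_congr_sphere (f₂ := fun _ => (0 : ℂ)), Real.circleAverage_const]
      intro ζ hζ
      rw [abs_one, mem_sphere_zero_iff_norm] at hζ
      simp only
      rw [indicator_of_notMem]
      have := mk_mul_mem_iff (hα := hα) (w := w) (s := ζ) (t := 1) hζ (by simp)
      rw [one_mul] at this
      exact fun h => hw (this.1 h)
  simp only [e1] at s1
  rw [← integral_indicator hΩ, ← s2.2, ← s1.2, integral_indicator hΩ, integral_const_mul]

end Monomials

/-! ## The Bergman kernel of the Thullen domain -/

section Kernel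

open ComplexConjugate bergmanSpace

variable {α : ℝ} {hα : 0 < α}

/-- The coefficients of the Bergman kernel on the disc `z₂ = 0`; their inverses are the squared
norms of the monomials in the first variable. -/
def monomialCoeff (α : ℝ) (j : ℕ) : ℝ := (j + 1) * (α * (j + 1) + 1) / Real.pi ^ 2

theorem monomialCoeff_pos (hα : 0 < α) (j : ℕ) : 0 < monomialCoeff α j := by
  have := Real.pi_pos
  unfold monomialCoeff
  positivity

/-- The fibre over ζ is a disc of area π · `fiberSq α ζ`; in polar coordinates the integral is 2π²
(1/(2j+2) - 1/(2j+2+2/α)). -/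
theorem integral_radial_weight (hα : 0 < α) (j : ℕ) :
    ∫ ζ in ball (0 : ℂ) 1, Real.pi * (‖ζ‖ ^ (2 * j) * fiberSq α ζ) = (monomialCoeff α j)⁻¹ := by
  have hpi := Real.pi_pos
  have h1 := integral_fun_norm_addHaar (volume : Measure ℂ)
    ((Iio 1).indicator fun r : ℝ => Real.pi * (r ^ (2 * j) * (1 - r ^ (2 / α))))
  have e : ∀ ζ : ℂ, (Iio 1).indicator (fun r : ℝ => Real.pi * (r ^ (2 * j) * (1 - r ^ (2 / α)))) ‖ζ‖ =
      (ball (0 : ℂ) 1).indicator (fun ζ => Real.pi * (‖ζ‖ ^ (2 * j) * fiberSq α ζ)) ζ := fun ζ => by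
    by_cases h : ‖ζ‖ < 1
    · rw [indicator_of_mem (show ‖ζ‖ ∈ Iio 1 from h), indicator_of_mem (mem_ball_zero_iff.2 h),
        fiberSq]
    · rw [indicator_of_notMem (show ‖ζ‖ ∉ Iio 1 from h),
        indicator_of_notMem (by rwa [mem_ball_zero_iff])]
  simp only [e] at h1
  rw [integral_indicator measurableSet_ball] at h1
  have hv : (volume : Measure ℂ).real (ball 0 1) = Real.pi := by
    simp [Measure.real, Complex.volume_ball]
  have h2 : ∫ y in Ioi (0 : ℝ), y ^ (2 - 1) • (Iio 1).indicator
      (fun r : ℝ => Real.pi * (r ^ (2 * j) * (1 - r ^ (2 / α)))) y =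
      ∫ y in (0 : ℝ)..1, Real.pi * (y ^ ((2 * j + 1 : ℕ) : ℝ) - y ^ ((2 * j + 1 : ℕ) + 2 / α)) := by
    rw [intervalIntegral.integral_of_le zero_le_one, integral_Ioc_eq_integral_Ioo,
      ← integral_indicator measurableSet_Ioi, ← integral_indicator measurableSet_Ioo]
    congr 1
    ext y
    by_cases hy : 0 < y
    · by_cases hy1 : y < 1
      · rw [indicator_of_mem (show y ∈ Ioi 0 from hy), indicator_of_mem (show y ∈ Iio 1 from hy1),
          indicator_of_mem (show y ∈ Ioo 0 1 from ⟨hy, hy1⟩), Real.rpow_add hy, Real.rpow_natCast,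
          smul_eq_mul]
        ring
      · rw [indicator_of_mem (show y ∈ Ioi 0 from hy), indicator_of_notMem (show y ∉ Iio 1 from hy1),
          indicator_of_notMem (fun h => hy1 h.2), smul_zero]
    · rw [indicator_of_notMem (show y ∉ Ioi 0 from hy), indicator_of_notMem (fun h => hy h.1)]
  rw [Complex.finrank_real_complex, h2, hv, intervalIntegral.integral_const_mul,
    intervalIntegral.integral_sub, integral_rpow, integral_rpow] at h1
  · rw [h1, monomialCoeff]
    have e1 : (0 : ℝ) ^ (((2 * j + 1 : ℕ) : ℝ) + 1) = 0 := Real.zero_rpow (by positivity)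
    have e2 : (0 : ℝ) ^ (((2 * j + 1 : ℕ) : ℝ) + 2 / α + 1) = 0 := Real.zero_rpow (by positivity)
    rw [e1, e2, Real.one_rpow, Real.one_rpow]
    push_cast
    rw [smul_eq_mul, nsmul_eq_mul]
    have h3 : (2 * (j : ℝ) + 1 + 2 / α + 1) = 2 * (α * (j + 1) + 1) / α := by field_simp; ring
    have h4 : (2 * (j : ℝ) + 1 + 1) = 2 * (j + 1) := by ring
    rw [h3, h4]
    field_simp
    push_cast
    ring
  · left
    have : (0 : ℝ) ≤ ((2 * j + 1 : ℕ) : ℝ) + 2 / α := by positivity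
    linarith
  · left
    have : (0 : ℝ) ≤ ((2 * j + 1 : ℕ) : ℝ) := by positivity
    linarith
  · exact intervalIntegral.intervalIntegrable_rpow (Or.inl (by positivity))
  · exact intervalIntegral.intervalIntegrable_rpow (Or.inl (by positivity))

theorem lintegral_pow_fst (hα : 0 < α) (j : ℕ) :
    ∫⁻ w in (thullen α hα : Set (ℂ × ℂ)), ENNReal.ofReal (‖w.1‖ ^ (2 * j)) =
      ENNReal.ofReal (monomialCoeff α j)⁻¹ := by
  have hΩ := (thullen α hα).isOpen.measurableSet
  have hpi := Real.pi_pos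
  rw [← integral_radial_weight hα, ofReal_integral_eq_lintegral_ofReal, ← lintegral_indicator hΩ,
    Measure.volume_eq_prod, lintegral_prod, ← lintegral_indicator measurableSet_ball]
  · refine lintegral_congr fun ζ => ?_
    by_cases hζ : ‖ζ‖ < 1
    · rw [indicator_of_mem (mem_ball_zero_iff.2 hζ)]
      have hR := fiberSq_pos hα hζ
      have e : ∀ v : ℂ, (thullen α hα : Set (ℂ × ℂ)).indicator
          (fun w => ENNReal.ofReal (‖w.1‖ ^ (2 * j))) (ζ, v) =
          (ball (0 : ℂ) √(fiberSq α ζ)).indicator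
            (fun _ => ENNReal.ofReal (‖ζ‖ ^ (2 * j))) v := by
        intro v
        have hiff : (ζ, v) ∈ (thullen α hα : Set (ℂ × ℂ)) ↔ v ∈ ball (0 : ℂ) √(fiberSq α ζ) := by
          rw [SetLike.mem_coe, mem_thullen_iff, defect, sub_pos, mem_ball_zero_iff,
            Real.lt_sqrt (norm_nonneg _)]
        by_cases hv : v ∈ ball (0 : ℂ) √(fiberSq α ζ)
        · rw [indicator_of_mem (hiff.2 hv), indicator_of_mem hv]
        · rw [indicator_of_notMem (fun h => hv (hiff.1 h)), indicator_of_notMem hv]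
      simp_rw [e]
      rw [lintegral_indicator measurableSet_ball, setLIntegral_const, Complex.volume_ball,
        ← ENNReal.ofReal_pow (Real.sqrt_nonneg _), Real.sq_sqrt hR.le,
        ← NNReal.coe_real_pi, ENNReal.ofReal_mul (by positivity), ENNReal.ofReal_mul (by positivity)]
      simp only [NNReal.coe_real_pi]
      have : (NNReal.pi : ℝ≥0∞) = ENNReal.ofReal Real.pi := by
        rw [← NNReal.coe_real_pi, ENNReal.ofReal_coe_nnreal]
      rw [this]
      ring
    · rw [indicator_of_notMem (by rwa [mem_ball_zero_iff])]
      have : ∀ v : ℂ, (ζ, v) ∉ (thullen α hα : Set (ℂ × ℂ)) := fun v hv =>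
            hζ (norm_fst_lt_of_mem hv)
      simp only [indicator_of_notMem (this _), lintegral_zero]
  · exact (Measurable.indicator (by fun_prop) hΩ).aemeasurable
  · have : Continuous fun ζ : ℂ => Real.pi * (‖ζ‖ ^ (2 * j) * fiberSq α ζ) := by
      have := continuous_fiberSq hα
      fun_prop
    exact (this.continuousOn.integrableOn_compact (isCompact_closedBall (0 : ℂ) 1)).mono_set
      ball_subset_closedBall
  · filter_upwards [ae_restrict_mem measurableSet_ball] with ζ hζ
    have := fiberSq_pos hα (mem_ball_zero_iff.1 hζ)
    positivity

theorem norm_monomialFst_sq (j : ℕ) : ‖monomialFst hα j‖ ^ 2 = (monomialCoeff α j)⁻¹ := by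
  have h1 := enorm_sq_eq_lintegral (monomialFst hα j)
  have h2 : ∫⁻ w in (thullen α hα : Set (ℂ × ℂ)), ‖rep (monomialFst hα j) w‖ₑ ^ 2 =
      ∫⁻ w in (thullen α hα : Set (ℂ × ℂ)), ENNReal.ofReal (‖w.1‖ ^ (2 * j)) := by
    refine setLIntegral_congr_fun (thullen α hα).isOpen.measurableSet fun w hw => ?_
    rw [rep_monomialFst j hw, ← ofReal_norm, ← ENNReal.ofReal_pow (norm_nonneg _), norm_pow,
      ← pow_mul, mul_comm]
  rw [h2, lintegral_pow_fst, ← ofReal_norm, ← ENNReal.ofReal_pow (norm_nonneg _)] at h1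
  exact (ENNReal.ofReal_eq_ofReal_iff (by positivity)
    (inv_pos.2 (monomialCoeff_pos hα j)).le).1 h1

theorem inner_monomialFst (f : bergmanSpace (thullen α hα)) (j : ℕ) :
    inner ℂ (monomialFst hα j) f =
      ((j.factorial : ℂ)⁻¹ * iteratedDeriv j (fun ζ => rep f (ζ, 0)) 0) *
        ((monomialCoeff α j)⁻¹ : ℝ) := by
  have key : ∀ f : bergmanSpace (thullen α hα), inner ℂ (monomialFst hα j) f =
      ∫ w in (thullen α hα : Set (ℂ × ℂ)), conj w.1 ^ j * rep f w := fun f => by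
    rw [inner_eq_integral]
    refine setIntegral_congr_fun (thullen α hα).isOpen.measurableSet fun w hw => ?_
    rw [rep_monomialFst j hw, RCLike.inner_apply, map_pow, mul_comm]
  rw [key, integral_conj_pow_mul]
  congr 1
  have h1 : ∫ w in (thullen α hα : Set (ℂ × ℂ)), conj w.1 ^ j * w.1 ^ j =
      ∫ w in (thullen α hα : Set (ℂ × ℂ)), conj w.1 ^ j * rep (monomialFst hα j) w := by
    refine setIntegral_congr_fun (thullen α hα).isOpen.measurableSet fun w hw => ?_
    rw [rep_monomialFst j hw]
  have h2 : (inner ℂ (monomialFst hα j) (monomialFst hα j) : ℂ) = (‖monomialFst hα j‖ : ℂ) ^ 2 :=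
    inner_self_eq_norm_sq_to_K (𝕜 := ℂ) (monomialFst hα j)
  rw [h1, ← key, h2, ← norm_monomialFst_sq (hα := hα)]
  push_cast
  rfl

/-- The numerator of the Bergman kernel. -/
def kernelNum (α : ℝ) (x : ℂ) : ℂ := (1 + α) + (α - 1) * x

/-- Decompose (j+1)(α(j+1)+1) = 2α·C(j+2,2) + (1-α)·C(j+1,1) and sum two binomial series. -/
theorem hasSum_monomialCoeff {x : ℂ} (hx : ‖x‖ < 1) :
    HasSum (fun j => (monomialCoeff α j : ℂ) * x ^ j)
      (kernelNum α x / (Real.pi ^ 2 * (1 - x) ^ 3)) := by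
  have h1 := (hasSum_choose_mul_geometric_of_norm_lt_one 2 hx).mul_left (2 * α / Real.pi ^ 2 : ℂ)
  have h2 := (hasSum_choose_mul_geometric_of_norm_lt_one 1 hx).mul_left ((1 - α) / Real.pi ^ 2 : ℂ)
  have hx1 : 1 - x ≠ 0 := by
    intro h
    rw [← sub_eq_zero.1 h, norm_one] at hx
    exact lt_irrefl _ hx
  have hpi : (Real.pi : ℂ) ≠ 0 := by exact_mod_cast Real.pi_ne_zero
  have e1 : (fun j => (monomialCoeff α j : ℂ) * x ^ j) = fun j =>
      2 * α / Real.pi ^ 2 * (((j + 2).choose 2 : ℕ) * x ^ j) +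
        (1 - α) / Real.pi ^ 2 * (((j + 1).choose 1 : ℕ) * x ^ j) := by
    ext j
    rw [Nat.choose_one_right, Nat.cast_choose_two, monomialCoeff]
    push_cast
    field_simp
    ring
  have e2 : kernelNum α x / (Real.pi ^ 2 * (1 - x) ^ 3) =
      2 * α / Real.pi ^ 2 * (1 / (1 - x) ^ (2 + 1)) +
        (1 - α) / Real.pi ^ 2 * (1 / (1 - x) ^ (1 + 1)) := by
    rw [kernelNum]
    field_simp
    ring
  rw [e1, e2]
  exact h1.add h2

/-- The points of the disc `z₂ = 0`. -/
def axisPoint (hα : 0 < α) {a : ℂ} (ha : ‖a‖ < 1) : thullen α hα := ⟨(a, 0), mk_zero_mem ha⟩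

/-- Paired with f, the series becomes the Taylor series of f(·,0) at a, whose sum is f(a,0).
Monomials in w₂ do not contribute at points of the axis. -/
theorem hasSum_axisKernel {a : ℂ} (ha : ‖a‖ < 1) :
    HasSum (fun j => ((monomialCoeff α j : ℂ) * conj a ^ j) • monomialFst hα j)
      (bergmanKernel (thullen α hα) (axisPoint hα ha)) := by
  have hs : Summable fun j => ((monomialCoeff α j : ℂ) * conj a ^ j) • monomialFst hα j := by
    refine Summable.of_norm_bounded (g := fun j => Real.pi * ‖(monomialCoeff α j : ℂ) * conj a ^ j‖)
      ((hasSum_monomialCoeff (by rwa [RCLike.norm_conj])).summable.norm.mul_left _) fun j => ?_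
    rw [norm_smul, mul_comm]
    gcongr
    -- All monomials have norm at most π, so summability of the scalar coefficients suffices.
    have h1 : ‖monomialFst hα j‖ ^ 2 ≤ Real.pi ^ 2 := by
      rw [norm_monomialFst_sq, monomialCoeff, inv_div]
      refine div_le_self (by positivity) ?_
      have : (0 : ℝ) ≤ j := Nat.cast_nonneg j
      have : 0 ≤ α * (j + 1) := by positivity
      nlinarith
    exact le_of_sq_le_sq h1 Real.pi_pos.le
  obtain ⟨S, hS⟩ := hs
  convert hS using 1
  symm
  refine eq_bergmanKernel_of_inner fun f => ?_
  have hg : DifferentiableOn ℂ (fun ζ => rep f (ζ, 0)) (ball 0 1) :=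
    (differentiableOn_rep f).comp (by fun_prop) fun ζ hζ => mk_zero_mem (mem_ball_zero_iff.1 hζ)
  have h1 := Complex.hasSum_taylorSeries_on_ball hg (mem_ball_zero_iff.2 ha)
  have h2 := hS.mapL (innerSL ℂ f)
  have h3 : HasSum (fun j : ℕ => conj (inner ℂ f
      (((monomialCoeff α j : ℂ) * conj a ^ j) • monomialFst hα j))) (conj (inner ℂ f S)) :=
    h2.mapL (Complex.conjCLE : ℂ →L[ℝ] ℂ)
  have h4 : ∀ k : bergmanSpace (thullen α hα), conj (inner ℂ f k : ℂ) = inner ℂ k f := fun k =>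
    inner_conj_symm k f
  rw [h4] at h3
  refine h3.unique ?_
  have e : (fun j => inner ℂ (((monomialCoeff α j : ℂ) * conj a ^ j) • monomialFst hα j) f) =
      fun j : ℕ => (j.factorial : ℂ)⁻¹ • (a - 0) ^ j •
        iteratedDeriv j (fun ζ => rep f (ζ, 0)) 0 := by
    ext j
    have hc : (monomialCoeff α j : ℂ) ≠ 0 := by exact_mod_cast (monomialCoeff_pos hα j).ne'
    rw [inner_smul_left (𝕜 := ℂ) (E := bergmanSpace _), map_mul, inner_monomialFst, map_pow,
      Complex.conj_conj, Complex.conj_ofReal, sub_zero, smul_eq_mul, smul_eq_mul]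
    push_cast
    field_simp
  simp only [h4, e]
  exact h1

theorem rep_axisKernel {a : ℂ} (ha : ‖a‖ < 1) {w : ℂ × ℂ} (hw : w ∈ thullen α hα) :
    rep (bergmanKernel (thullen α hα) (axisPoint hα ha)) w =
      kernelNum α (conj a * w.1) / (Real.pi ^ 2 * (1 - conj a * w.1) ^ 3) := by
  have h1 := (hasSum_axisKernel (hα := hα) ha).mapL (evalCLM ⟨w, hw⟩)
  have hx : ‖conj a * w.1‖ < 1 := by
    rw [norm_mul, RCLike.norm_conj]
    have := norm_fst_lt_of_mem hw
    nlinarith [norm_nonneg a, norm_nonneg w.1]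
  refine (h1.unique ?_)
  have e : (fun j => evalCLM ⟨w, hw⟩ (((monomialCoeff α j : ℂ) * conj a ^ j) • monomialFst hα j)) =
      fun j => (monomialCoeff α j : ℂ) * (conj a * w.1) ^ j := by
    ext j
    rw [map_smul, evalCLM_apply, rep_monomialFst j hw, smul_eq_mul, mul_pow, mul_assoc]
  rw [e]
  exact hasSum_monomialCoeff hx

end Kernel

/-! ## Action of the automorphisms on the Bergman space -/

section Transport

open ComplexConjugate bergmanSpace

variable {α : ℝ} {hα : 0 < α} {b : ℂ}

theorem differentiableOn_autoSnd (hb : ‖b‖ < 1) :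
    DifferentiableOn ℂ (autoSnd α b) (thullen α hα) := by
  intro w hw
  have hw2 := norm_snd_lt_of_mem hw
  have e : autoSnd α b = fun w => (w.1 * sndFactor α b w.2, mobius b w.2) := rfl
  rw [e]
  have h1 : DifferentiableAt ℂ (fun w : ℂ × ℂ => sndFactor α b w.2) w :=
    (differentiableAt_sndFactor hb hw2).comp w differentiableAt_snd
  have h2 : DifferentiableAt ℂ (fun w : ℂ × ℂ => mobius b w.2) w :=
    (hasDerivAt_mobius hb hw2.le).differentiableAt.comp w differentiableAt_snd
  exact ((differentiableAt_fst.mul h1).prodMk h2).differentiableWithinAt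

theorem differentiableOn_holJacobian_autoSnd (hb : ‖b‖ < 1) :
    DifferentiableOn ℂ (holJacobian (autoSnd α b)) (thullen α hα) := by
  have key : ∀ w ∈ (thullen α hα : Set (ℂ × ℂ)), holJacobian (autoSnd α b) w = sndFactor α b w.2 *
      (-((1 - ‖b‖ ^ 2 : ℝ) : ℂ) / (1 - conj b * w.2) ^ 2) := fun w hw => by
    have hw2 : ‖w.2‖ < 1 := norm_snd_lt_of_mem hw
    exact holJacobian_autoSnd hb hw2
  refine DifferentiableOn.congr ?_ key
  intro w hw
  have hw2 := norm_snd_lt_of_mem hw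
  have h0 := one_sub_conj_mul_ne_zero hb hw2.le
  have h1 : DifferentiableAt ℂ (fun w : ℂ × ℂ => sndFactor α b w.2) w :=
    (differentiableAt_sndFactor hb hw2).comp w differentiableAt_snd
  have h2 : DifferentiableAt ℂ (fun ζ : ℂ => -((1 - ‖b‖ ^ 2 : ℝ) : ℂ) / (1 - conj b * ζ) ^ 2) w.2 :=
    DifferentiableAt.div (by fun_prop) (by fun_prop) (pow_ne_zero 2 h0)
  exact (h1.mul (h2.comp w differentiableAt_snd)).differentiableWithinAt

theorem autoSnd_mem (hb : ‖b‖ < 1) {w : ℂ × ℂ} (hw : w ∈ thullen α hα) :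
    autoSnd α b w ∈ thullen α hα := (autoSnd_mem_iff hb (norm_snd_lt_of_mem hw)).2 hw

theorem differentiableOn_pullback (hb : ‖b‖ < 1) (f : bergmanSpace (thullen α hα)) :
    DifferentiableOn ℂ (fun w => rep f (autoSnd α b w) * holJacobian (autoSnd α b) w)
      (thullen α hα) :=
  ((differentiableOn_rep f).comp (differentiableOn_autoSnd hb) fun _ hw => autoSnd_mem hb hw).mul
    (differentiableOn_holJacobian_autoSnd hb)

theorem lintegral_pullback (hb : ‖b‖ < 1) (f : bergmanSpace (thullen α hα)) :
    ∫⁻ w in (thullen α hα : Set (ℂ × ℂ)), ‖rep f (autoSnd α b w) * holJacobian (autoSnd α b) w‖ₑ ^ 2 =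
      ‖f‖ₑ ^ 2 := by
  have hΩ := (thullen α hα).isOpen.measurableSet
  rw [enorm_sq_eq_lintegral, ← lintegral_autoSnd hb (G := fun w => ‖rep f w‖ₑ ^ 2)]
  · refine setLIntegral_congr_fun hΩ fun w hw => ?_
    rw [enorm_mul, mul_pow, ← norm_holJacobian_autoSnd_sq hb (norm_snd_lt_of_mem hw),
      ENNReal.ofReal_pow (norm_nonneg _), ofReal_norm, mul_comm]
  · have := measurable_indicator_of_continuousOn (differentiableOn_rep f).continuousOn
    have h2 := (this.enorm.pow_const 2).indicator hΩ
    convert h2 using 1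
    ext w
    by_cases hw : w ∈ (thullen α hα : Set (ℂ × ℂ))
    · simp [hw]
    · simp [hw]

theorem memLp_pullback (hb : ‖b‖ < 1) (f : bergmanSpace (thullen α hα)) :
    MemLp (fun w => rep f (autoSnd α b w) * holJacobian (autoSnd α b) w) 2
      (volume.restrict (thullen α hα)) := by
  refine ⟨(differentiableOn_pullback hb f).continuousOn.aestronglyMeasurable
    (thullen α hα).isOpen.measurableSet, ?_⟩
  rw [eLpNorm_lt_top_iff_lintegral_rpow_enorm_lt_top (by norm_num) (by norm_num)]
  simp only [ENNReal.toReal_ofNat, ENNReal.rpow_ofNat]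
  rw [lintegral_pullback hb]
  finiteness

/-- The unitary operator `f ↦ (f ∘ φ_b) · J φ_b` on the Bergman space of the Thullen domain. -/
def pullback (hα : 0 < α) (hb : ‖b‖ < 1) :
    bergmanSpace (thullen α hα) →ₗᵢ[ℂ] bergmanSpace (thullen α hα) where
  toFun f := ofHol _ (differentiableOn_pullback hb f) (memLp_pullback hb f)
  map_add' f g := by
    refine ext_rep fun w hw => ?_
    rw [rep_ofHol _ _ hw, rep_add _ _ hw, Pi.add_apply, rep_ofHol _ _ hw, rep_ofHol _ _ hw,
      rep_add _ _ (autoSnd_mem hb hw), Pi.add_apply]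
    ring
  map_smul' c f := by
    refine ext_rep fun w hw => ?_
    rw [rep_ofHol _ _ hw, rep_smul _ _ hw, Pi.smul_apply, rep_ofHol _ _ hw,
      rep_smul _ _ (autoSnd_mem hb hw), Pi.smul_apply, RingHom.id_apply, smul_eq_mul, smul_eq_mul]
    ring
  norm_map' f := by
    change ‖ofHol _ (differentiableOn_pullback hb f) (memLp_pullback hb f)‖ = ‖f‖
    have h := enorm_sq_eq_lintegral (ofHol _ (differentiableOn_pullback hb f) (memLp_pullback hb f))
    have h2 : ∫⁻ w in thullen α hα,
        ‖rep (ofHol _ (differentiableOn_pullback hb f) (memLp_pullback hb f)) w‖ₑ ^ 2 =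
        ‖f‖ₑ ^ 2 := by
      rw [← lintegral_pullback hb f]
      refine setLIntegral_congr_fun (thullen α hα).isOpen.measurableSet fun w hw => ?_
      rw [rep_ofHol _ _ hw]
    rw [h2] at h
    have h3 := (ENNReal.pow_right_strictMono two_ne_zero).injective h
    exact (enorm_eq_iff_norm_eq).1 h3

theorem rep_pullback (hb : ‖b‖ < 1) (f : bergmanSpace (thullen α hα)) {w : ℂ × ℂ}
    (hw : w ∈ thullen α hα) :
    rep (pullback hα hb f) w = rep f (autoSnd α b w) * holJacobian (autoSnd α b) w :=
  rep_ofHol (differentiableOn_pullback hb f) (memLp_pullback hb f) hw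

theorem pullback_pullback (hb : ‖b‖ < 1) (f : bergmanSpace (thullen α hα)) :
    pullback hα hb (pullback hα hb f) = f := by
  refine ext_rep fun w hw => ?_
  have hw2 := norm_snd_lt_of_mem hw
  rw [rep_pullback hb _ hw, rep_pullback hb _ (autoSnd_mem hb hw), autoSnd_autoSnd hb hw2, mul_assoc,
    holJacobian_autoSnd_mul hb hw2, mul_one]

/-- The automorphism `autoSnd α b` as a map of the domain to itself. -/
def autoPoint (hb : ‖b‖ < 1) (x : thullen α hα) : thullen α hα :=
  ⟨autoSnd α b x, autoSnd_mem hb x.2⟩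

/-- An isometric involution is self-adjoint, so pairing the image of K_x with f evaluates the
pullback of f at x. -/
theorem pullback_bergmanKernel (hb : ‖b‖ < 1) (x : thullen α hα) :
    pullback hα hb (bergmanKernel _ x) =
      conj (holJacobian (autoSnd α b) x) • bergmanKernel _ (autoPoint hb x) := by
  refine ext_inner_right ℂ fun f => ?_
  rw [inner_smul_left (𝕜 := ℂ) (E := bergmanSpace _), Complex.conj_conj, inner_bergmanKernel]
  conv_lhs => rw [← pullback_pullback hb f]
  rw [(pullback hα hb).inner_map_map, inner_bergmanKernel, rep_pullback hb f x.2, mul_comm]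
  rfl

theorem norm_bergmanKernel_eq (hb : ‖b‖ < 1) (x : thullen α hα) :
    ‖bergmanKernel _ x‖ = ‖holJacobian (autoSnd α b) x‖ * ‖bergmanKernel _ (autoPoint hb x)‖ := by
  rw [← (pullback hα hb).norm_map, pullback_bergmanKernel, norm_smul, RCLike.norm_conj]

theorem norm_inner_bergmanKernel_eq (hb : ‖b‖ < 1) (x y : thullen α hα) :
    ‖inner ℂ (bergmanKernel _ x) (bergmanKernel _ y)‖ = ‖holJacobian (autoSnd α b) x‖ *
      ‖holJacobian (autoSnd α b) y‖ *
      ‖inner ℂ (bergmanKernel _ (autoPoint hb x)) (bergmanKernel _ (autoPoint hb y))‖ := by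
  rw [← (pullback hα hb).inner_map_map, pullback_bergmanKernel, pullback_bergmanKernel,
    inner_smul_left (𝕜 := ℂ) (E := bergmanSpace _),
    inner_smul_right (𝕜 := ℂ) (E := bergmanSpace _), norm_mul, norm_mul, Complex.conj_conj, RCLike.norm_conj,
    mul_assoc]

end Transport

/-! ## Size and overlap of the kernel functions -/

section KernelEstimates

open ComplexConjugate bergmanSpace

variable {α : ℝ} {hα : 0 < α}

/-- The numerator of the Bergman kernel at real arguments. -/
def kernelNumReal (α x : ℝ) : ℝ := (1 + α) + (α - 1) * x

theorem kernelNum_ofReal (x : ℝ) : kernelNum α (x : ℂ) = (kernelNumReal α x : ℂ) := by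
  rw [kernelNum, kernelNumReal]
  push_cast
  rfl

theorem two_mul_min_le_kernelNumReal {x : ℝ} (hx0 : 0 ≤ x) (hx : x ≤ 1) :
    2 * min 1 α ≤ kernelNumReal α x := by
  rw [kernelNumReal]
  rcases le_total 1 α with h | h
  · rw [min_eq_left h]; nlinarith
  · rw [min_eq_right h]; nlinarith

theorem kernelNumReal_le_two_mul_max {x : ℝ} (hx0 : 0 ≤ x) (hx : x ≤ 1) :
    kernelNumReal α x ≤ 2 * max 1 α := by
  rw [kernelNumReal]
  rcases le_total 1 α with h | h
  · rw [max_eq_right h]; nlinarith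
  · rw [max_eq_left h]; nlinarith

/-- Reverse triangle inequality: 1 + α - |α - 1| = 2 min(1, α). The numerator thus never degenerates
on the closed disc. -/
theorem two_mul_min_le_norm_kernelNum (hα : 0 < α) {x : ℂ} (hx : ‖x‖ ≤ 1) :
    2 * min 1 α ≤ ‖kernelNum α x‖ := by
  have h1 : ‖((1 + α : ℝ) : ℂ)‖ ≤ ‖kernelNum α x‖ + ‖((α - 1 : ℝ) : ℂ) * x‖ := by
    have e : ((1 + α : ℝ) : ℂ) = kernelNum α x - ((α - 1 : ℝ) : ℂ) * x := by
      rw [kernelNum]; push_cast; ring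
    rw [e]
    exact norm_sub_le _ _
  rw [norm_mul, Complex.norm_real, Complex.norm_real, Real.norm_of_nonneg (by linarith),
    Real.norm_eq_abs] at h1
  have h2 : |α - 1| * ‖x‖ ≤ |α - 1| := mul_le_of_le_one_right (abs_nonneg _) hx
  rcases le_total 1 α with h | h
  · rw [min_eq_left h]; rw [abs_of_nonneg (by linarith)] at *; linarith
  · rw [min_eq_right h]; rw [abs_of_nonpos (by linarith)] at *; linarith

theorem norm_axisKernel_sq {a : ℂ} (ha : ‖a‖ < 1) :
    ‖bergmanKernel (thullen α hα) (axisPoint hα ha)‖ ^ 2 =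
      kernelNumReal α (‖a‖ ^ 2) / (Real.pi ^ 2 * (1 - ‖a‖ ^ 2) ^ 3) := by
  have h1 : (inner ℂ (bergmanKernel (thullen α hα) (axisPoint hα ha))
      (bergmanKernel (thullen α hα) (axisPoint hα ha)) : ℂ) =
      (‖bergmanKernel (thullen α hα) (axisPoint hα ha)‖ : ℂ) ^ 2 :=
    inner_self_eq_norm_sq_to_K (𝕜 := ℂ) (bergmanKernel (thullen α hα) (axisPoint hα ha))
  rw [inner_bergmanKernel, rep_axisKernel ha (axisPoint hα ha).2] at h1
  simp only [axisPoint] at h1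
  rw [conj_mul_self_eq, kernelNum_ofReal] at h1
  exact_mod_cast h1.symm

theorem sndFactor_zero {b : ℂ} (hb : ‖b‖ < 1) :
    sndFactor α b 0 = (((1 - ‖b‖ ^ 2) ^ (α / 2) : ℝ) : ℂ) := by
  have h := one_sub_norm_sq_pos hb
  rw [sndFactor, mul_zero, sub_zero, div_one, ← Complex.ofReal_cpow (Real.sqrt_nonneg _),
    Real.sqrt_eq_rpow, ← Real.rpow_mul h.le]
  congr 2
  ring

/-- Every orbit of the automorphisms φ_b meets the axis, so the kernel formulas on the axis
determine all norms and overlaps. -/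
theorem autoPoint_axisPoint (z : thullen α hα) :
    autoPoint (norm_snd_lt_of_mem z.2) (axisPoint hα (norm_fAlpha_lt z.2)) = z := by
  have hb := norm_snd_lt_of_mem z.2
  have h := Real.rpow_pos_of_pos (one_sub_norm_sq_pos hb) (α / 2)
  refine Subtype.ext ?_
  change autoSnd α (z : ℂ × ℂ).2 (fAlpha α z, 0) = z
  rw [autoSnd_eq]
  refine Prod.ext ?_ (mobius_zero_right _)
  simp only
  rw [sndFactor_zero hb, fAlpha, div_mul_cancel₀]
  exact_mod_cast h.ne'

theorem norm_bergmanKernel_sq_mul_sndDensity {b : ℂ} (hb : ‖b‖ < 1) (x : thullen α hα) :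
    ‖bergmanKernel _ (autoPoint hb x)‖ ^ 2 * sndDensity α b x = ‖bergmanKernel _ x‖ ^ 2 := by
  rw [norm_bergmanKernel_eq hb x, mul_pow, norm_holJacobian_autoSnd_sq hb (norm_snd_lt_of_mem x.2),
    mul_comm]

theorem norm_bergmanKernel_sq (z : thullen α hα) :
    ‖bergmanKernel _ z‖ ^ 2 =
      kernelNumReal α (‖fAlpha α z‖ ^ 2) / Real.pi ^ 2 * kernelSize α z := by
  have hb := norm_snd_lt_of_mem z.2
  have ha := norm_fAlpha_lt z.2
  have h := norm_bergmanKernel_sq_mul_sndDensity hb (axisPoint hα ha)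
  have hca := one_sub_norm_sq_pos ha
  have hcb := one_sub_norm_sq_pos hb
  have hpi := Real.pi_pos
  rw [autoPoint_axisPoint, norm_axisKernel_sq, sndDensity, mobiusDensity] at h
  simp only [axisPoint, mul_zero, sub_zero, norm_one, one_pow, div_one] at h
  rw [kernelSize, Real.rpow_neg hcb.le, Real.rpow_neg hca.le, add_comm 2 α]
  have h1 : (1 - ‖(z : ℂ × ℂ).2‖ ^ 2) ^ (α + 2) ≠ 0 := (Real.rpow_pos_of_pos hcb _).ne'
  rw [← mul_right_cancel_iff_of_pos (Real.rpow_pos_of_pos hcb (α + 2)), h]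
  norm_cast
  field_simp

theorem norm_sq_le_one_of_lt {c : ℂ} (hc : ‖c‖ < 1) : ‖c‖ ^ 2 ≤ 1 :=
  pow_le_one₀ (norm_nonneg _) hc.le

theorem norm_bergmanKernel_sq_le (z : thullen α hα) :
    ‖bergmanKernel _ z‖ ^ 2 ≤ 2 * max 1 α / Real.pi ^ 2 * kernelSize α z := by
  rw [norm_bergmanKernel_sq]
  have := kernelSize_pos z.2
  have := kernelNumReal_le_two_mul_max (α := α) (sq_nonneg ‖fAlpha α z‖)
    (norm_sq_le_one_of_lt (norm_fAlpha_lt z.2))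
  gcongr

theorem norm_bergmanKernel_pos (z : thullen α hα) : 0 < ‖bergmanKernel _ z‖ := by
  have h1 := kernelSize_pos z.2
  have h2 := two_mul_min_le_kernelNumReal (α := α) (sq_nonneg ‖fAlpha α z‖)
    (norm_sq_le_one_of_lt (norm_fAlpha_lt z.2))
  have h3 : 0 < min 1 α := lt_min one_pos hα
  have h4 : 0 < ‖bergmanKernel _ z‖ ^ 2 := by
    rw [norm_bergmanKernel_sq]
    have : 0 < kernelNumReal α (‖fAlpha α z‖ ^ 2) := by linarith
    have := Real.pi_pos
    positivity
  exact (norm_nonneg _).lt_of_ne' fun h => by simp [h] at h4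

theorem norm_inner_normalizedKernel (z w : thullen α hα) :
    ‖(inner ℂ (normalizedKernel _ z) (normalizedKernel _ w) : ℂ)‖ =
      ‖(inner ℂ (bergmanKernel _ z) (bergmanKernel _ w) : ℂ)‖ /
        (‖bergmanKernel _ z‖ * ‖bergmanKernel _ w‖) := by
  rw [normalizedKernel, normalizedKernel, inner_smul_left (𝕜 := ℂ) (E := bergmanSpace _),
    inner_smul_right (𝕜 := ℂ) (E := bergmanSpace _), norm_mul, norm_mul, RCLike.norm_conj,
    Complex.norm_real, Complex.norm_real, norm_inv, norm_inv, norm_norm, norm_norm]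
  have h1 := (norm_bergmanKernel_pos z).ne'
  have h2 := (norm_bergmanKernel_pos w).ne'
  field_simp

/-- The pullback sends a normalized kernel to a unimodular multiple of the one at the image point;
the Jacobians cancel. -/
theorem norm_inner_normalizedKernel_autoPoint {b : ℂ} (hb : ‖b‖ < 1) (x y : thullen α hα) :
    ‖(inner ℂ (normalizedKernel _ (autoPoint hb x)) (normalizedKernel _ (autoPoint hb y)) : ℂ)‖ =
      ‖(inner ℂ (normalizedKernel _ x) (normalizedKernel _ y) : ℂ)‖ := by
  rw [norm_inner_normalizedKernel, norm_inner_normalizedKernel, norm_inner_bergmanKernel_eq hb x y,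
    norm_bergmanKernel_eq hb x, norm_bergmanKernel_eq hb y]
  have h1 := norm_bergmanKernel_pos x
  have h2 := norm_bergmanKernel_pos y
  rw [norm_bergmanKernel_eq hb x] at h1
  rw [norm_bergmanKernel_eq hb y] at h2
  have h3 := (pos_of_mul_pos_left h1 (norm_nonneg _)).ne'
  have h4 := (pos_of_mul_pos_left h2 (norm_nonneg _)).ne'
  have h5 := (norm_bergmanKernel_pos (autoPoint hb x)).ne'
  have h6 := (norm_bergmanKernel_pos (autoPoint hb y)).ne'
  field_simp

/-- The map `autoFst α (fAlpha α z)` as a map of the domain to itself. -/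
def fstPoint (z u : thullen α hα) : thullen α hα :=
  ⟨autoFst α (fAlpha α z) u, autoFst_fAlpha_mem z.2 u.2⟩

/-- The map `centerMap α z` as a map of the domain to itself. -/
def centerPoint (z u : thullen α hα) : thullen α hα :=
  ⟨centerMap α z u, centerMap_mem z.2 u.2⟩

theorem centerPoint_eq (z u : thullen α hα) :
    centerPoint z u = autoPoint (norm_snd_lt_of_mem z.2) (fstPoint z u) := rfl

/-- Invariance under φ_{z₂} replaces the pair by (f_α(z), 0) and ϕ_{f_α(z)}(u), where the explicit
axis kernel applies. Invariance fails for the non-holomorphic map ϕ, whence the remaining dependence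
on z. -/
theorem norm_inner_centerPoint_sq (z u : thullen α hα) :
    ‖(inner ℂ (normalizedKernel _ z) (normalizedKernel _ (centerPoint z u)) : ℂ)‖ ^ 2 =
      ‖kernelNum α (conj (fAlpha α z) * mobius (fAlpha α z) (u : ℂ × ℂ).1)‖ ^ 2 /
        (kernelNumReal α (‖fAlpha α z‖ ^ 2) *
          kernelNumReal α (‖fAlpha α (fstPoint z u)‖ ^ 2)) *
        (1 - ‖(fstPoint z u : ℂ × ℂ).2‖ ^ 2) ^ (2 + α) *
        ((1 - ‖fAlpha α (fstPoint z u)‖ ^ 2) /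
          mobiusDensity (fAlpha α z) (u : ℂ × ℂ).1) ^ 3 := by
  have hb := norm_snd_lt_of_mem z.2
  have ha := norm_fAlpha_lt z.2
  have hu1 := norm_fst_lt_of_mem u.2
  have hca := one_sub_norm_sq_pos ha
  have hδ := one_sub_norm_sq_pos (norm_snd_lt_of_mem (fstPoint z u).2)
  have hA := one_sub_norm_sq_pos (norm_fAlpha_lt (fstPoint z u).2)
  have hpi := Real.pi_pos
  have hpos := norm_one_sub_conj_mul_pos ha hu1.le
  have hmin : 0 < min 1 α := lt_min one_pos hα
  have hn1 := two_mul_min_le_kernelNumReal (α := α) (sq_nonneg ‖fAlpha α z‖)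
    (norm_sq_le_one_of_lt ha)
  have hn2 := two_mul_min_le_kernelNumReal (α := α) (sq_nonneg ‖fAlpha α (fstPoint z u)‖)
    (norm_sq_le_one_of_lt (norm_fAlpha_lt (fstPoint z u).2))
  have hn1' : 0 < kernelNumReal α (‖fAlpha α z‖ ^ 2) := by linarith
  have hn2' : 0 < kernelNumReal α (‖fAlpha α (fstPoint z u)‖ ^ 2) := by linarith
  have h1 : ‖(inner ℂ (normalizedKernel _ z) (normalizedKernel _ (centerPoint z u)) : ℂ)‖ =
      ‖(inner ℂ (normalizedKernel _ (axisPoint hα ha)) (normalizedKernel _ (fstPoint z u)) : ℂ)‖ := by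
    rw [← norm_inner_normalizedKernel_autoPoint hb (axisPoint hα ha) (fstPoint z u),
      autoPoint_axisPoint, centerPoint_eq]
  have h2 : ‖(inner ℂ (bergmanKernel _ (axisPoint hα ha)) (bergmanKernel _ (fstPoint z u)) : ℂ)‖ =
      ‖rep (bergmanKernel _ (axisPoint hα ha)) (fstPoint z u)‖ := by
    rw [← inner_bergmanKernel]
    exact norm_inner_symm (𝕜 := ℂ) (E := bergmanSpace _) _ _
  have e1 : ((fstPoint z u : thullen α hα) : ℂ × ℂ).1 = mobius (fAlpha α z) (u : ℂ × ℂ).1 := rfl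
  rw [h1, norm_inner_normalizedKernel, h2, rep_axisKernel ha (fstPoint z u).2, div_pow, mul_pow,
    norm_axisKernel_sq, norm_bergmanKernel_sq, kernelSize, norm_div, norm_mul, norm_pow, norm_pow,
    Complex.norm_real, Real.norm_of_nonneg hpi.le, e1, one_sub_conj_mul_mobius ha hu1.le, norm_div,
    Complex.norm_real, Real.norm_of_nonneg hca.le, mobiusDensity, Real.rpow_neg hδ.le,
    Real.rpow_neg hA.le]
  have h3 : (1 - ‖(fstPoint z u : ℂ × ℂ).2‖ ^ 2) ^ (2 + α) ≠ 0 := (Real.rpow_pos_of_pos hδ _).ne'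
  norm_cast
  field_simp

theorem fiberSq_fAlpha_le {z : ℂ × ℂ} (hz : z ∈ thullen α hα) :
    defect α z ≤ max 1 (1 / α) * (1 - ‖fAlpha α z‖ ^ 2) := by
  have h1 := fiberSq_fAlpha hα (norm_snd_lt_of_mem hz)
  have h2 := fiberSq_le_max_mul hα (norm_fAlpha_lt hz).le
  have h3 := fiberSq_pos hα (norm_fAlpha_lt hz)
  have h4 := one_sub_norm_sq_pos (norm_snd_lt_of_mem hz)
  nlinarith [sq_nonneg ‖z.2‖]

theorem defect_le_one_sub_fstPoint (z u : thullen α hα) :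
    defect α u ≤ 1 - ‖(fstPoint z u : ℂ × ℂ).2‖ ^ 2 := by
  have hu1 := norm_fst_lt_of_mem u.2
  have ha := norm_fAlpha_lt z.2
  have hR := fiberSq_pos hα hu1
  have h : ‖(fstPoint z u : ℂ × ℂ).2‖ ^ 2 = _ := norm_autoFst_snd_sq hα ha hu1
  have hd := mem_thullen_iff.1 u.2
  rw [h, fiberRatio, mul_div_assoc', le_sub_comm, div_le_iff₀ hR]
  rw [defect] at hd ⊢
  have := fiberSq_le_one α (mobius (fAlpha α z) (u : ℂ × ℂ).1)
  have := fiberSq_le_one α (u : ℂ × ℂ).1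
  nlinarith [sq_nonneg ‖(u : ℂ × ℂ).2‖]

/-- In the overlap formula the numerators are pinched between constants, the second factor is at
least the power 2 + α of the defining function at u, and the cube is at least a constant times its
third power. All constants are free of z. -/
theorem exists_overlap_lower_bound (hα : 0 < α) : ∃ c : ℝ, 0 < c ∧ ∀ z u : thullen α hα,
    c * defect α u ^ (5 + α) ≤
      ‖(inner ℂ (normalizedKernel _ z) (normalizedKernel _ (centerPoint z u)) : ℂ)‖ ^ 2 := by
  have hmin : 0 < min 1 α := lt_min one_pos hα
  have hk := min_one_div_pos hα
  have hK := max_one_div_pos α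
  have hmax : 0 < max 1 α := by positivity
  refine ⟨(2 * min 1 α) ^ 2 / ((2 * max 1 α) * (2 * max 1 α)) *
    (min 1 (1 / α) / max 1 (1 / α) ^ 2) ^ 3, by positivity, fun z u => ?_⟩
  have ha := norm_fAlpha_lt z.2
  have hu1 := norm_fst_lt_of_mem u.2
  have hδ := one_sub_norm_sq_pos (norm_snd_lt_of_mem (fstPoint z u).2)
  have hA := one_sub_norm_sq_pos (norm_fAlpha_lt (fstPoint z u).2)
  have hd := mem_thullen_iff.1 u.2
  have hD := mobiusDensity_pos ha hu1.le
  have hn1 := two_mul_min_le_kernelNumReal (α := α) (sq_nonneg ‖fAlpha α z‖)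
    (norm_sq_le_one_of_lt ha)
  have hn2 := two_mul_min_le_kernelNumReal (α := α) (sq_nonneg ‖fAlpha α (fstPoint z u)‖)
    (norm_sq_le_one_of_lt (norm_fAlpha_lt (fstPoint z u).2))
  have hn3 := kernelNumReal_le_two_mul_max (α := α) (sq_nonneg ‖fAlpha α z‖)
    (norm_sq_le_one_of_lt ha)
  have hn4 := kernelNumReal_le_two_mul_max (α := α) (sq_nonneg ‖fAlpha α (fstPoint z u)‖)
    (norm_sq_le_one_of_lt (norm_fAlpha_lt (fstPoint z u).2))
  have hn1' : 0 < kernelNumReal α (‖fAlpha α z‖ ^ 2) := by linarith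
  have hn2' : 0 < kernelNumReal α (‖fAlpha α (fstPoint z u)‖ ^ 2) := by linarith
  have hn5 := two_mul_min_le_norm_kernelNum hα
    (x := conj (fAlpha α z) * mobius (fAlpha α z) (u : ℂ × ℂ).1) (by
      rw [norm_mul, RCLike.norm_conj]
      exact mul_le_one₀ ha.le (norm_nonneg _) (norm_mobius_lt ha hu1).le)
  have hb1 : min 1 (1 / α) / max 1 (1 / α) ^ 2 * defect α u ≤
      (1 - ‖fAlpha α (fstPoint z u)‖ ^ 2) / mobiusDensity (fAlpha α z) (u : ℂ × ℂ).1 := by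
    have h1 := fiberSq_fAlpha_le (fstPoint z u).2
    have h2 : defect α (fstPoint z u) = _ := defect_autoFst hα ha hu1
    have h3 := le_fiberRatio hα ha hu1
    rw [h2] at h1
    rw [le_div_iff₀ hD]
    have h4 : min 1 (1 / α) / max 1 (1 / α) * mobiusDensity (fAlpha α z) (u : ℂ × ℂ).1 *
        defect α u ≤ max 1 (1 / α) * (1 - ‖fAlpha α (fstPoint z u)‖ ^ 2) :=
      le_trans (by gcongr) h1
    rw [← mul_le_mul_iff_right₀ hK]
    refine le_trans (le_of_eq ?_) h4
    field_simp
  have hb2 := defect_le_one_sub_fstPoint z u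
  rw [norm_inner_centerPoint_sq]
  have e : defect α u ^ (5 + α) = defect α u ^ (2 + α) * defect α u ^ 3 := by
    rw [← Real.rpow_natCast (defect α u) 3, ← Real.rpow_add hd]
    congr 1
    push_cast
    ring
  rw [e]
  calc _ = (2 * min 1 α) ^ 2 / ((2 * max 1 α) * (2 * max 1 α)) * defect α u ^ (2 + α) *
        (min 1 (1 / α) / max 1 (1 / α) ^ 2 * defect α u) ^ 3 := by ring
    _ ≤ _ := by gcongr

/-- The measure ‖K_w‖² dσ, pulled back by the recentring map, dominates a fixed multiple of Lebesgue
measure. The factor φ_{z₂} preserves it exactly; for ϕ, the kernel is at least a constant times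
D^(-3) and the Jacobian at least a constant times D³, where D is the Möbius density. -/
theorem exists_kernel_mul_density_lower_bound (hα : 0 < α) : ∃ c : ℝ, 0 < c ∧
    ∀ z u : thullen α hα, c ≤ ‖bergmanKernel _ (centerPoint z u)‖ ^ 2 * centerDensity α z u := by
  have hmin : 0 < min 1 α := lt_min one_pos hα
  have hk := min_one_div_pos hα
  have hK := max_one_div_pos α
  have hpi := Real.pi_pos
  refine ⟨2 * min 1 α / Real.pi ^ 2 * (min 1 (1 / α) / max 1 (1 / α)), by positivity, fun z u => ?_⟩
  have hb := norm_snd_lt_of_mem z.2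
  have ha := norm_fAlpha_lt z.2
  have hu1 := norm_fst_lt_of_mem u.2
  have hy2 := norm_snd_lt_of_mem (fstPoint z u).2
  have hδ := one_sub_norm_sq_pos hy2
  have hA := one_sub_norm_sq_pos (norm_fAlpha_lt (fstPoint z u).2)
  have hD := mobiusDensity_pos ha hu1.le
  have hn2 := two_mul_min_le_kernelNumReal (α := α) (sq_nonneg ‖fAlpha α (fstPoint z u)‖)
    (norm_sq_le_one_of_lt (norm_fAlpha_lt (fstPoint z u).2))
  have h1 := norm_bergmanKernel_sq_mul_sndDensity hb (fstPoint z u)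
  have h3 := le_fiberRatio hα ha hu1
  have h4 : 1 - ‖fAlpha α (fstPoint z u)‖ ^ 2 ≤ mobiusDensity (fAlpha α z) (u : ℂ × ℂ).1 := by
    have e1 : ((fstPoint z u : thullen α hα) : ℂ × ℂ).1 = mobius (fAlpha α z) (u : ℂ × ℂ).1 := rfl
    have h5 : ‖mobius (fAlpha α z) (u : ℂ × ℂ).1‖ ≤ ‖fAlpha α (fstPoint z u)‖ := by
      rw [norm_fAlpha hy2, e1, le_div_iff₀ (Real.rpow_pos_of_pos hδ _)]
      refine mul_le_of_le_one_right (norm_nonneg _) (Real.rpow_le_one hδ.le ?_ (by positivity))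
      nlinarith [norm_nonneg (fstPoint z u : ℂ × ℂ).2]
    have h6 := one_sub_norm_mobius_sq ha hu1.le
    have h7 : ‖mobius (fAlpha α z) (u : ℂ × ℂ).1‖ ^ 2 ≤ ‖fAlpha α (fstPoint z u)‖ ^ 2 := by gcongr
    nlinarith [sq_nonneg ‖(u : ℂ × ℂ).1‖]
  have h5 : mobiusDensity (fAlpha α z) (u : ℂ × ℂ).1 ^ (-3 : ℝ) ≤ kernelSize α (fstPoint z u) := by
    rw [kernelSize]
    refine (Real.rpow_le_rpow_of_nonpos hA h4 (by norm_num)).trans ?_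
    refine le_mul_of_one_le_left (by positivity) ?_
    refine Real.one_le_rpow_of_pos_of_le_one_of_nonpos hδ ?_ (by linarith)
    nlinarith [norm_nonneg (fstPoint z u : ℂ × ℂ).2]
  have e : ‖bergmanKernel _ (centerPoint z u)‖ ^ 2 * centerDensity α z u =
      ‖bergmanKernel _ (fstPoint z u)‖ ^ 2 * fstDensity α (fAlpha α z) u := by
    rw [← h1, centerPoint_eq, centerDensity, mul_assoc]
    rfl
  rw [e, norm_bergmanKernel_sq, fstDensity]
  have e2 : 2 * min 1 α / Real.pi ^ 2 * (min 1 (1 / α) / max 1 (1 / α)) =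
      2 * min 1 α / Real.pi ^ 2 * mobiusDensity (fAlpha α z) (u : ℂ × ℂ).1 ^ (-3 : ℝ) *
      (mobiusDensity (fAlpha α z) (u : ℂ × ℂ).1 ^ 2 *
      (min 1 (1 / α) / max 1 (1 / α) * mobiusDensity (fAlpha α z) (u : ℂ × ℂ).1)) := by
    rw [Real.rpow_neg hD.le]
    norm_cast
    field_simp
  rw [e2]
  have hkn : 0 < kernelNumReal α (‖fAlpha α (fstPoint z u)‖ ^ 2) := by linarith
  have hks := kernelSize_pos (fstPoint z u).2
  gcongr

end KernelEstimates

/-! ### Overlap of kernel functions near the diagonal -/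

section OverlapNearOne

open ComplexConjugate bergmanSpace

variable {α : ℝ} {hα : 0 < α}

/-- On [0, 1/2] one has -log(1-x) ≤ 2x; then e^t - 1 ≤ t e^t with t = 2αx ≤ α. -/
theorem one_sub_rpow_neg_sub_one_le (hα : 0 < α) {x : ℝ} (hx0 : 0 ≤ x) (hx : x ≤ 1 / 2) :
    (1 - x) ^ (-α) - 1 ≤ 2 * α * Real.exp α * x := by
  have h1 : 0 < 1 - x := by linarith
  have h2 := Real.one_sub_inv_le_log_of_pos h1
  have h3 : -(2 * x) ≤ 1 - (1 - x)⁻¹ := by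
    rw [neg_le_sub_iff_le_add, inv_le_iff_one_le_mul₀ h1]
    nlinarith
  have h4 : (1 - x) ^ (-α) ≤ Real.exp (2 * α * x) := by
    rw [Real.rpow_def_of_pos h1, Real.exp_le_exp]
    nlinarith
  have h5 := Real.add_one_le_exp (-(2 * α * x))
  have h6 : Real.exp (2 * α * x) ≤ Real.exp α := Real.exp_le_exp.2 (by nlinarith)
  have h7 : Real.exp (-(2 * α * x)) * Real.exp (2 * α * x) = 1 := by
    rw [← Real.exp_add, neg_add_cancel, Real.exp_zero]
  have h8 := Real.exp_pos (2 * α * x)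
  have h9 : 0 ≤ 2 * α * x := by positivity
  nlinarith

/-- The difference equals -ζ(1-|a|²)/(1-āζ), and |1-āζ| ≥ 1-|a| makes the bound uniform in a. -/
theorem norm_mobius_sub_le {a ζ : ℂ} (ha : ‖a‖ < 1) (hζ : ‖ζ‖ < 1) :
    ‖mobius a ζ - a‖ ≤ 2 * ‖ζ‖ := by
  have h0 := one_sub_conj_mul_ne_zero ha hζ.le
  have hpos := norm_one_sub_conj_mul_pos ha hζ.le
  have e : mobius a ζ - a = -(ζ * ((1 - ‖a‖ ^ 2 : ℝ) : ℂ)) / (1 - conj a * ζ) := by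
    have := conj_mul_self_eq a
    rw [mobius, eq_div_iff h0, sub_mul, div_mul_cancel₀ _ h0]
    push_cast at this ⊢
    linear_combination ζ * this
  have h1 : 1 - ‖a‖ ≤ ‖1 - conj a * ζ‖ := by
    have := norm_sub_norm_le (1 : ℂ) (conj a * ζ)
    rw [norm_one, norm_mul, RCLike.norm_conj] at this
    nlinarith [norm_nonneg a]
  rw [e, norm_div, norm_neg, norm_mul, Complex.norm_real,
    Real.norm_of_nonneg (one_sub_norm_sq_pos ha).le, div_le_iff₀ hpos]
  have h2 : 1 - ‖a‖ ^ 2 ≤ 2 * (1 - ‖a‖) := by nlinarith [norm_nonneg a]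
  have h3 : 1 - ‖a‖ ^ 2 ≤ 2 * ‖1 - conj a * ζ‖ := by linarith
  nlinarith [norm_nonneg ζ]

theorem sq_le_sq_add_of_sub_le {x y t : ℝ} (hx0 : 0 ≤ x) (hx1 : x ≤ 1) (hy0 : 0 ≤ y) (hy1 : y ≤ 1)
    (ht : 0 ≤ t) (h : x - y ≤ t) : x ^ 2 ≤ y ^ 2 + 2 * t := by
  nlinarith

theorem norm_normalizedKernel (z : thullen α hα) : ‖normalizedKernel _ z‖ = 1 := by
  rw [normalizedKernel, norm_smul, Complex.norm_real, norm_inv, norm_norm,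
    inv_mul_cancel₀ (norm_bergmanKernel_pos z).ne']

theorem norm_inner_normalizedKernel_le_one (z w : thullen α hα) :
    ‖(inner ℂ (normalizedKernel _ z) (normalizedKernel _ w) : ℂ)‖ ≤ 1 := by
  refine (norm_inner_le_norm (𝕜 := ℂ) (E := bergmanSpace _) _ _).trans (le_of_eq ?_)
  rw [norm_normalizedKernel, norm_normalizedKernel, mul_one]

set_option maxHeartbeats 1000000 in
/-- Quantitative form of the continuity of the overlap of kernel functions near the diagonal. -/
theorem exists_overlap_bound (hα : 0 < α) : ∃ C : ℝ, 1 ≤ C ∧ ∀ (ε : ℝ), 0 < ε → C * ε ≤ 1 / 2 →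
    ∀ z u : thullen α hα, ‖(u : ℂ × ℂ)‖ ≤ ε → 1 - ε ≤ defect α u →
    (1 - C * ε) ^ 2 / (1 + C * ε) * (1 - C * ε) ^ (2 + α) * (1 - C * ε) ^ 3 ≤
      ‖(inner ℂ (normalizedKernel _ z) (normalizedKernel _ (centerPoint z u)) : ℂ)‖ ^ 2 := by
  have hmin : 0 < min 1 α := lt_min one_pos hα
  obtain ⟨K, hKdef⟩ : ∃ K, K = max 1 (1 / α) / min 1 (1 / α) := ⟨_, rfl⟩
  have hK : 0 < K := by rw [hKdef]; exact div_pos (max_one_div_pos α) (min_one_div_pos hα)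
  obtain ⟨L, hLdef⟩ : ∃ L, L = 2 * α * Real.exp α := ⟨_, rfl⟩
  have hL : 0 < L := by rw [hLdef]; positivity
  obtain ⟨β, hβdef⟩ : ∃ β, β = |α - 1| / (2 * min 1 α) := ⟨_, rfl⟩
  have hβ : 0 ≤ β := by rw [hβdef]; positivity
  -- K bounds the fibre ratio by the Möbius density, L bounds the growth of (1-x)^(-α) near 0, and β
  -- divides |α-1| by the lower bound 2 min(1,α) of the numerators. The part 1 + LK serves the
  -- quotient that is cubed, β(4+L) the ratio of numerators.
  refine ⟨1 + L * K + β * (4 + L), by nlinarith [mul_pos hL hK, mul_nonneg hβ hL.le],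
    fun ε hε hC z u hu hdef => ?_⟩
  obtain ⟨C, hCdef⟩ : ∃ C, C = 1 + L * K + β * (4 + L) := ⟨_, rfl⟩
  rw [← hCdef] at hC ⊢
  have hLK := mul_pos hL hK
  have hβL := mul_nonneg hβ hL.le
  have hC1 : 1 ≤ C := by rw [hCdef]; nlinarith
  have hεC : ε ≤ C * ε := by nlinarith
  have hε1 : ε ≤ 1 / 2 := hεC.trans hC
  have ha := norm_fAlpha_lt z.2
  have hu1 := norm_fst_lt_of_mem u.2
  have hy2 := norm_snd_lt_of_mem (fstPoint z u).2
  have hδ := one_sub_norm_sq_pos hy2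
  have hA := one_sub_norm_sq_pos (norm_fAlpha_lt (fstPoint z u).2)
  have hD := mobiusDensity_pos ha hu1.le
  have hu1ε : ‖(u : ℂ × ℂ).1‖ ≤ ε := (norm_fst_le _).trans hu
  have hu2ε : ‖(u : ℂ × ℂ).2‖ ≤ ε := (norm_snd_le _).trans hu
  have hm := norm_mobius_lt ha hu1
  have hn1 := two_mul_min_le_kernelNumReal (α := α) (sq_nonneg ‖fAlpha α z‖)
    (norm_sq_le_one_of_lt ha)
  have hn2 := two_mul_min_le_kernelNumReal (α := α) (sq_nonneg ‖fAlpha α (fstPoint z u)‖)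
    (norm_sq_le_one_of_lt (norm_fAlpha_lt (fstPoint z u).2))
  rw [norm_inner_centerPoint_sq]
  have hδε : 1 - ε ≤ 1 - ‖(fstPoint z u : ℂ × ℂ).2‖ ^ 2 :=
    hdef.trans (defect_le_one_sub_fstPoint z u)
  have hx0 := sq_nonneg ‖(fstPoint z u : ℂ × ℂ).2‖
  -- The bound is relative to the Möbius density, which may be arbitrarily small: the overlap
  -- formula divides by that density, so an absolute bound would not be uniform in z.
  have hxD : ‖(fstPoint z u : ℂ × ℂ).2‖ ^ 2 ≤
      ε * (K * mobiusDensity (fAlpha α z) (u : ℂ × ℂ).1) := by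
    have h : ‖(fstPoint z u : ℂ × ℂ).2‖ ^ 2 = _ := norm_autoFst_snd_sq hα ha hu1
    rw [h]
    have h1 := fiberRatio_le hα ha hu1
    rw [← hKdef] at h1
    have h2 := (fiberRatio_pos hα ha hu1).le
    have h3 : ‖(u : ℂ × ℂ).2‖ ^ 2 ≤ ε := by nlinarith [norm_nonneg (u : ℂ × ℂ).2]
    gcongr
  have hAm : ‖fAlpha α (fstPoint z u)‖ ^ 2 = ‖mobius (fAlpha α z) (u : ℂ × ℂ).1‖ ^ 2 *
      (1 - ‖(fstPoint z u : ℂ × ℂ).2‖ ^ 2) ^ (-α) := by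
    have e1 : ((fstPoint z u : thullen α hα) : ℂ × ℂ).1 = mobius (fAlpha α z) (u : ℂ × ℂ).1 := rfl
    rw [norm_fAlpha hy2, e1, div_pow, ← Real.rpow_natCast ((1 - _) ^ (α / 2)),
      ← Real.rpow_mul hδ.le, Real.rpow_neg hδ.le, div_eq_mul_inv]
    congr 3
    push_cast
    ring
  have hpow := one_sub_rpow_neg_sub_one_le hα hx0 (by linarith)
  rw [← hLdef] at hpow
  have hpow1 : 1 ≤ (1 - ‖(fstPoint z u : ℂ × ℂ).2‖ ^ 2) ^ (-α) :=
    Real.one_le_rpow_of_pos_of_le_one_of_nonpos hδ (by linarith) (by linarith)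
  have hmob := one_sub_norm_mobius_sq ha hu1.le
  generalize (1 - ‖(fstPoint z u : ℂ × ℂ).2‖ ^ 2) ^ (-α) = t at hAm hpow hpow1
  have hm2 := norm_sq_le_one_of_lt hm
  have hAm' : ‖fAlpha α (fstPoint z u)‖ ^ 2 ≤ ‖mobius (fAlpha α z) (u : ℂ × ℂ).1‖ ^ 2 +
      L * ‖(fstPoint z u : ℂ × ℂ).2‖ ^ 2 := by rw [hAm]; nlinarith
  have hbr : 1 - C * ε ≤ (1 - ‖fAlpha α (fstPoint z u)‖ ^ 2) /
      mobiusDensity (fAlpha α z) (u : ℂ × ℂ).1 := by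
    rw [le_div_iff₀ hD]
    have h1 : ‖(u : ℂ × ℂ).1‖ ^ 2 ≤ ε := by nlinarith [norm_nonneg (u : ℂ × ℂ).1]
    have h2 : L * ‖(fstPoint z u : ℂ × ℂ).2‖ ^ 2 ≤
        L * (ε * (K * mobiusDensity (fAlpha α z) (u : ℂ × ℂ).1)) := by gcongr
    have h3 : mobiusDensity (fAlpha α z) (u : ℂ × ℂ).1 * ‖(u : ℂ × ℂ).1‖ ^ 2 ≤
        mobiusDensity (fAlpha α z) (u : ℂ × ℂ).1 * ε := by gcongr
    have h4 : (1 + L * K) * (ε * mobiusDensity (fAlpha α z) (u : ℂ × ℂ).1) ≤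
        C * (ε * mobiusDensity (fAlpha α z) (u : ℂ × ℂ).1) := by
      gcongr
      rw [hCdef]; nlinarith
    linarith
  have hsub := norm_mobius_sub_le ha hu1
  have hsub' : ‖mobius (fAlpha α z) (u : ℂ × ℂ).1 - fAlpha α z‖ ≤ 2 * ε := by linarith
  have hma : ‖mobius (fAlpha α z) (u : ℂ × ℂ).1‖ ^ 2 ≤ ‖fAlpha α z‖ ^ 2 + 4 * ε := by
    have := norm_sub_norm_le (mobius (fAlpha α z) (u : ℂ × ℂ).1) (fAlpha α z)
    have := sq_le_sq_add_of_sub_le (norm_nonneg _) hm.le (norm_nonneg _) ha.le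
      (by positivity) (this.trans hsub')
    linarith
  have hma' : ‖fAlpha α z‖ ^ 2 ≤ ‖mobius (fAlpha α z) (u : ℂ × ℂ).1‖ ^ 2 + 4 * ε := by
    have := norm_sub_norm_le (fAlpha α z) (mobius (fAlpha α z) (u : ℂ × ℂ).1)
    rw [norm_sub_rev] at this
    have := sq_le_sq_add_of_sub_le (norm_nonneg _) ha.le (norm_nonneg _) hm.le
      (by positivity) (this.trans hsub')
    linarith
  have hAa : |‖fAlpha α (fstPoint z u)‖ ^ 2 - ‖fAlpha α z‖ ^ 2| ≤ (4 + L) * ε := by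
    have h1 : L * ‖(fstPoint z u : ℂ × ℂ).2‖ ^ 2 ≤ L * ε := by
      gcongr; linarith
    have h2 : ‖mobius (fAlpha α z) (u : ℂ × ℂ).1‖ ^ 2 ≤ ‖fAlpha α (fstPoint z u)‖ ^ 2 := by
      rw [hAm]; exact le_mul_of_one_le_right (sq_nonneg _) hpow1
    have h3 := mul_pos hL hε
    rw [abs_le]
    constructor <;> linarith
  have hNa : 0 < kernelNumReal α (‖fAlpha α z‖ ^ 2) := by linarith
  have hβ' : |α - 1| ≤ β * kernelNumReal α (‖fAlpha α z‖ ^ 2) := by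
    rw [hβdef, div_mul_eq_mul_div, le_div_iff₀ (by positivity)]
    gcongr
  have hC2 : β * ((4 + L) * ε) ≤ C * ε := by
    rw [hCdef]; nlinarith
  have hNA : kernelNumReal α (‖fAlpha α (fstPoint z u)‖ ^ 2) ≤
      kernelNumReal α (‖fAlpha α z‖ ^ 2) * (1 + C * ε) := by
    have h1 : kernelNumReal α (‖fAlpha α (fstPoint z u)‖ ^ 2) -
        kernelNumReal α (‖fAlpha α z‖ ^ 2) =
        (α - 1) * (‖fAlpha α (fstPoint z u)‖ ^ 2 - ‖fAlpha α z‖ ^ 2) := by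
      rw [kernelNumReal, kernelNumReal]; ring
    have h2 := le_abs_self ((α - 1) * (‖fAlpha α (fstPoint z u)‖ ^ 2 - ‖fAlpha α z‖ ^ 2))
    rw [abs_mul] at h2
    have h3 : |α - 1| * |‖fAlpha α (fstPoint z u)‖ ^ 2 - ‖fAlpha α z‖ ^ 2| ≤
        (β * kernelNumReal α (‖fAlpha α z‖ ^ 2)) * ((4 + L) * ε) := by gcongr
    linarith [mul_le_mul_of_nonneg_right hC2 hNa.le]
  have hNum : kernelNumReal α (‖fAlpha α z‖ ^ 2) * (1 - C * ε) ≤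
      ‖kernelNum α (conj (fAlpha α z) * mobius (fAlpha α z) (u : ℂ × ℂ).1)‖ := by
    have h1 : kernelNum α (conj (fAlpha α z) * mobius (fAlpha α z) (u : ℂ × ℂ).1) =
        (kernelNumReal α (‖fAlpha α z‖ ^ 2) : ℂ) - ((α - 1 : ℝ) : ℂ) *
          (conj (fAlpha α z) * (fAlpha α z - mobius (fAlpha α z) (u : ℂ × ℂ).1)) := by
      rw [← kernelNum_ofReal, ← conj_mul_self_eq, kernelNum, kernelNum]
      push_cast
      ring
    have h2 := norm_sub_norm_le (kernelNumReal α (‖fAlpha α z‖ ^ 2) : ℂ) (((α - 1 : ℝ) : ℂ) *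
          (conj (fAlpha α z) * (fAlpha α z - mobius (fAlpha α z) (u : ℂ × ℂ).1)))
    rw [← h1, Complex.norm_real, Real.norm_of_nonneg hNa.le, norm_mul, norm_mul, Complex.norm_real,
      Real.norm_eq_abs, RCLike.norm_conj, norm_sub_rev] at h2
    have h3 : |α - 1| * (‖fAlpha α z‖ * ‖mobius (fAlpha α z) (u : ℂ × ℂ).1 - fAlpha α z‖) ≤
        (β * kernelNumReal α (‖fAlpha α z‖ ^ 2)) * (1 * (2 * ε)) := by gcongr
    have h4 : β * (2 * ε) ≤ C * ε := le_trans (by gcongr; linarith) hC2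
    linarith [mul_le_mul_of_nonneg_right h4 hNa.le]
  have hNA0 : 0 < kernelNumReal α (‖fAlpha α (fstPoint z u)‖ ^ 2) := by linarith
  have hnn : 0 ≤ 1 - C * ε := by linarith
  have h1C : 0 < 1 + C * ε := by linarith
  have hratio : (1 - C * ε) ^ 2 / (1 + C * ε) ≤
      ‖kernelNum α (conj (fAlpha α z) * mobius (fAlpha α z) (u : ℂ × ℂ).1)‖ ^ 2 /
        (kernelNumReal α (‖fAlpha α z‖ ^ 2) *
          kernelNumReal α (‖fAlpha α (fstPoint z u)‖ ^ 2)) := by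
    calc (1 - C * ε) ^ 2 / (1 + C * ε) = (kernelNumReal α (‖fAlpha α z‖ ^ 2) * (1 - C * ε)) ^ 2 /
          (kernelNumReal α (‖fAlpha α z‖ ^ 2) *
            (kernelNumReal α (‖fAlpha α z‖ ^ 2) * (1 + C * ε))) := by field_simp
      _ ≤ _ := by gcongr
  have hδC : 1 - C * ε ≤ 1 - ‖(fstPoint z u : ℂ × ℂ).2‖ ^ 2 := by linarith
  gcongr

/-- The quantitative bound tends to 1 as ε tends to 0. Since overlaps are at most 1, a lower bound
for the square is one for the overlap itself. -/
theorem exists_overlap_near_one (hα : 0 < α) {η : ℝ} (hη : 0 < η) : ∃ s : ℝ, 0 < s ∧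
    ∀ z u : thullen α hα, ‖(u : ℂ × ℂ)‖ ≤ s →
      1 - η ≤ ‖(inner ℂ (normalizedKernel _ z) (normalizedKernel _ (centerPoint z u)) : ℂ)‖ := by
  obtain ⟨C, hC1, hC⟩ := exists_overlap_bound hα
  have hcont : ContinuousAt (fun ε : ℝ => (1 - C * ε) ^ 2 / (1 + C * ε) *
      (1 - C * ε) ^ (2 + α) * (1 - C * ε) ^ 3) 0 := by
    refine ContinuousAt.mul (ContinuousAt.mul (ContinuousAt.div (by fun_prop) (by fun_prop)
      (by simp)) (ContinuousAt.rpow_const (by fun_prop) (Or.inl (by simp)))) (by fun_prop)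
  have hlim := hcont.eventually (lt_mem_nhds (a := 1 - η) (by simp [hη]))
  obtain ⟨ε₀, hε₀, hball⟩ := Metric.eventually_nhds_iff.1 hlim
  obtain ⟨ε, hε, hε1, hε2⟩ : ∃ ε : ℝ, 0 < ε ∧ C * ε ≤ 1 / 2 ∧ ε < ε₀ := by
    have hC0 : 0 < C := by linarith
    refine ⟨min (1 / (2 * C)) (ε₀ / 2), by positivity, ?_,
      (min_le_right _ _).trans_lt (by linarith)⟩
    calc C * min (1 / (2 * C)) (ε₀ / 2) ≤ C * (1 / (2 * C)) := by gcongr; exact min_le_left _ _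
      _ = 1 / 2 := by field_simp
  have hd0 : defect α (0 : ℂ × ℂ) = 1 := by
    have : 2 / α ≠ 0 := by positivity
    simp [defect, fiberSq, Real.zero_rpow this]
  have hd := (continuous_defect hα).continuousAt.eventually
    (lt_mem_nhds (a := 1 - ε) (b := defect α (0 : ℂ × ℂ)) (by rw [hd0]; linarith))
  obtain ⟨s₀, hs₀, hball'⟩ := Metric.eventually_nhds_iff.1 hd
  refine ⟨min ε (s₀ / 2), by positivity, fun z u hu => ?_⟩
  have h1 := hC ε hε hε1 z u (hu.trans (min_le_left _ _))
    (hball' (y := (u : ℂ × ℂ)) (by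
      rw [dist_zero_right]
      exact hu.trans_lt ((min_le_right _ _).trans_lt (by linarith)))).le
  have h2 := hball (y := ε) (by rw [dist_zero_right, Real.norm_of_nonneg hε.le]; exact hε2)
  have h3 := h2.le.trans h1
  have h4 := norm_inner_normalizedKernel_le_one z (centerPoint z u)
  nlinarith [norm_nonneg (inner ℂ (normalizedKernel _ z) (normalizedKernel _ (centerPoint z u)) : ℂ)]

end OverlapNearOne

/-! ## The Schur test -/

/-- Schur's test for nonnegative kernels. -/
theorem lintegral_sq_le_of_schur {X : Type*} [MeasurableSpace X] {μ : Measure X} [SFinite μ]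
    {N : X → X → ℝ≥0∞} (hN : Measurable (Function.uncurry N)) {h : X → ℝ≥0∞} (hh : Measurable h)
    (hpos : ∀ x, h x ≠ 0) (hfin : ∀ x, h x ≠ ∞) {C₁ C₂ : ℝ≥0∞}
    (h₁ : ∀ x, ∫⁻ y, N x y * h y ∂μ ≤ C₁ * h x) (h₂ : ∀ y, ∫⁻ x, N x y * h x ∂μ ≤ C₂ * h y)
    {g : X → ℝ≥0∞} (hg : Measurable g) :
    ∫⁻ x, (∫⁻ y, N x y * g y ∂μ) ^ 2 ∂μ ≤ C₁ * C₂ * ∫⁻ y, g y ^ 2 ∂μ := by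
  have hN1 : ∀ x, Measurable (N x) := fun x => hN.comp measurable_prodMk_left
  have hN2 : ∀ y, Measurable fun x => N x y := fun y => hN.comp measurable_prodMk_right
  -- Cauchy-Schwarz for N g = (N h)^{1/2} · (N h⁻¹ g²)^{1/2}.
  have key : ∀ x, (∫⁻ y, N x y * g y ∂μ) ^ 2 ≤ C₁ * (h x * ∫⁻ y, N x y * ((h y)⁻¹ * g y ^ 2) ∂μ) := by
    intro x
    have e : ∀ y, N x y * g y = ((fun y => (N x y * h y) ^ (1 / 2 : ℝ)) *
        (fun y => (N x y * ((h y)⁻¹ * g y ^ 2)) ^ (1 / 2 : ℝ))) y := fun y => by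
      simp only [Pi.mul_apply]
      rw [← ENNReal.mul_rpow_of_nonneg _ _ (by norm_num)]
      have : N x y * h y * (N x y * ((h y)⁻¹ * g y ^ 2)) = (N x y * g y) ^ (2 : ℝ) := by
        rw [ENNReal.rpow_two]
        calc _ = (h y * (h y)⁻¹) * (N x y * g y) ^ 2 := by ring
          _ = _ := by rw [ENNReal.mul_inv_cancel (hpos y) (hfin y), one_mul]
      rw [this, ← ENNReal.rpow_mul]
      norm_num
    have hw : Measurable fun y => N x y * ((h y)⁻¹ * g y ^ 2) :=
      (hN1 x).mul (hh.inv.mul (hg.pow_const 2))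
    have hHC : Real.HolderConjugate 2 2 := by
      rw [Real.holderConjugate_iff]; norm_num
    have hH := ENNReal.lintegral_mul_le_Lp_mul_Lq μ hHC
      (f := fun y => (N x y * h y) ^ (1 / 2 : ℝ))
      (g := fun y => (N x y * ((h y)⁻¹ * g y ^ 2)) ^ (1 / 2 : ℝ))
      (((hN1 x).mul hh).pow_const _).aemeasurable
      (hw.pow_const _).aemeasurable
    simp only [← e] at hH
    have e2 : ∀ a : ℝ≥0∞, (a ^ (1 / 2 : ℝ)) ^ (2 : ℝ) = a := fun a => by
      rw [← ENNReal.rpow_mul]; norm_num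
    simp only [e2] at hH
    have h3 := ENNReal.rpow_le_rpow (z := 2) hH (by norm_num)
    rw [ENNReal.mul_rpow_of_nonneg _ _ (by norm_num), e2, e2, ENNReal.rpow_two] at h3
    refine h3.trans ?_
    rw [← mul_assoc]
    gcongr
    exact h₁ x
  have hm2 : Measurable (Function.uncurry fun x y => h x * (N x y * ((h y)⁻¹ * g y ^ 2))) :=
    (hh.comp measurable_fst).mul (hN.mul ((hh.inv.mul (hg.pow_const _)).comp measurable_snd))
  calc ∫⁻ x, (∫⁻ y, N x y * g y ∂μ) ^ 2 ∂μ
      ≤ ∫⁻ x, C₁ * ∫⁻ y, h x * (N x y * ((h y)⁻¹ * g y ^ 2)) ∂μ ∂μ := by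
        refine lintegral_mono fun x => (key x).trans (le_of_eq ?_)
        rw [lintegral_const_mul]
        exact (hN1 x).mul (hh.inv.mul (hg.pow_const _))
    _ = C₁ * ∫⁻ y, ∫⁻ x, h x * (N x y * ((h y)⁻¹ * g y ^ 2)) ∂μ ∂μ := by
        have hm3 : Measurable fun x => ∫⁻ y, h x * (N x y * ((h y)⁻¹ * g y ^ 2)) ∂μ :=
          hm2.lintegral_prod_right'
        rw [lintegral_const_mul _ hm3,
          lintegral_lintegral_swap hm2.aemeasurable]
    _ ≤ C₁ * ∫⁻ y, C₂ * g y ^ 2 ∂μ := by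
        refine mul_le_mul_right (lintegral_mono fun y => ?_) _
        calc ∫⁻ x, h x * (N x y * ((h y)⁻¹ * g y ^ 2)) ∂μ
            = ∫⁻ x, N x y * h x * ((h y)⁻¹ * g y ^ 2) ∂μ := by
              refine lintegral_congr fun x => by ring
          _ = (∫⁻ x, N x y * h x ∂μ) * ((h y)⁻¹ * g y ^ 2) :=
              lintegral_mul_const _ ((hN2 y).mul hh)
          _ ≤ C₂ * h y * ((h y)⁻¹ * g y ^ 2) := by gcongr; exact h₂ y
          _ = (h y * (h y)⁻¹) * (C₂ * g y ^ 2) := by ring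
          _ = C₂ * g y ^ 2 := by rw [ENNReal.mul_inv_cancel (hpos y) (hfin y), one_mul]
    _ = C₁ * C₂ * ∫⁻ y, g y ^ 2 ∂μ := by
        rw [lintegral_const_mul _ (hg.pow_const _), mul_assoc]

/-! ## Integral bounds for the matrix coefficients -/

section RowBound

open bergmanSpace

variable {α : ℝ} {hα : 0 < α}

/-- Lebesgue measure on the points of a domain. -/
def domainMeasure (Ω : Opens (ℂ × ℂ)) : Measure Ω := volume.comap ((↑) : Ω → ℂ × ℂ)

theorem lintegral_domainMeasure {Ω : Opens (ℂ × ℂ)} (f : ℂ × ℂ → ℝ≥0∞) :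
    ∫⁻ x, f x ∂(domainMeasure Ω) = ∫⁻ w in Ω, f w :=
  lintegral_subtype_comap Ω.isOpen.measurableSet f

instance : IsFiniteMeasure (domainMeasure (thullen α hα)) := by
  refine ⟨?_⟩
  rw [← setLIntegral_one, Measure.restrict_univ,
    lintegral_domainMeasure (Ω := thullen α hα) (fun _ => 1), setLIntegral_one]
  exact volume_thullen_lt_top hα

theorem measurable_centerPoint (z : thullen α hα) : Measurable (centerPoint z) :=
  ((measurable_centerMap (α := α) (z : ℂ × ℂ)).comp measurable_subtype_coe).subtype_mk

theorem lintegral_centerPoint (z : thullen α hα) {G : thullen α hα → ℝ≥0∞} (hG : Measurable G) :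
    ∫⁻ u, ENNReal.ofReal (centerDensity α z u) * G (centerPoint z u)
      ∂(domainMeasure (thullen α hα)) = ∫⁻ w, G w ∂(domainMeasure (thullen α hα)) := by
  have hme : MeasurableEmbedding ((↑) : thullen α hα → ℂ × ℂ) :=
    MeasurableEmbedding.subtype_coe (thullen α hα).isOpen.measurableSet
  have hG' : Measurable (Function.extend ((↑) : thullen α hα → ℂ × ℂ) G 0) :=
    hme.measurable_extend hG measurable_zero
  have hx : ∀ x : thullen α hα, Function.extend ((↑) : thullen α hα → ℂ × ℂ) G 0 x = G x :=
    fun x => hme.injective.extend_apply _ _ _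
  have h := lintegral_centerMap z.2 (hG'.indicator (thullen α hα).isOpen.measurableSet)
  rw [← lintegral_domainMeasure, ← lintegral_domainMeasure (fun w => _)] at h
  simp only [hx] at h
  rw [← h]
  refine lintegral_congr fun u => ?_
  congr 1
  exact (hx (centerPoint z u)).symm

/-- The kernel function `K_z`, as an element of the span of the normalized ones. -/
def spanBergman (Ω : Opens (ℂ × ℂ)) (z : Ω) : kernelSpan Ω :=
  (‖bergmanKernel Ω z‖ : ℂ) • spanKernel Ω z

theorem coe_spanBergman (z : thullen α hα) :
    (spanBergman (thullen α hα) z : bergmanSpace (thullen α hα)) = bergmanKernel _ z := by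
  have h : (‖bergmanKernel _ z‖ : ℂ) ≠ 0 := by exact_mod_cast (norm_bergmanKernel_pos z).ne'
  change (‖bergmanKernel _ z‖ : ℂ) • normalizedKernel _ z = _
  rw [normalizedKernel, smul_smul, Complex.ofReal_inv, mul_inv_cancel₀ h, one_smul]

variable (A : kernelSpan (thullen α hα) →ₗ[ℂ] bergmanSpace (thullen α hα))

/-- The modulus of the matrix coefficient `⟨A K_z, K_w⟩`. -/
def coeffNorm (z w : thullen α hα) : ℝ≥0∞ := ‖rep (A (spanBergman _ z)) w‖ₑ

theorem coeffNorm_eq (z w : thullen α hα) :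
    coeffNorm A z w = ‖bergmanKernel _ z‖ₑ * ‖rep (A (spanKernel _ z)) w‖ₑ := by
  have h := rep_smul (‖bergmanKernel _ z‖ : ℂ) (A (spanKernel _ z)) w.2
  rw [coeffNorm, spanBergman, map_smul, h, Pi.smul_apply, enorm_smul, ← ofReal_norm, Complex.norm_real, norm_norm,
    ofReal_norm]

theorem continuous_rep_coe {Ω : Opens (ℂ × ℂ)} (f : bergmanSpace Ω) :
    Continuous fun w : Ω => rep f w :=
  continuousOn_iff_continuous_domRestrict.1 (differentiableOn_rep f).continuousOn

theorem measurable_coeffNorm (z : thullen α hα) : Measurable (coeffNorm A z) :=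
  (continuous_rep_coe _).enorm.measurable

theorem measurable_schurPow (hα : 0 < α) (κ : ℝ) : Measurable (schurPow α κ) := by
  have := (continuous_defect hα).measurable
  unfold schurPow
  fun_prop

/-- Recentring at z and Hölder with three factors: the indicator of E', the recentred image of k_z,
bounded in L^p by hypothesis, and the recentred test function, bounded in L^q by the Forelli-Rudin
estimates. The leftover exponent s yields the gain in the measure of E'. The pair h, s does not
depend on A, so the same test function serves rows and columns. -/
theorem exists_row_bound (hα : 0 < α) {p : ℝ} (hp : 4 < p) :
    ∃ (h : thullen α hα → ℝ≥0∞) (s : ℝ), Measurable h ∧ (∀ z, h z ≠ 0) ∧ (∀ z, h z ≠ ∞) ∧ 0 < s ∧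
      ∀ A : kernelSpan (thullen α hα) →ₗ[ℂ] bergmanSpace (thullen α hα),
        translSup α hα p A < ∞ → ∃ C : ℝ≥0∞, C < ∞ ∧ ∀ (z : thullen α hα)
          (E E' : Set (thullen α hα)), MeasurableSet E → MeasurableSet E' →
          (∀ u, centerPoint z u ∈ E → u ∈ E') →
          ∫⁻ w in E, coeffNorm A z w * h w ∂(domainMeasure _) ≤
            C * (domainMeasure _ E') ^ s * h z := by
  have hp0 : 0 < p := by linarith
  -- This makes q = 4/3 - 2κ the midpoint of the conjugate exponent p/(p-1) and 4/3; p > 4 says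
  -- exactly that the former is the smaller. Exceeding p/(p-1) leaves s > 0.
  obtain ⟨κ, hκdef⟩ : ∃ κ, κ = (4 / 3 - p / (p - 1)) / 4 := ⟨_, rfl⟩
  have hp1 : p / (p - 1) < 4 / 3 := by rw [div_lt_iff₀ (by linarith)]; linarith
  have hp2 : 1 < p / (p - 1) := by rw [lt_div_iff₀ (by linarith)]; linarith
  have hκ : 0 < κ := by rw [hκdef]; linarith
  have hκ1 : κ < 1 / 6 := by rw [hκdef]; linarith
  obtain ⟨q, hqdef⟩ : ∃ q, q = 4 / 3 - 2 * κ := ⟨_, rfl⟩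
  have hpq : p / (p - 1) < q := by rw [hqdef, hκdef]; linarith
  have hq0 : 0 < q := by linarith
  have hs : 0 < 1 - 1 / p - 1 / q := by
    have h1 : 1 / q < 1 / (p / (p - 1)) := one_div_lt_one_div_of_lt (by linarith) hpq
    have h2 : 1 / (p / (p - 1)) = 1 - 1 / p := by field_simp
    linarith
  obtain ⟨C₁, hC₁, hb₁⟩ := exists_schurWeight_bound hα hκ hκ1
  obtain ⟨C₂, hC₂, hb₂⟩ := exists_schur_pointwise_bound hα hκ hκ1
  rw [← hqdef] at hb₂
  obtain ⟨c, hc, hbc⟩ : ∃ c : ℝ, 0 < c ∧ ∀ z : thullen α hα,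
      ‖bergmanKernel _ z‖ ^ 2 ≤ c * kernelSize α z := by
    have : 0 < max 1 α := by positivity
    exact ⟨2 * max 1 α / Real.pi ^ 2, by have := Real.pi_pos; positivity, norm_bergmanKernel_sq_le⟩
  have hsm := measurable_schurPow hα κ
  refine ⟨fun z => ENNReal.ofReal (schurPow α κ z) ^ (1 / q), 1 - 1 / p - 1 / q,
    ((hsm.comp measurable_subtype_coe).ennreal_ofReal).pow_const _, fun z => ?_, fun z => ?_, hs,
    fun A hA => ⟨translSup α hα p A * (ENNReal.ofReal (c ^ (q / 2) * C₂) * C₁) ^ (1 / q),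
      ENNReal.mul_lt_top hA (ENNReal.rpow_lt_top_of_nonneg (by positivity) (by finiteness)),
      fun z E E' hE hE' hEE => ?_⟩⟩
  · have := schurPow_pos (κ := κ) z.2
    simp [this, ENNReal.rpow_eq_zero_iff]
  · have := ENNReal.rpow_lt_top_of_nonneg (x := ENNReal.ofReal (schurPow α κ z)) (y := 1 / q)
      (by positivity) ENNReal.ofReal_ne_top
    exact this.ne
  obtain ⟨h, hhdef⟩ : ∃ h : thullen α hα → ℝ≥0∞,
    h = fun z : thullen α hα => ENNReal.ofReal (schurPow α κ z) ^ (1 / q) := ⟨_, rfl⟩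
  have hhm : Measurable h := by
    rw [hhdef]
    exact ((hsm.comp measurable_subtype_coe).ennreal_ofReal).pow_const _
  rw [← hhdef]
  have hhz : h z = ENNReal.ofReal (schurPow α κ z) ^ (1 / q) := by rw [hhdef]
  obtain ⟨J, hJdef⟩ : ∃ J : thullen α hα → ℝ≥0∞,
    J = fun u : thullen α hα => ENNReal.ofReal √(centerDensity α z u) := ⟨_, rfl⟩
  have hJm : Measurable J := by
    rw [hJdef]
    exact (((measurable_centerDensity hα z).comp measurable_subtype_coe).sqrt).ennreal_ofReal
  have hJsq : ∀ u : thullen α hα, ENNReal.ofReal (centerDensity α z u) = J u * J u := fun u => by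
    rw [hJdef]
    simp only
    rw [← ENNReal.ofReal_mul (Real.sqrt_nonneg _),
      Real.mul_self_sqrt (centerDensity_pos z.2 u.2).le]
  have hΦ := measurable_centerPoint z
  have hAm : Measurable fun w : thullen α hα => ‖rep (A (spanKernel _ z)) w‖ₑ :=
    (continuous_rep_coe _).enorm.measurable
  -- The Jacobian is split evenly between the two factors, and ‖K_z‖ is moved to the test function,
  -- leaving the normalized kernel in the first. The powers and their inverses prepare Hölder's
  -- inequality.
  have step1 : ∫⁻ w in E, coeffNorm A z w * h w ∂(domainMeasure _) ≤
      ∫⁻ u, (E'.indicator 1 u) ^ (1 - 1 / p - 1 / q) *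
        (((‖rep (A (spanKernel _ z)) (centerPoint z u)‖ₑ * J u) ^ p) ^ (1 / p) *
        ((‖bergmanKernel _ z‖ₑ * J u * h (centerPoint z u)) ^ q) ^ (1 / q))
        ∂(domainMeasure _) := by
    have hNh : Measurable fun w => coeffNorm A z w * h w := (measurable_coeffNorm A z).mul hhm
    rw [← lintegral_indicator hE, ← lintegral_centerPoint z (hNh.indicator hE)]
    refine lintegral_mono fun u => ?_
    simp only
    by_cases hu : centerPoint z u ∈ E
    · rw [indicator_of_mem hu, indicator_of_mem (hEE u hu), Pi.one_apply, ENNReal.one_rpow, one_mul,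
        ← ENNReal.rpow_mul, ← ENNReal.rpow_mul, mul_one_div_cancel hp0.ne',
        mul_one_div_cancel hq0.ne', ENNReal.rpow_one, ENNReal.rpow_one, hJsq, coeffNorm_eq]
      exact le_of_eq (by ring)
    · rw [indicator_of_notMem hu, mul_zero]
      exact zero_le
  -- By `norm_translV_translU` this is the L^p norm in the hypothesis at the point z.
  have hf1 : (∫⁻ u, (‖rep (A (spanKernel _ z)) (centerPoint z u)‖ₑ * J u) ^ p
      ∂(domainMeasure _)) ^ (1 / p) ≤ translSup α hα p A := by
    refine le_trans (le_of_eq ?_) (le_iSup _ z)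
    rw [eLpNorm_eq_lintegral_rpow_enorm_toReal (by simpa using hp0) ENNReal.ofReal_ne_top,
      ENNReal.toReal_ofReal hp0.le, ← lintegral_domainMeasure]
    congr 1
    refine lintegral_congr fun u => ?_
    congr 1
    rw [← ofReal_norm (translV _ _ _ _), norm_translV_translU z.2 u.2,
      ENNReal.ofReal_mul (norm_nonneg _), ofReal_norm, hJdef]
    rfl
  have hf2 : (∫⁻ u, (‖bergmanKernel _ z‖ₑ * J u * h (centerPoint z u)) ^ q
      ∂(domainMeasure _)) ^ (1 / q) ≤
      (ENNReal.ofReal (c ^ (q / 2) * C₂) * C₁) ^ (1 / q) * h z := by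
    rw [hhz, ← ENNReal.mul_rpow_of_nonneg _ _ (by positivity)]
    refine ENNReal.rpow_le_rpow ?_ (by positivity)
    have hpt : ∀ u : thullen α hα, (‖bergmanKernel _ z‖ₑ * J u * h (centerPoint z u)) ^ q ≤
        ENNReal.ofReal (c ^ (q / 2) * C₂ * schurPow α κ z) *
          ENNReal.ofReal (schurWeight α κ (fAlpha α z) (z : ℂ × ℂ).2 u) := by
      intro u
      have hJ0 := (centerDensity_pos z.2 u.2).le
      have hsz := (schurPow_pos (κ := κ) z.2).le
      have hks := (kernelSize_pos z.2).le
      have hh1 : h (centerPoint z u) ^ q = ENNReal.ofReal (schurPow α κ (centerMap α z u)) := by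
        rw [hhdef]
        simp only
        rw [← ENNReal.rpow_mul, one_div_mul_cancel hq0.ne', ENNReal.rpow_one]
        rfl
      rw [ENNReal.mul_rpow_of_nonneg _ _ hq0.le, hh1, hJdef, ← ofReal_norm,
        ← ENNReal.ofReal_mul (norm_nonneg _), ENNReal.ofReal_rpow_of_nonneg (by positivity) hq0.le,
        ← ENNReal.ofReal_mul (by positivity), ← ENNReal.ofReal_mul (by positivity)]
      refine ENNReal.ofReal_le_ofReal ?_
      have e1 : (‖bergmanKernel _ z‖ * √(centerDensity α z u)) ^ q =
          (‖bergmanKernel _ z‖ ^ 2 * centerDensity α z u) ^ (q / 2) := by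
        nth_rw 2 [← Real.sq_sqrt hJ0]
        rw [← mul_pow, ← Real.rpow_natCast, ← Real.rpow_mul (by positivity)]
        congr 1
        push_cast
        ring
      have h3 : (‖bergmanKernel _ z‖ ^ 2 * centerDensity α z u) ^ (q / 2) ≤
          c ^ (q / 2) * (kernelSize α z * centerDensity α z u) ^ (q / 2) := by
        rw [← Real.mul_rpow hc.le (by positivity), ← mul_assoc]
        gcongr
        exact hbc z
      rw [e1]
      have h4 := (schurPow_pos (κ := κ) (centerMap_mem z.2 u.2)).le
      calc _ ≤ c ^ (q / 2) * (kernelSize α z * centerDensity α z u) ^ (q / 2) *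
            schurPow α κ (centerMap α z u) := by gcongr
        _ ≤ c ^ (q / 2) * (schurPow α κ z * (C₂ * schurWeight α κ (fAlpha α z) (z : ℂ × ℂ).2 u)) := by
            rw [mul_assoc]; exact mul_le_mul_of_nonneg_left (hb₂ z z.2 u u.2) (by positivity)
        _ = _ := by ring
    refine (lintegral_mono hpt).trans ?_
    rw [lintegral_const_mul' _ _ ENNReal.ofReal_ne_top, lintegral_domainMeasure
      (fun u => ENNReal.ofReal (schurWeight α κ (fAlpha α z) (z : ℂ × ℂ).2 u)),
      ENNReal.ofReal_mul (by positivity), mul_right_comm]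
    gcongr
    exact hb₁ _ _ (norm_fAlpha_lt z.2) (norm_snd_lt_of_mem z.2)
  have hH := ENNReal.lintegral_prod_norm_pow_le (μ := domainMeasure (thullen α hα)) Finset.univ
    (f := ![E'.indicator 1,
      fun u => (‖rep (A (spanKernel _ z)) (centerPoint z u)‖ₑ * J u) ^ p,
      fun u => (‖bergmanKernel _ z‖ₑ * J u * h (centerPoint z u)) ^ q])
    (p := ![1 - 1 / p - 1 / q, 1 / p, 1 / q]) (fun i _ => by
      fin_cases i
      · exact (measurable_one.indicator hE').aemeasurable
      · exact (((hAm.comp hΦ).mul hJm).pow_const _).aemeasurable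
      · exact (((hJm.const_mul _).mul (hhm.comp hΦ)).pow_const _).aemeasurable)
    (by simp [Fin.sum_univ_three]; ring) (fun i _ => by
      fin_cases i
      · exact hs.le
      · exact (by positivity : 0 ≤ 1 / p)
      · exact (by positivity : 0 ≤ 1 / q))
  simp only [Fin.prod_univ_three, Matrix.cons_val_zero, Matrix.cons_val_one, Matrix.cons_val_two,
    Matrix.tail_cons, Matrix.head_cons, mul_assoc] at hH
  simp only [mul_assoc] at step1 hf1 hf2
  refine (step1.trans hH).trans ?_
  rw [lintegral_indicator_one hE']
  calc _ ≤ (domainMeasure (thullen α hα)) E' ^ (1 - 1 / p - 1 / q) * (translSup α hα p A *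
        ((ENNReal.ofReal (c ^ (q / 2) * C₂) * C₁) ^ (1 / q) * h z)) := by gcongr
    _ = _ := by ring

end RowBound

/-! ## Extension to a bounded operator -/

section Extension

open bergmanSpace

variable {α : ℝ} {hα : 0 < α}

/-- `T` and `Tstar` are adjoint to each other on kernel functions. -/
def AreAdjoint (T Tstar : kernelSpan (thullen α hα) →ₗ[ℂ] bergmanSpace (thullen α hα)) : Prop :=
  ∀ z w : thullen α hα,
    (inner ℂ (normalizedKernel (thullen α hα) w) (T (spanKernel (thullen α hα) z)) : ℂ) =
      inner ℂ (Tstar (spanKernel (thullen α hα) w)) (normalizedKernel (thullen α hα) z)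

variable {T Tstar : kernelSpan (thullen α hα) →ₗ[ℂ] bergmanSpace (thullen α hα)}

theorem bergmanKernel_eq_smul (z : thullen α hα) :
    bergmanKernel _ z = (‖bergmanKernel _ z‖ : ℂ) • normalizedKernel _ z := by
  have h : (‖bergmanKernel _ z‖ : ℂ) ≠ 0 := by exact_mod_cast (norm_bergmanKernel_pos z).ne'
  rw [normalizedKernel, smul_smul, Complex.ofReal_inv, mul_inv_cancel₀ h, one_smul]

/-- The adjoint relation extends from single kernels to their span by linearity in f; this gives the
pointwise formula for T f. -/
theorem AreAdjoint.inner_spanBergman (hadj : AreAdjoint T Tstar) (z : thullen α hα)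
    (f : kernelSpan (thullen α hα)) :
    (inner ℂ (bergmanKernel _ z) (T f) : ℂ) =
      inner ℂ (Tstar (spanBergman _ z)) (f : bergmanSpace (thullen α hα)) := by
  obtain ⟨f, hf⟩ := f
  induction hf using Submodule.span_induction with
  | mem x hx =>
    obtain ⟨w, rfl⟩ := hx
    rw [bergmanKernel_eq_smul, spanBergman, map_smul,
      inner_smul_left (𝕜 := ℂ) (E := bergmanSpace _),
      inner_smul_left (𝕜 := ℂ) (E := bergmanSpace _)]
    congr 1
    exact hadj w z
  | zero =>
    have h0 : (⟨0, Submodule.zero_mem _⟩ : kernelSpan (thullen α hα)) = 0 := rfl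
    rw [h0, map_zero, inner_zero_right (𝕜 := ℂ) (E := bergmanSpace _)]
    exact (inner_zero_right (𝕜 := ℂ) (E := bergmanSpace _) _).symm
  | add x y hx hy h1 h2 =>
    have h0 : (⟨x + y, Submodule.add_mem _ hx hy⟩ : kernelSpan (thullen α hα)) =
      ⟨x, hx⟩ + ⟨y, hy⟩ := rfl
    rw [h0, map_add, inner_add_right (𝕜 := ℂ) (E := bergmanSpace _), h1, h2]
    exact (inner_add_right (𝕜 := ℂ) (E := bergmanSpace _) _ _ _).symm
  | smul c x hx h1 =>
    have h0 : (⟨c • x, Submodule.smul_mem _ c hx⟩ : kernelSpan (thullen α hα)) =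
      c • ⟨x, hx⟩ := rfl
    rw [h0, map_smul, inner_smul_right (𝕜 := ℂ) (E := bergmanSpace _), h1]
    exact (inner_smul_right (𝕜 := ℂ) (E := bergmanSpace _) _ _ _).symm

/-- Columns of one matrix are rows of the other, so the row bound applied to T controls the second
Schur condition for T*. -/
theorem AreAdjoint.coeffNorm_swap (hadj : AreAdjoint T Tstar) (z w : thullen α hα) :
    coeffNorm Tstar z w = coeffNorm T w z := by
  have h := hadj.inner_spanBergman z (spanBergman _ w)
  rw [inner_bergmanKernel, coe_spanBergman] at h
  rw [coeffNorm, coeffNorm, h, ← inner_bergmanKernel, ← ofReal_norm, ← ofReal_norm]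
  congr 1
  exact norm_inner_symm (𝕜 := ℂ) (E := bergmanSpace _) _ _

/-- A Carathéodory function: continuous in w by holomorphy, and measurable in z because the swapped
coefficient is. -/
theorem AreAdjoint.measurable_coeffNorm (hadj : AreAdjoint T Tstar) :
    Measurable (Function.uncurry (coeffNorm Tstar)) := by
  have h1 : ∀ z, Continuous fun w => coeffNorm Tstar z w := fun z => (continuous_rep_coe _).enorm
  have h2 : ∀ w, Measurable fun z => coeffNorm Tstar z w := fun w => by
    simp only [hadj.coeffNorm_swap]
    exact _root_.measurable_coeffNorm T w
  have h3 : Measurable (Function.uncurry fun w z => coeffNorm Tstar z w) :=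
    measurable_uncurry_of_continuous_of_measurable h1 h2
  have e : Function.uncurry (coeffNorm Tstar) =
      (Function.uncurry fun w z => coeffNorm Tstar z w) ∘ Prod.swap := by
    funext x
    rfl
  rw [e]
  exact h3.comp measurable_swap

/-- The truncations of the matrix of `T` to a set of pairs of points have small norm, if the
recentred slices of that set have small measure. -/
theorem exists_truncated_bound {p : ℝ} (hp : 4 < p) (hadj : AreAdjoint T Tstar)
    (hT : translSup α hα p T < ∞) (hTstar : translSup α hα p Tstar < ∞) :
    ∃ (C : ℝ≥0∞) (s : ℝ), C < ∞ ∧ 0 < s ∧ ∀ (D : Set (thullen α hα × thullen α hα))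
      (V : Set (thullen α hα)), MeasurableSet D → MeasurableSet V →
      (∀ z u, (z, centerPoint z u) ∈ D → u ∈ V) → (∀ z u, (centerPoint z u, z) ∈ D → u ∈ V) →
      ∀ g : thullen α hα → ℝ≥0∞, Measurable g →
        ∫⁻ z, (∫⁻ w, D.indicator (Function.uncurry (coeffNorm Tstar)) (z, w) * g w
          ∂(domainMeasure _)) ^ 2 ∂(domainMeasure _) ≤
          C * ((domainMeasure _ V) ^ s) ^ 2 * ∫⁻ w, g w ^ 2 ∂(domainMeasure _) := by
  obtain ⟨h, s, hh, hpos, hfin, hs, hb⟩ := exists_row_bound hα hp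
  obtain ⟨C₁, hC₁, hb₁⟩ := hb Tstar hTstar
  obtain ⟨C₂, hC₂, hb₂⟩ := hb T hT
  refine ⟨C₁ * C₂, s, ENNReal.mul_lt_top hC₁ hC₂, hs, fun D V hD hV h₁ h₂ g hg => ?_⟩
  have hN := hadj.measurable_coeffNorm
  have := lintegral_sq_le_of_schur (μ := domainMeasure (thullen α hα))
    (N := fun z w => D.indicator (Function.uncurry (coeffNorm Tstar)) (z, w))
    (hN.indicator hD) hh hpos hfin (C₁ := C₁ * (domainMeasure _ V) ^ s)
    (C₂ := C₂ * (domainMeasure _ V) ^ s) (fun z => ?_) (fun w => ?_) hg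
  · refine this.trans (le_of_eq ?_)
    ring
  · have hE : MeasurableSet (Prod.mk z ⁻¹' D) := measurable_prodMk_left hD
    refine le_trans (le_of_eq ?_) (hb₁ z _ V hE hV (h₁ z))
    rw [← lintegral_indicator hE]
    refine lintegral_congr fun w => ?_
    by_cases hw : (z, w) ∈ D
    · rw [indicator_of_mem hw, indicator_of_mem (s := Prod.mk z ⁻¹' D) hw]; rfl
    · rw [indicator_of_notMem hw, indicator_of_notMem (s := Prod.mk z ⁻¹' D) hw, zero_mul]
  · have hE : MeasurableSet ((fun z => (z, w)) ⁻¹' D) := measurable_prodMk_right hD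
    refine le_trans (le_of_eq ?_) (hb₂ w _ V hE hV (h₂ w))
    rw [← lintegral_indicator hE]
    refine lintegral_congr fun z => ?_
    by_cases hz : (z, w) ∈ D
    · rw [indicator_of_mem hz, indicator_of_mem (s := (fun z => (z, w)) ⁻¹' D) hz,
        ← hadj.coeffNorm_swap]
      rfl
    · rw [indicator_of_notMem hz, indicator_of_notMem (s := (fun z => (z, w)) ⁻¹' D) hz, zero_mul]

theorem enorm_inner_le_lintegral {Ω : Opens (ℂ × ℂ)} (a : bergmanSpace Ω) (f : L2 Ω)
    {φ : ℂ × ℂ → ℂ} (hf : f =ᵐ[volume.restrict Ω] φ) :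
    ‖(inner ℂ (a : L2 Ω) f : ℂ)‖ₑ ≤ ∫⁻ w, ‖rep a w‖ₑ * ‖φ w‖ₑ ∂(domainMeasure Ω) := by
  rw [lintegral_domainMeasure (fun w => ‖rep a w‖ₑ * ‖φ w‖ₑ), L2.inner_def]
  refine (enorm_integral_le_lintegral_enorm _).trans (lintegral_mono_ae ?_)
  filter_upwards [hf, ae_eq_rep a] with w h1 h2
  rw [h1, h2, ← ofReal_norm, ← ofReal_norm, ← ofReal_norm, ← ENNReal.ofReal_mul (norm_nonneg _)]
  exact ENNReal.ofReal_le_ofReal (norm_inner_le_norm _ _)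

/-- A function orthogonal to every K_z vanishes at every point. -/
theorem dense_kernelSpan :
    Dense (kernelSpan (thullen α hα) : Set (bergmanSpace (thullen α hα))) := by
  rw [Submodule.dense_iff_topologicalClosure_eq_top,
    Submodule.topologicalClosure_eq_top_iff, Submodule.eq_bot_iff]
  intro f hf
  refine bergmanSpace.ext_rep fun z hz => ?_
  have h1 := (Submodule.mem_orthogonal _ _).1 hf _ (spanBergman _ ⟨z, hz⟩).2
  rw [coe_spanBergman, inner_bergmanKernel] at h1
  -- The representative of 0 is a chosen function; its vanishing at z is read off from the
  -- reproducing property.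
  have h2 := inner_bergmanKernel (thullen α hα) ⟨z, hz⟩ 0
  rw [inner_zero_right (𝕜 := ℂ) (E := bergmanSpace _)] at h2
  rw [h1, ← h2]

/-- Boundedness on the span is the truncated bound with no truncation. The pointwise formula holds
on the span by adjointness and passes to the closure, both sides being continuous in f. -/
theorem exists_extension {p : ℝ} (hp : 4 < p) (hadj : AreAdjoint T Tstar)
    (hT : translSup α hα p T < ∞) (hTstar : translSup α hα p Tstar < ∞) :
    ∃ Tb : bergmanSpace (thullen α hα) →L[ℂ] bergmanSpace (thullen α hα),
      (∀ f : kernelSpan (thullen α hα), Tb (f : bergmanSpace (thullen α hα)) = T f) ∧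
      ∀ (z : thullen α hα) (f : bergmanSpace (thullen α hα)),
        rep (Tb f) z = inner ℂ (Tstar (spanBergman _ z)) f := by
  obtain ⟨C, s, hC, hs, hb⟩ := exists_truncated_bound hp hadj hT hTstar
  obtain ⟨B, hBdef⟩ : ∃ B : ℝ≥0∞, B = C * ((domainMeasure (thullen α hα) univ) ^ s) ^ 2 := ⟨_, rfl⟩
  have hB : B < ∞ := by
    rw [hBdef]
    have := ENNReal.rpow_lt_top_of_nonneg hs.le (measure_ne_top (domainMeasure (thullen α hα)) univ)
    finiteness
  have hbd : ∀ f : kernelSpan (thullen α hα), ‖T f‖ₑ ^ 2 ≤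
      B * ‖(f : bergmanSpace (thullen α hα))‖ₑ ^ 2 := by
    intro f
    rw [enorm_sq_eq_lintegral, enorm_sq_eq_lintegral,
      ← lintegral_domainMeasure (fun w => ‖rep (T f) w‖ₑ ^ 2),
      ← lintegral_domainMeasure (fun w => ‖rep (f : bergmanSpace (thullen α hα)) w‖ₑ ^ 2), hBdef]
    refine le_trans (lintegral_mono fun z => ?_) (hb univ univ MeasurableSet.univ MeasurableSet.univ
      (by simp) (by simp) (fun w => ‖rep (f : bergmanSpace (thullen α hα)) w‖ₑ)
      (continuous_rep_coe _).enorm.measurable)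
    simp only [indicator_univ, Function.uncurry_apply_pair]
    gcongr
    rw [← inner_bergmanKernel, hadj.inner_spanBergman]
    exact enorm_inner_le_lintegral (Tstar (spanBergman _ z)) _ (ae_eq_rep _)
  have hbd' : ∀ f : kernelSpan (thullen α hα), ‖T f‖ ≤
      √B.toReal * ‖(kernelSpan (thullen α hα)).subtype f‖ := by
    intro f
    have h1 := ENNReal.toReal_mono (by finiteness) (hbd f)
    rw [ENNReal.toReal_mul, ENNReal.toReal_pow, ENNReal.toReal_pow, toReal_enorm, toReal_enorm] at h1
    refine abs_le_of_sq_le_sq' ?_ (by positivity) |>.2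
    rw [mul_pow, Real.sq_sqrt ENNReal.toReal_nonneg]
    exact h1
  have hdense : DenseRange (kernelSpan (thullen α hα)).subtype := by
    have := dense_kernelSpan (hα := hα)
    rwa [DenseRange, Submodule.coe_subtype, Subtype.range_coe]
  refine ⟨T.extendOfNorm (kernelSpan (thullen α hα)).subtype, fun f =>
    LinearMap.extendOfNorm_eq hdense ⟨_, hbd'⟩ f, fun z f => ?_⟩
  rw [← inner_bergmanKernel]
  refine hdense.induction_on (p := fun f => (inner ℂ (bergmanKernel _ z)
    (T.extendOfNorm (kernelSpan (thullen α hα)).subtype f) : ℂ) =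
      inner ℂ (Tstar (spanBergman _ z)) f) f ?_ fun g => ?_
  · have c1 : Continuous fun f => (innerSL ℂ (bergmanKernel (thullen α hα) z))
      (T.extendOfNorm (kernelSpan (thullen α hα)).subtype f) := by fun_prop
    have c2 : Continuous fun f => (innerSL ℂ (Tstar (spanBergman _ z))) f := by fun_prop
    exact isClosed_eq c1 c2
  · rw [LinearMap.extendOfNorm_eq hdense ⟨_, hbd'⟩ g]
    exact hadj.inner_spanBergman z g

end Extension

/-! ## Regularity of the Skwarczyński distance -/

section Distance

open bergmanSpace

variable {α : ℝ} {hα : 0 < α}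

theorem continuous_fAlpha : Continuous fun z : thullen α hα => fAlpha α z := by
  unfold fAlpha
  refine Continuous.div (by fun_prop) (Complex.continuous_ofReal.comp
    (Continuous.rpow_const (by fun_prop) fun z => Or.inl ?_)) fun z => ?_
  · exact (one_sub_norm_sq_pos (norm_snd_lt_of_mem z.2)).ne'
  · exact_mod_cast (Real.rpow_pos_of_pos (one_sub_norm_sq_pos (norm_snd_lt_of_mem z.2)) _).ne'

theorem continuous_norm_bergmanKernel :
    Continuous fun z : thullen α hα => ‖bergmanKernel _ z‖ := by
  have h : Continuous fun z : thullen α hα => ‖bergmanKernel _ z‖ ^ 2 := by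
    simp only [norm_bergmanKernel_sq]
    have hf := continuous_fAlpha (hα := hα)
    unfold kernelNumReal kernelSize
    refine Continuous.mul (by fun_prop) (Continuous.mul
      (Continuous.rpow_const (by fun_prop) fun z => Or.inl ?_)
      (Continuous.rpow_const (by fun_prop) fun z => Or.inl ?_))
    · exact (one_sub_norm_sq_pos (norm_snd_lt_of_mem z.2)).ne'
    · exact (one_sub_norm_sq_pos (norm_fAlpha_lt z.2)).ne'
  have e : (fun z : thullen α hα => ‖bergmanKernel _ z‖) = fun z => √(‖bergmanKernel _ z‖ ^ 2) := by
    funext z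
    exact (Real.sqrt_sq (norm_nonneg _)).symm
  rw [e]
  exact h.sqrt

/-- The modulus of the inner product of two normalized kernel functions. -/
def overlap (z w : thullen α hα) : ℝ :=
  ‖(inner ℂ (normalizedKernel _ z) (normalizedKernel _ w) : ℂ)‖

theorem overlap_comm (z w : thullen α hα) : overlap z w = overlap w z :=
  norm_inner_symm (𝕜 := ℂ) (E := bergmanSpace _) _ _

theorem overlap_nonneg (z w : thullen α hα) : 0 ≤ overlap z w := norm_nonneg _

theorem overlap_le_one (z w : thullen α hα) : overlap z w ≤ 1 :=
  norm_inner_normalizedKernel_le_one z w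

theorem overlap_eq (z w : thullen α hα) :
    overlap z w = ‖rep (bergmanKernel _ w) z‖ / (‖bergmanKernel _ z‖ * ‖bergmanKernel _ w‖) := by
  rw [overlap, norm_inner_normalizedKernel, inner_bergmanKernel]

theorem continuous_overlap_left (w : thullen α hα) : Continuous fun z => overlap z w := by
  simp only [overlap_eq]
  exact (continuous_rep_coe _).norm.div (continuous_norm_bergmanKernel.mul continuous_const)
    fun z => (mul_pos (norm_bergmanKernel_pos z) (norm_bergmanKernel_pos w)).ne'

theorem skwDist_eq (z w : thullen α hα) : skwDist _ z w = √(1 - overlap z w) := by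
  rw [skwDist, overlap_comm]
  rfl

theorem skwDist_comm (z w : thullen α hα) : skwDist _ z w = skwDist _ w z := by
  rw [skwDist_eq, skwDist_eq, overlap_comm]

theorem continuous_skwDist_left (w : thullen α hα) : Continuous fun z => skwDist _ z w := by
  simp only [skwDist_eq]
  exact (continuous_const.sub (continuous_overlap_left w)).sqrt

theorem measurable_skwDist :
    Measurable (Function.uncurry (skwDist (thullen α hα))) := by
  have h1 : ∀ z : thullen α hα, Continuous fun w => skwDist _ z w := fun z => by
    have := continuous_skwDist_left z
    simpa only [skwDist_comm z] using this
  have h2 : ∀ w : thullen α hα, Measurable fun z => skwDist _ z w :=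
    fun w => (continuous_skwDist_left w).measurable
  have h3 : Measurable (Function.uncurry fun w z => skwDist (thullen α hα) z w) :=
    measurable_uncurry_of_continuous_of_measurable h1 h2
  have e : Function.uncurry (skwDist (thullen α hα)) =
      (Function.uncurry fun w z => skwDist (thullen α hα) z w) ∘ Prod.swap := by
    funext x
    rfl
  rw [e]
  exact h3.comp measurable_swap

theorem measurableSet_skwThickening (r : ℝ) (s : Set (thullen α hα)) :
    MeasurableSet (skwThickening (thullen α hα) r s) := by
  have h : Measurable fun z : thullen α hα => ⨅ w ∈ s, ENNReal.ofReal (skwDist _ z w) := by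
    refine measurable_of_Iio fun t => IsOpen.measurableSet ?_
    have : (fun z : thullen α hα => ⨅ w ∈ s, ENNReal.ofReal (skwDist _ z w)) ⁻¹' Iio t =
        ⋃ w ∈ s, {z | ENNReal.ofReal (skwDist _ z w) < t} := by
      ext z
      simp [iInf_lt_iff]
    rw [this]
    exact isOpen_biUnion fun w _ => isOpen_lt
      (ENNReal.continuous_ofReal.comp (continuous_skwDist_left w)) continuous_const
  exact measurableSet_le h measurable_const

theorem lt_skwDist_of_notMem_skwThickening {r : ℝ} {s : Set (thullen α hα)} {z w : thullen α hα}
    (hz : z ∉ skwThickening _ r s) (hw : w ∈ s) : r < skwDist _ w z := by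
  by_contra! h
  refine hz (le_trans (iInf₂_le w hw : _ ≤ ENNReal.ofReal (skwDist _ z w))
    (ENNReal.ofReal_le_ofReal ?_))
  rwa [skwDist_comm]

/-- The pairs of points at Skwarczyński distance more than `r`. -/
def farPairs (α : ℝ) (hα : 0 < α) (r : ℝ) : Set (thullen α hα × thullen α hα) :=
  {x | r < skwDist _ x.1 x.2}

theorem measurableSet_farPairs (r : ℝ) : MeasurableSet (farPairs α hα r) :=
  measurableSet_lt measurable_const measurable_skwDist

/-- Large distance means small overlap, hence by `exists_overlap_lower_bound` a small value of the
defining function at u, uniformly in z. These boundary layers decrease to the empty set in a domain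
of finite measure. -/
theorem exists_small_slices (hα : 0 < α) {δ : ℝ≥0∞} (hδ : 0 < δ) :
    ∃ (r : ℝ) (V : Set (thullen α hα)), 0 < r ∧ r < 1 ∧ MeasurableSet V ∧ domainMeasure _ V < δ ∧
      (∀ z u, (z, centerPoint z u) ∈ farPairs α hα r → u ∈ V) ∧
      (∀ z u, (centerPoint z u, z) ∈ farPairs α hα r → u ∈ V) := by
  obtain ⟨c, hc, hbc⟩ := exists_overlap_lower_bound hα
  have hdm : Measurable fun u : thullen α hα => c * defect α u ^ (5 + α) :=
    ((((continuous_defect hα).measurable.comp measurable_subtype_coe)).pow_const _).const_mul c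
  obtain ⟨V, hVdef⟩ : ∃ V : ℕ → Set (thullen α hα),
    V = fun n : ℕ => {u : thullen α hα | c * defect α u ^ (5 + α) < 1 / ((n : ℝ) + 2)} := ⟨_, rfl⟩
  have hVm : ∀ n, MeasurableSet (V n) := fun n => by
    rw [hVdef]; exact measurableSet_lt hdm measurable_const
  have hanti : Antitone V := by
    intro m n hmn u hu
    rw [hVdef] at hu ⊢
    have hu' : c * defect α u ^ (5 + α) < 1 / ((n : ℝ) + 2) := hu
    change c * defect α u ^ (5 + α) < 1 / ((m : ℝ) + 2)
    have hmn' : (m : ℝ) ≤ n := by exact_mod_cast hmn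
    exact hu'.trans_le (one_div_le_one_div_of_le (by positivity) (by linarith))
  have hempty : ⋂ n, V n = ∅ := by
    rw [eq_empty_iff_forall_notMem]
    intro u hu
    have hpos : 0 < c * defect α u ^ (5 + α) :=
      mul_pos hc (Real.rpow_pos_of_pos (mem_thullen_iff.1 u.2) _)
    obtain ⟨n, hn⟩ := exists_nat_one_div_lt hpos
    have h1 := mem_iInter.1 hu n
    rw [hVdef] at h1
    have h2 : 1 / ((n : ℝ) + 2) ≤ 1 / ((n : ℝ) + 1) :=
      one_div_le_one_div_of_le (by positivity) (by linarith)
    have h3 : c * defect α u ^ (5 + α) < 1 / ((n : ℝ) + 2) := h1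
    linarith
  have hlim := tendsto_measure_iInter_atTop (μ := domainMeasure (thullen α hα))
    (fun n => (hVm n).nullMeasurableSet) hanti ⟨0, measure_ne_top _ _⟩
  rw [hempty, measure_empty] at hlim
  obtain ⟨n, hn⟩ := (hlim.eventually (gt_mem_nhds hδ)).exists
  have hn2 : (0 : ℝ) < (n : ℝ) + 2 := by positivity
  have ht1 : 1 / ((n : ℝ) + 2) < 1 := by
    rw [div_lt_one hn2]; linarith [(Nat.cast_nonneg n : (0 : ℝ) ≤ n)]
  have ht0 : 0 < 1 / ((n : ℝ) + 2) := by positivity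
  have key : ∀ z u : thullen α hα, √(1 - 1 / ((n : ℝ) + 2)) < skwDist _ z (centerPoint z u) →
      u ∈ V n := by
    intro z u h
    rw [hVdef]
    change c * defect α u ^ (5 + α) < 1 / ((n : ℝ) + 2)
    rw [skwDist_eq, Real.sqrt_lt_sqrt_iff (by linarith)] at h
    -- The overlap lies in [0, 1], so its square is also below 1/(n+2).
    have h1 : c * defect α u ^ (5 + α) ≤ overlap z (centerPoint z u) ^ 2 := hbc z u
    have h2 := overlap_nonneg z (centerPoint z u)
    have h3 := overlap_le_one z (centerPoint z u)
    nlinarith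
  refine ⟨√(1 - 1 / ((n : ℝ) + 2)), V n, Real.sqrt_pos.2 (by linarith), ?_, hVm n, hn,
    fun z u h => key z u h, fun z u h => key z u ?_⟩
  · rw [Real.sqrt_lt' one_pos]; linarith
  · rw [skwDist_comm]; exact h

end Distance

/-! ## Multiplication by indicator functions -/

section Indicator

variable {Ω : Opens (ℂ × ℂ)}

theorem ae_domainMeasure {P : ℂ × ℂ → Prop} (h : ∀ᵐ w ∂(volume.restrict (Ω : Set (ℂ × ℂ))), P w) :
    ∀ᵐ x : Ω ∂(domainMeasure Ω), P x := by
  have hme : MeasurableEmbedding ((↑) : Ω → ℂ × ℂ) :=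
    MeasurableEmbedding.subtype_coe Ω.isOpen.measurableSet
  rw [← map_comap_subtype_coe Ω.isOpen.measurableSet] at h
  exact hme.ae_map_iff.1 h

theorem enorm_sq_eq_lintegral_L2 (f : L2 Ω) :
    ‖f‖ₑ ^ 2 = ∫⁻ w, ‖f w‖ₑ ^ 2 ∂(domainMeasure Ω) := by
  rw [lintegral_domainMeasure (fun w => ‖f w‖ₑ ^ 2), Lp.enorm_def,
    eLpNorm_eq_lintegral_rpow_enorm_toReal (by norm_num) (by norm_num)]
  simp only [ENNReal.toReal_ofNat, ENNReal.rpow_ofNat]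
  rw [← ENNReal.rpow_natCast, ← ENNReal.rpow_mul]
  norm_num

theorem indicatorOp_ae_eq_domain {s : Set Ω} (hs : MeasurableSet s) (f : L2 Ω) :
    ∀ᵐ x : Ω ∂(domainMeasure Ω), indicatorOp Ω s f x = s.indicator (fun x : Ω => f x) x := by
  filter_upwards [ae_domainMeasure (indicatorOp_ae_eq Ω hs f)] with x hx
  rw [hx]
  by_cases h : x ∈ s
  · rw [indicator_of_mem h, indicator_of_mem (mem_image_of_mem _ h)]
  · rw [indicator_of_notMem h, indicator_of_notMem]
    rwa [Subtype.val_injective.mem_set_image]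

theorem ext_domain {f g : L2 Ω} (h : ∀ᵐ x : Ω ∂(domainMeasure Ω), f x = g x) : f = g := by
  rw [← sub_eq_zero, ← enorm_eq_zero, ← pow_eq_zero_iff two_ne_zero, enorm_sq_eq_lintegral_L2]
  rw [← lintegral_zero (μ := domainMeasure Ω)]
  refine lintegral_congr_ae ?_
  filter_upwards [h, ae_domainMeasure (Lp.coeFn_sub f g)] with x h1 h2
  rw [h2, Pi.sub_apply, h1, sub_self]
  simp

theorem indicatorOp_indicatorOp_self {s : Set Ω} (hs : MeasurableSet s) (f : L2 Ω) :
    indicatorOp Ω s (indicatorOp Ω s f) = indicatorOp Ω s f := by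
  refine ext_domain ?_
  filter_upwards [indicatorOp_ae_eq_domain hs f,
    indicatorOp_ae_eq_domain hs (indicatorOp Ω s f)] with x h1 h2
  rw [h2]
  by_cases h : x ∈ s
  · rw [indicator_of_mem h]
  · rw [h1, indicator_of_notMem h, indicator_of_notMem h]

theorem indicatorOp_indicatorOp_of_disjoint {s t : Set Ω} (hs : MeasurableSet s)
    (ht : MeasurableSet t) (hst : Disjoint s t) (f : L2 Ω) :
    indicatorOp Ω s (indicatorOp Ω t f) = 0 := by
  refine ext_domain ?_
  filter_upwards [indicatorOp_ae_eq_domain ht f, indicatorOp_ae_eq_domain hs (indicatorOp Ω t f),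
    ae_domainMeasure (Lp.coeFn_zero ℂ 2 (volume.restrict (Ω : Set (ℂ × ℂ))))] with x h1 h2 h3
  rw [h2, h3]
  by_cases h : x ∈ s
  · rw [indicator_of_mem h, h1, indicator_of_notMem (disjoint_left.1 hst h)]
    rfl
  · rw [indicator_of_notMem h]
    rfl

theorem inner_indicatorOp_of_disjoint {s t : Set Ω} (hs : MeasurableSet s)
    (ht : MeasurableSet t) (hst : Disjoint s t) (f g : L2 Ω) :
    (inner ℂ (indicatorOp Ω s f) (indicatorOp Ω t g) : ℂ) = 0 := by
  rw [L2.inner_def]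
  refine integral_eq_zero_of_ae ?_
  filter_upwards [indicatorOp_ae_eq Ω hs f, indicatorOp_ae_eq Ω ht g] with x h1 h2
  rw [h1, h2]
  by_cases h : x ∈ ((↑) '' s : Set (ℂ × ℂ))
  · have h' : x ∉ ((↑) '' t : Set (ℂ × ℂ)) := disjoint_left.1
      ((disjoint_image_iff Subtype.val_injective).2 hst) h
    rw [indicator_of_notMem h', inner_zero_right]
    rfl
  · rw [indicator_of_notMem h, inner_zero_left]
    rfl

end Indicator

/-! ## Localization of the extended operator -/

section Localization

open bergmanSpace

variable {α : ℝ} {hα : 0 < α}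
  {Tstar : kernelSpan (thullen α hα) →ₗ[ℂ] bergmanSpace (thullen α hα)}
  {Tb : bergmanSpace (thullen α hα) →L[ℂ] bergmanSpace (thullen α hα)}

/-- Since T* K_z lies in A², pairing with it does not see the projection; TP is thus an integral
operator on all of L². -/
theorem rep_apply_bergmanProjection
    (hTb : ∀ (z : thullen α hα) (f : bergmanSpace (thullen α hα)),
      rep (Tb f) z = inner ℂ (Tstar (spanBergman _ z)) f)
    (z : thullen α hα) (g : L2 (thullen α hα)) :
    rep (Tb (bergmanProjection _ g)) z =
      inner ℂ (Tstar (spanBergman _ z) : L2 (thullen α hα)) g := by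
  rw [hTb]
  exact (bergmanSpace (thullen α hα)).inner_orthogonalProjectionOnto_eq_of_mem_left
    (Tstar (spanBergman _ z)) g

theorem enorm_rep_localized_le
    (hTb : ∀ (z : thullen α hα) (f : bergmanSpace (thullen α hα)),
      rep (Tb f) z = inner ℂ (Tstar (spanBergman _ z)) f)
    {G : Set (thullen α hα)} (hG : MeasurableSet G) (f : bergmanSpace (thullen α hα))
    (z : thullen α hα) :
    ‖rep (Tb (bergmanProjection _ (indicatorOp _ G f))) z‖ₑ ≤
      ∫⁻ w, coeffNorm Tstar z w * ‖rep f w‖ₑ ∂(domainMeasure _) := by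
  rw [rep_apply_bergmanProjection hTb]
  have h : (indicatorOp (thullen α hα) G f : ℂ × ℂ → ℂ) =ᵐ[volume.restrict (thullen α hα)]
      ((↑) '' G : Set (ℂ × ℂ)).indicator (rep f) := by
    filter_upwards [indicatorOp_ae_eq (thullen α hα) hG (f : L2 (thullen α hα)), ae_eq_rep f]
      with x h1 h2
    rw [h1, indicator, indicator, h2]
  refine (enorm_inner_le_lintegral _ _ h).trans (lintegral_mono fun w => ?_)
  rw [coeffNorm]
  gcongr
  exact enorm_indicator_le_enorm_self _ _

/-- The difference is the pairing of T* K_z with f cut off to the complement of the thickening; for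
z in F, every point there is at distance more than r from z. -/
theorem enorm_rep_sub_localized_le
    (hTb : ∀ (z : thullen α hα) (f : bergmanSpace (thullen α hα)),
      rep (Tb f) z = inner ℂ (Tstar (spanBergman _ z)) f)
    {r : ℝ} {F : Set (thullen α hα)} (f : bergmanSpace (thullen α hα))
    {z : thullen α hα} (hz : z ∈ F) :
    ‖rep (Tb f) z -
        rep (Tb (bergmanProjection _ (indicatorOp _ (skwThickening _ r F) f))) z‖ₑ ≤
      ∫⁻ w, (farPairs α hα r).indicator (Function.uncurry (coeffNorm Tstar)) (z, w) * ‖rep f w‖ₑ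
        ∂(domainMeasure _) := by
  have hG := measurableSet_skwThickening r F
  have e : rep (Tb f) z -
      rep (Tb (bergmanProjection _ (indicatorOp _ (skwThickening _ r F) f))) z =
      inner ℂ (Tstar (spanBergman _ z) : L2 (thullen α hα))
        ((f : L2 (thullen α hα)) - indicatorOp _ (skwThickening _ r F) f) := by
    rw [rep_apply_bergmanProjection hTb, hTb, inner_sub_right]
    rfl
  have h : (((f : L2 (thullen α hα)) - indicatorOp _ (skwThickening _ r F) f :
      L2 (thullen α hα)) : ℂ × ℂ → ℂ) =ᵐ[volume.restrict (thullen α hα)]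
      ((↑) '' (skwThickening _ r F) : Set (ℂ × ℂ))ᶜ.indicator (rep f) := by
    filter_upwards [indicatorOp_ae_eq (thullen α hα) hG (f : L2 (thullen α hα)), ae_eq_rep f,
      Lp.coeFn_sub (f : L2 (thullen α hα)) (indicatorOp _ (skwThickening _ r F) f)] with x h1 h2 h3
    rw [h3, Pi.sub_apply, h1]
    by_cases hx : x ∈ ((↑) '' (skwThickening _ r F) : Set (ℂ × ℂ))
    · rw [indicator_of_mem hx, indicator_of_notMem (notMem_compl_iff.2 hx), sub_self]
    · rw [indicator_of_notMem hx, indicator_of_mem (mem_compl hx), sub_zero, h2]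
  rw [e]
  refine (enorm_inner_le_lintegral _ _ h).trans (lintegral_mono fun w => ?_)
  by_cases hw : w ∈ skwThickening _ r F
  · rw [indicator_of_notMem (notMem_compl_iff.2 (mem_image_of_mem _ hw)), enorm_zero, mul_zero]
    exact zero_le
  · have h1 : (z, w) ∈ farPairs α hα r := lt_skwDist_of_notMem_skwThickening hw hz
    rw [indicator_of_mem h1, Function.uncurry_apply_pair, coeffNorm]
    gcongr
    exact enorm_indicator_le_enorm_self _ _

/-- The terms live on disjoint sets, hence are orthogonal, and their squared norms add up to at most
the integral of the common majorant H. -/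
theorem summable_indicatorOp {Ω : Opens (ℂ × ℂ)} {F : ℕ → Set Ω} (hF : ∀ j, MeasurableSet (F j))
    (hd : Pairwise fun i j => Disjoint (F i) (F j)) {b : ℕ → L2 Ω} {H : Ω → ℝ≥0∞}
    (hH : ∫⁻ x, H x ∂(domainMeasure Ω) < ∞)
    (hb : ∀ j, ∀ᵐ x : Ω ∂(domainMeasure Ω), ‖b j x‖ₑ ^ 2 ≤ H x) :
    Summable fun j => indicatorOp Ω (F j) (b j) := by
  let K : ℕ → Submodule ℂ (L2 Ω) := fun j => LinearMap.range (indicatorOp Ω (F j)).toLinearMap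
  have hK : OrthogonalFamily ℂ (fun j => K j) fun j => (K j).subtypeₗᵢ := by
    rintro i j hij ⟨_, f, rfl⟩ ⟨_, g, rfl⟩
    exact inner_indicatorOp_of_disjoint (hF i) (hF j) (hd hij) f g
  have hsq : ∀ j, ‖indicatorOp Ω (F j) (b j)‖ₑ ^ 2 ≤ ∫⁻ x in F j, H x ∂(domainMeasure Ω) := by
    intro j
    rw [enorm_sq_eq_lintegral_L2, ← lintegral_indicator (hF j)]
    refine lintegral_mono_ae ?_
    filter_upwards [hb j, indicatorOp_ae_eq_domain (hF j) (b j)] with x h1 h2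
    rw [h2]
    by_cases hx : x ∈ F j
    · rw [indicator_of_mem hx, indicator_of_mem hx]
      exact h1
    · rw [indicator_of_notMem hx, indicator_of_notMem hx]
      simp
  have hsum : ∑' j, ‖indicatorOp Ω (F j) (b j)‖ₑ ^ 2 ≠ ∞ := by
    refine ne_top_of_le_ne_top hH.ne ((ENNReal.tsum_le_tsum hsq).trans ?_)
    rw [← lintegral_iUnion hF hd]
    exact setLIntegral_le_lintegral _ _
  refine (hK.summable_iff_norm_sq_summable fun j =>
    ⟨indicatorOp Ω (F j) (b j), LinearMap.mem_range_self _ (b j)⟩).2 ?_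
  refine (ENNReal.summable_toReal hsum).congr fun j => ?_
  rw [ENNReal.toReal_pow, toReal_enorm]
  rfl

/-- The full kernel provides the majorant that makes the series converge; the far kernel bounds the
error. As the F_j partition the domain, the error can be estimated pointwise, in the one piece
containing z. -/
theorem exists_localized_sum
    (hTb : ∀ (z : thullen α hα) (f : bergmanSpace (thullen α hα)),
      rep (Tb f) z = inner ℂ (Tstar (spanBergman _ z)) f)
    {B : ℝ≥0∞} (hB : B < ∞) (hBb : ∀ g : thullen α hα → ℝ≥0∞, Measurable g →
        ∫⁻ z, (∫⁻ w, coeffNorm Tstar z w * g w ∂(domainMeasure _)) ^ 2 ∂(domainMeasure _) ≤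
          B * ∫⁻ w, g w ^ 2 ∂(domainMeasure _))
    {η r : ℝ} (hη : 0 ≤ η) (hηb : ∀ g : thullen α hα → ℝ≥0∞, Measurable g →
        ∫⁻ z, (∫⁻ w, (farPairs α hα r).indicator (Function.uncurry (coeffNorm Tstar)) (z, w) * g w
          ∂(domainMeasure _)) ^ 2 ∂(domainMeasure _) ≤
          ENNReal.ofReal η ^ 2 * ∫⁻ w, g w ^ 2 ∂(domainMeasure _))
    {F : ℕ → Set (thullen α hα)} (hF : ∀ j, MeasurableSet (F j))
    (hd : Pairwise fun i j => Disjoint (F i) (F j)) (hU : ⋃ j, F j = univ) :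
    ∃ S : bergmanSpace (thullen α hα) →L[ℂ] L2 (thullen α hα),
      (∀ f, HasSum (fun j =>
        localizedOp Tb (F j) (skwThickening (thullen α hα) r (F j)) f) (S f)) ∧
      ‖(bergmanSpace (thullen α hα)).subtypeL ∘L Tb - S‖ ≤ η := by
  have hnorm : ∀ f : bergmanSpace (thullen α hα),
      ∫⁻ w : thullen α hα, ‖rep f w‖ₑ ^ 2 ∂(domainMeasure _) = ‖f‖ₑ ^ 2 := fun f => by
    rw [enorm_sq_eq_lintegral, ← lintegral_domainMeasure (fun w => ‖rep f w‖ₑ ^ 2)]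
  have hmeas : ∀ f : bergmanSpace (thullen α hα),
      Measurable fun w : thullen α hα => ‖rep f w‖ₑ :=
    fun f => (continuous_rep_coe f).enorm.measurable
  let b : bergmanSpace (thullen α hα) → ℕ → bergmanSpace (thullen α hα) := fun f j =>
    Tb (bergmanProjection _ (indicatorOp _ (skwThickening (thullen α hα) r (F j)) f))
  have hloc : ∀ f j, localizedOp Tb (F j) (skwThickening (thullen α hα) r (F j)) f =
    indicatorOp _ (F j) (b f j) := fun f j => rfl
  have hsum : ∀ f, Summable fun j =>
      localizedOp Tb (F j) (skwThickening (thullen α hα) r (F j)) f := by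
    intro f
    refine summable_indicatorOp hF hd (b := fun j => (b f j : L2 (thullen α hα)))
      (H := fun z => (∫⁻ w, coeffNorm Tstar z w * ‖rep f w‖ₑ ∂(domainMeasure _)) ^ 2) ?_ fun j => ?_
    · refine (hBb _ (hmeas f)).trans_lt ?_
      rw [hnorm]
      finiteness
    · filter_upwards [ae_domainMeasure (ae_eq_rep (b f j))] with z hz
      rw [hz]
      gcongr
      exact enorm_rep_localized_le hTb (measurableSet_skwThickening r (F j)) f z
  -- Multiplication by the indicator of F_j is continuous and annihilates every other term, so the
  -- sum agrees on F_j with its j-th term.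
  have hpiece : ∀ f j, indicatorOp _ (F j) (∑' i,
      localizedOp Tb (F i) (skwThickening (thullen α hα) r (F i)) f) =
      indicatorOp _ (F j) (b f j) := by
    intro f j
    have h1 := (hsum f).hasSum.mapL (indicatorOp _ (F j))
    have h2 := hasSum_single (f := fun i => indicatorOp _ (F j)
      (localizedOp Tb (F i) (skwThickening (thullen α hα) r (F i)) f)) j fun i hij =>
        indicatorOp_indicatorOp_of_disjoint (hF j) (hF i) (hd hij.symm) _
    rw [h1.unique h2]
    exact indicatorOp_indicatorOp_self (hF j) _
  have hbound : ∀ f, ‖(Tb f : L2 (thullen α hα)) - ∑' i,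
      localizedOp Tb (F i) (skwThickening (thullen α hα) r (F i)) f‖ ≤ η * ‖f‖ := by
    intro f
    have h1 : ‖(Tb f : L2 (thullen α hα)) - ∑' i,
      localizedOp Tb (F i) (skwThickening (thullen α hα) r (F i)) f‖ₑ ^ 2 ≤
        ENNReal.ofReal η ^ 2 * ‖f‖ₑ ^ 2 := by
      rw [enorm_sq_eq_lintegral_L2, ← hnorm]
      refine (lintegral_mono_ae ?_).trans (hηb _ (hmeas f))
      have hall : ∀ᵐ x : thullen α hα ∂(domainMeasure _), ∀ j,
          indicatorOp _ (F j) (∑' i,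
            localizedOp Tb (F i) (skwThickening (thullen α hα) r (F i)) f) x =
          (F j).indicator (fun x : thullen α hα => (∑' i,
            localizedOp Tb (F i) (skwThickening (thullen α hα) r (F i)) f : L2 _) x) x ∧
          indicatorOp _ (F j) (b f j) x =
            (F j).indicator (fun x : thullen α hα => (b f j : L2 (thullen α hα)) x) x ∧
          (b f j : L2 (thullen α hα)) x = rep (b f j) x := by
        refine ae_all_iff.2 fun j => ?_
        filter_upwards [indicatorOp_ae_eq_domain (hF j) (∑' i,
            localizedOp Tb (F i) (skwThickening (thullen α hα) r (F i)) f),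
          indicatorOp_ae_eq_domain (hF j) (b f j : L2 (thullen α hα)),
          ae_domainMeasure (ae_eq_rep (b f j))] with x h1 h2 h3
        exact ⟨h1, h2, h3⟩
      filter_upwards [hall, ae_domainMeasure (ae_eq_rep (Tb f)), ae_domainMeasure
        (Lp.coeFn_sub (Tb f : L2 (thullen α hα)) (∑' i,
          localizedOp Tb (F i) (skwThickening (thullen α hα) r (F i)) f))] with z h2 h3 h4
      obtain ⟨j, hj⟩ := mem_iUnion.1 (hU.symm ▸ mem_univ z : z ∈ ⋃ j, F j)
      obtain ⟨h5, h6, h7⟩ := h2 j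
      rw [hpiece, h6, indicator_of_mem hj, indicator_of_mem hj, h7] at h5
      rw [h4, Pi.sub_apply, h3, ← h5]
      gcongr
      exact enorm_rep_sub_localized_le hTb f hj
    rw [← mul_pow] at h1
    have h2 := (ENNReal.pow_le_pow_left_iff two_ne_zero).1 h1
    have h3 := ENNReal.toReal_mono (by finiteness) h2
    rwa [ENNReal.toReal_mul, toReal_enorm, toReal_enorm, ENNReal.toReal_ofReal hη] at h3
  let S₀ : bergmanSpace (thullen α hα) →ₗ[ℂ] L2 (thullen α hα) :=
    { toFun := fun f => ∑' i, localizedOp Tb (F i) (skwThickening (thullen α hα) r (F i)) f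
      map_add' := fun f g => by
        simp only [map_add]
        exact (hsum f).tsum_add (hsum g)
      map_smul' := fun c f => by
        simp only [map_smul, RingHom.id_apply]
        exact (hsum f).tsum_const_smul c }
  refine ⟨S₀.mkContinuous (‖Tb‖ + η) fun f => ?_, fun f => (hsum f).hasSum, ?_⟩
  · have h1 := norm_sub_norm_le (S₀ f) (Tb f : L2 (thullen α hα))
    rw [norm_sub_rev] at h1
    have h2 : ‖(Tb f : L2 (thullen α hα))‖ ≤ ‖Tb‖ * ‖f‖ := Tb.le_opNorm f
    have h3 := hbound f
    have h4 : ‖(Tb f : L2 (thullen α hα)) - S₀ f‖ ≤ η * ‖f‖ := h3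
    linarith
  · exact ContinuousLinearMap.opNorm_le_bound _ hη hbound

end Localization

/-! ## Coverings by Skwarczyński balls -/

section Phase

variable {E : Type*} [NormedAddCommGroup E] [InnerProductSpace ℂ E]

theorem norm_sub_smul_sq {a b : E} (ha : ‖a‖ = 1) (hb : ‖b‖ = 1) {c : ℂ} (hc : ‖c‖ = 1) :
    ‖a - c • b‖ ^ 2 = 2 - 2 * (c * inner ℂ a b).re := by
  have h := @norm_sub_sq ℂ E _ _ _ a (c • b)
  rw [h, norm_smul, ha, hb, hc, inner_smul_right, RCLike.re_eq_complex_re]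
  ring

/-- Choosing the phase that makes the inner product real and nonnegative minimizes the distance.
Thus √2 d is the quotient distance between unit vectors modulo phases. -/
theorem exists_phase {a b : E} (ha : ‖a‖ = 1) (hb : ‖b‖ = 1) :
    ∃ c : ℂ, ‖c‖ = 1 ∧ ‖a - c • b‖ = √2 * √(1 - ‖(inner ℂ a b : ℂ)‖) := by
  obtain ⟨c, hc, hcw⟩ : ∃ c : ℂ, ‖c‖ = 1 ∧ c * inner ℂ a b = (‖(inner ℂ a b : ℂ)‖ : ℂ) := by
    by_cases h : (inner ℂ a b : ℂ) = 0
    · exact ⟨1, norm_one, by rw [h]; simp⟩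
    · have hn : (‖(inner ℂ a b : ℂ)‖ : ℂ) ≠ 0 := by exact_mod_cast (norm_pos_iff.2 h).ne'
      refine ⟨(‖(inner ℂ a b : ℂ)‖ : ℂ) / inner ℂ a b, ?_, div_mul_cancel₀ _ h⟩
      rw [norm_div, Complex.norm_real, norm_norm, div_self (norm_pos_iff.2 h).ne']
  refine ⟨c, hc, ?_⟩
  rw [← Real.sqrt_mul (by norm_num), ← Real.sqrt_sq (norm_nonneg (a - c • b)),
    norm_sub_smul_sq ha hb hc, hcw, Complex.ofReal_re]
  congr 1
  ring

theorem sqrt_one_sub_norm_inner_le {a b : E} (ha : ‖a‖ = 1) (hb : ‖b‖ = 1) {c : ℂ}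
    (hc : ‖c‖ = 1) : √2 * √(1 - ‖(inner ℂ a b : ℂ)‖) ≤ ‖a - c • b‖ := by
  rw [← Real.sqrt_mul (by norm_num), ← Real.sqrt_sq (norm_nonneg (a - c • b)),
    norm_sub_smul_sq ha hb hc]
  refine Real.sqrt_le_sqrt ?_
  have h := (Complex.re_le_norm (c * inner ℂ a b))
  rw [norm_mul, hc, one_mul] at h
  linarith

/-- The optimal phases for (a,b) and (b,e) multiply to an admissible one for (a,e), and the norm
triangle inequality applies. -/
theorem sqrt_one_sub_norm_inner_triangle {a b e : E} (ha : ‖a‖ = 1) (hb : ‖b‖ = 1)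
    (he : ‖e‖ = 1) : √(1 - ‖(inner ℂ a e : ℂ)‖) ≤
      √(1 - ‖(inner ℂ a b : ℂ)‖) + √(1 - ‖(inner ℂ b e : ℂ)‖) := by
  obtain ⟨c, hc, h1⟩ := exists_phase ha hb
  obtain ⟨c', hc', h2⟩ := exists_phase hb he
  have h3 := sqrt_one_sub_norm_inner_le ha he (c := c * c') (by rw [norm_mul, hc, hc', one_mul])
  have h4 : a - (c * c') • e = (a - c • b) + c • (b - c' • e) := by
    rw [smul_sub, smul_smul]; abel
  have h5 := norm_add_le (a - c • b) (c • (b - c' • e))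
  rw [← h4, norm_smul, hc, one_mul, h1, h2, ← mul_add] at h5
  exact le_of_mul_le_mul_left (h3.trans h5) (by positivity)

end Phase

/-! ### Volume of Skwarczyński balls and the packing argument -/

section Covering

open bergmanSpace

variable {α : ℝ} {hα : 0 < α}

theorem skwDist_triangle (x y z : thullen α hα) :
    skwDist _ x z ≤ skwDist _ x y + skwDist _ y z := by
  simp only [skwDist_eq]
  exact sqrt_one_sub_norm_inner_triangle (norm_normalizedKernel x) (norm_normalizedKernel y)
    (norm_normalizedKernel z)

theorem skwDist_self (x : thullen α hα) : skwDist _ x x = 0 := by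
  have h : overlap x x = 1 := by
    have h1 := inner_self_eq_norm_sq_to_K (𝕜 := ℂ) (normalizedKernel (thullen α hα) x)
    rw [norm_normalizedKernel] at h1
    rw [overlap, h1]
    simp
  rw [skwDist_eq, h, sub_self, Real.sqrt_zero]

/-- Open balls for the Skwarczyński distance. -/
def skwBall (z : thullen α hα) (R : ℝ) : Set (thullen α hα) := {w | skwDist _ w z < R}

theorem isOpen_skwBall (z : thullen α hα) (R : ℝ) : IsOpen (skwBall z R) :=
  isOpen_lt (continuous_skwDist_left z) continuous_const

theorem mem_skwBall_self (z : thullen α hα) {R : ℝ} (hR : 0 < R) : z ∈ skwBall z R := by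
  change skwDist _ z z < R
  rwa [skwDist_self]

/-- The invariant measure `‖K_w‖² dσ(w)`. -/
def kernelMeasure (α : ℝ) (hα : 0 < α) : Measure (thullen α hα) :=
  (domainMeasure _).withDensity fun w => ‖bergmanKernel _ w‖ₑ ^ 2

theorem kernelMeasure_apply {s : Set (thullen α hα)} (hs : MeasurableSet s) :
    kernelMeasure α hα s = ∫⁻ w in s, ‖bergmanKernel _ w‖ₑ ^ 2 ∂(domainMeasure _) :=
  withDensity_apply _ hs

theorem measurable_enorm_bergmanKernel :
    Measurable fun w : thullen α hα => ‖bergmanKernel _ w‖ₑ := by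
  simp only [← ofReal_norm]
  exact continuous_norm_bergmanKernel.measurable.ennreal_ofReal

/-- |k_z(w)| is ‖K_w‖ times the overlap, which on the ball is at least 1 - R²; integrate and use
‖k_z‖ = 1. -/
theorem kernelMeasure_skwBall_le (z : thullen α hα) {R : ℝ} (hR0 : 0 ≤ R) (hR : R < 1) :
    kernelMeasure α hα (skwBall z R) ≤ (ENNReal.ofReal (1 - R ^ 2) ^ 2)⁻¹ := by
  have hρ : 0 < 1 - R ^ 2 := by nlinarith
  have h1 : ∀ w ∈ skwBall z R, ‖bergmanKernel _ w‖ₑ ^ 2 ≤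
      (ENNReal.ofReal (1 - R ^ 2) ^ 2)⁻¹ * ‖rep (normalizedKernel _ z) w‖ₑ ^ 2 := by
    intro w hw
    have hw' : √(1 - overlap w z) < R := by
      have : skwDist _ w z < R := hw
      rwa [skwDist_eq] at this
    have h2 : 1 - R ^ 2 ≤ overlap w z := by
      have h3 := overlap_le_one w z
      have h4 := Real.sq_sqrt (by linarith : 0 ≤ 1 - overlap w z)
      nlinarith [Real.sqrt_nonneg (1 - overlap w z)]
    have h5 : ‖rep (normalizedKernel _ z) w‖ = ‖bergmanKernel _ w‖ * overlap w z := by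
      rw [← inner_bergmanKernel, overlap, bergmanKernel_eq_smul w,
        inner_smul_left (𝕜 := ℂ) (E := bergmanSpace _), norm_mul, RCLike.norm_conj,
        ← bergmanKernel_eq_smul, Complex.norm_real, norm_norm]
    rw [mul_comm, ← div_eq_mul_inv, ENNReal.le_div_iff_mul_le
      (Or.inl (by positivity)) (Or.inl (by finiteness)), ← mul_pow, ← ofReal_norm, ← ofReal_norm, h5,
      ← ENNReal.ofReal_mul (norm_nonneg _)]
    gcongr
  rw [kernelMeasure_apply (isOpen_skwBall z R).measurableSet]
  refine (setLIntegral_mono' (isOpen_skwBall z R).measurableSet h1).trans ?_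
  refine (setLIntegral_le_lintegral _ _).trans ?_
  rw [lintegral_const_mul _ ((continuous_rep_coe _).enorm.measurable.pow_const _),
    lintegral_domainMeasure (fun w => ‖rep (normalizedKernel _ z) w‖ₑ ^ 2),
    ← enorm_sq_eq_lintegral, ← ofReal_norm, norm_normalizedKernel]
  simp

theorem zero_mem_thullen : (0 : ℂ × ℂ) ∈ thullen α hα := by
  rw [mem_thullen_iff, defect]
  simpa using fiberSq_pos hα (ζ := 0) (by simp)

/-- Every ball contains the image of one fixed neighbourhood of the origin under the recentring map,
by the uniform overlap bound, and the kernel measure of that image is bounded below. -/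
theorem exists_kernelMeasure_skwBall_lower_bound (hα : 0 < α) {R : ℝ} (hR : 0 < R) :
    ∃ c : ℝ≥0∞, 0 < c ∧ ∀ z : thullen α hα, c ≤ kernelMeasure α hα (skwBall z R) := by
  obtain ⟨s, hs, hov⟩ := exists_overlap_near_one hα (η := R ^ 2 / 2) (by positivity)
  obtain ⟨c, hc, hcb⟩ := exists_kernel_mul_density_lower_bound hα
  obtain ⟨V, hVdef⟩ : ∃ V : Set (thullen α hα), V = {u : thullen α hα | ‖(u : ℂ × ℂ)‖ < s} := ⟨_, rfl⟩
  have hVo : IsOpen V := by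
    rw [hVdef]; exact isOpen_lt (by fun_prop) continuous_const
  have hVpos : 0 < domainMeasure _ V := by
    have hme : MeasurableEmbedding ((↑) : thullen α hα → ℂ × ℂ) :=
      MeasurableEmbedding.subtype_coe (thullen α hα).isOpen.measurableSet
    rw [domainMeasure, hme.comap_apply]
    refine ((thullen α hα).isOpen.isOpenMap_subtype_val V hVo).measure_pos _
      ⟨0, ⟨0, zero_mem_thullen⟩, ?_, rfl⟩
    rw [hVdef]
    simpa using hs
  refine ⟨ENNReal.ofReal c * domainMeasure _ V, ENNReal.mul_pos (by simpa using hc) hVpos.ne',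
    fun z => ?_⟩
  have hB := (isOpen_skwBall z R).measurableSet
  rw [kernelMeasure_apply hB, ← lintegral_indicator hB, ← lintegral_centerPoint z
    ((measurable_enorm_bergmanKernel.pow_const 2).indicator hB), ← setLIntegral_const]
  refine le_trans (setLIntegral_mono' hVo.measurableSet fun u hu => ?_)
    (setLIntegral_le_lintegral V _)
  have hu' : ‖(u : ℂ × ℂ)‖ < s := by rw [hVdef] at hu; exact hu
  have h1 : centerPoint z u ∈ skwBall z R := by
    change skwDist _ (centerPoint z u) z < R
    rw [skwDist_comm, skwDist_eq, Real.sqrt_lt' hR]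
    have h2 : 1 - R ^ 2 / 2 ≤ overlap z (centerPoint z u) := hov z u hu'.le
    nlinarith
  rw [indicator_of_mem h1, ← ofReal_norm, ← ENNReal.ofReal_pow (norm_nonneg _),
    ← ENNReal.ofReal_mul (centerDensity_pos z.2 u.2).le, mul_comm]
  exact ENNReal.ofReal_le_ofReal (hcb z u)

/-- A maximal separated set for the Skwarczyński distance, enumerated. -/
theorem exists_separated_net (hα : 0 < α) {η : ℝ} (hη : 0 < η) : ∃ f : ℕ → thullen α hα,
    (∀ i j, f i ≠ f j → η ≤ skwDist _ (f i) (f j)) ∧ ∀ x, ∃ j, x ∈ skwBall (f j) η := by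
  obtain ⟨s, hs⟩ := zorn_subset {s : Set (thullen α hα) | s.Pairwise fun x y => η ≤ skwDist _ x y}
    fun c hc hchain => ⟨⋃₀ c, (pairwise_sUnion hchain.directedOn).2 fun t ht => hc ht,
      fun t ht => subset_sUnion_of_mem ht⟩
  have hsep : s.Pairwise fun x y => η ≤ skwDist _ x y := hs.prop
  have hcov : ∀ x, ∃ y ∈ s, x ∈ skwBall y η := by
    intro x
    by_contra! hx
    have hxs : x ∉ s := fun h => hx x h (mem_skwBall_self x hη)
    have hins : (insert x s).Pairwise fun x y => η ≤ skwDist _ x y := by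
      refine hsep.insert fun y hy _ => ?_
      have h1 : η ≤ skwDist _ x y := not_lt.1 (hx y hy)
      exact ⟨h1, by rwa [skwDist_comm]⟩
    exact hxs (hs.le_of_ge hins (subset_insert x s) (mem_insert x s))
  have hcount : s.Countable := by
    refine PairwiseDisjoint.countable_of_isOpen (s := fun x => skwBall x (η / 2))
      (fun x hx y hy hxy => disjoint_left.2 fun w h1 h2 => ?_)
      (fun x _ => isOpen_skwBall _ _) fun x _ => ⟨x, mem_skwBall_self x (by positivity)⟩
    have h3 : skwDist _ w x < η / 2 := h1
    have h4 : skwDist _ w y < η / 2 := h2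
    have h5 := hsep hx hy hxy
    have h6 := skwDist_triangle x w y
    rw [skwDist_comm x w] at h6
    linarith
  have hne : s.Nonempty := by
    obtain ⟨y, hy, -⟩ := hcov ⟨0, zero_mem_thullen⟩
    exact ⟨y, hy⟩
  obtain ⟨f, hf⟩ := hcount.exists_eq_range hne
  refine ⟨f, fun i j hij => hsep (hf ▸ mem_range_self i) (hf ▸ mem_range_self j) hij, fun x => ?_⟩
  obtain ⟨y, hy, hx⟩ := hcov x
  rw [hf] at hy
  obtain ⟨j, rfl⟩ := hy
  exact ⟨j, hx⟩

/-- If z lies in many thickenings, then many disjoint balls of radius η/2 about net points fit into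
one ball of radius r + 3η < 1 about z; comparing kernel measures bounds their number. -/
theorem exists_isSkwCovering (hα : 0 < α) {r : ℝ} (hr0 : 0 < r) (hr1 : r < 1) :
    ∃ (N : ℕ) (C : ℝ) (F : ℕ → Set (thullen α hα)),
      C < 1 ∧ IsSkwCovering (thullen α hα) r N C F := by
  -- This keeps r + 3η below 1, as the upper volume bound requires.
  obtain ⟨η, hηdef⟩ : ∃ η, η = (1 - r) / 4 := ⟨_, rfl⟩
  have hη : 0 < η := by rw [hηdef]; linarith
  obtain ⟨f, hsep, hcov⟩ := exists_separated_net hα hη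
  obtain ⟨c, hc, hcb⟩ := exists_kernelMeasure_skwBall_lower_bound hα (half_pos hη)
  have hR1 : r + 3 * η < 1 := by rw [hηdef]; linarith
  obtain ⟨L, hLdef⟩ : ∃ L : ℝ≥0∞, L = (ENNReal.ofReal (1 - (r + 3 * η) ^ 2) ^ 2)⁻¹ := ⟨_, rfl⟩
  have hL : L < ∞ := by
    have : 0 < 1 - (r + 3 * η) ^ 2 := by nlinarith
    rw [hLdef, ENNReal.inv_lt_top]
    positivity
  have hcL : L / c < ∞ := ENNReal.div_lt_top hL.ne hc.ne'
  obtain ⟨N, hN⟩ := ENNReal.exists_nat_gt hcL.ne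
  -- Each point is assigned to the first net ball that contains it.
  obtain ⟨F, hFdef⟩ : ∃ F : ℕ → Set (thullen α hα),
    F = fun j => skwBall (f j) η \ ⋃ i < j, skwBall (f i) η := ⟨_, rfl⟩
  have hFb : ∀ j, F j ⊆ skwBall (f j) η := fun j => by rw [hFdef]; exact sdiff_subset
  have hFn : ∀ i j, i < j → ∀ x ∈ F j, x ∉ skwBall (f i) η := by
    intro i j hij x hx hxi
    rw [hFdef] at hx
    exact hx.2 (mem_iUnion₂.2 ⟨i, hij, hxi⟩)
  -- Diameters are at most 2η = (1-r)/2 < 1/2, so 3/4 leaves room for the strict bounds on both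
  -- sides.
  refine ⟨N, 3 / 4, F, by norm_num, fun j => ?_, ?_, ?_, fun z => ?_, ?_⟩
  · rw [hFdef]
    exact (isOpen_skwBall _ _).measurableSet.diff
      (isOpen_biUnion fun i _ => isOpen_skwBall _ _).measurableSet
  · intro i j hij
    refine disjoint_left.2 fun x hi hj => ?_
    rcases lt_or_gt_of_ne hij with h | h
    · exact hFn i j h x hj (hFb i hi)
    · exact hFn j i h x hi (hFb j hj)
  · classical
    refine eq_univ_of_forall fun x => mem_iUnion.2 ⟨Nat.find (hcov x), ?_⟩
    rw [hFdef]
    refine ⟨Nat.find_spec (hcov x), fun h => ?_⟩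
    obtain ⟨i, hi, hxi⟩ := mem_iUnion₂.1 h
    exact Nat.find_min (hcov x) hi hxi
  · by_contra! hlt
    have hle : ((N : ℕ∞)) ≤ {j | z ∈ skwThickening (thullen α hα) r (F j)}.encard := hlt.le
    obtain ⟨t, ht, htc⟩ := exists_subset_encard_eq hle
    have htf : t.Finite := finite_of_encard_eq_coe htc
    have hmem : ∀ j ∈ t, (F j).Nonempty ∧ skwDist _ z (f j) < r + 2 * η := by
      intro j hj
      have h1 : (⨅ w ∈ F j, ENNReal.ofReal (skwDist _ z w)) < ENNReal.ofReal (r + η) :=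
        lt_of_le_of_lt (ht hj) ((ENNReal.ofReal_lt_ofReal_iff (by linarith)).2 (by linarith))
      obtain ⟨w, hw, h2⟩ := by simpa only [iInf_lt_iff] using h1
      have h3 := ENNReal.ofReal_lt_ofReal_iff (by linarith) |>.1 h2
      have h4 : skwDist _ w (f j) < η := hFb j hw
      have h5 := skwDist_triangle z w (f j)
      exact ⟨⟨w, hw⟩, by linarith⟩
    -- The enumeration of the net may repeat points, but a repeated centre gives an empty piece, and
    -- the pieces indexed by t are nonempty.
    have hinj : ∀ i ∈ t, ∀ j ∈ t, i ≠ j → f i ≠ f j := by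
      intro i hi j hj hij he
      rcases lt_or_gt_of_ne hij with h | h
      · obtain ⟨x, hx⟩ := (hmem j hj).1
        exact hFn i j h x hx (he ▸ hFb j hx)
      · obtain ⟨x, hx⟩ := (hmem i hi).1
        exact hFn j i h x hx (he ▸ hFb i hx)
    have hsub : (⋃ j ∈ htf.toFinset, skwBall (f j) (η / 2)) ⊆ skwBall z (r + 3 * η) := by
      refine iUnion₂_subset fun j hj w hw => ?_
      have h1 := (hmem j (htf.mem_toFinset.1 hj)).2
      have h2 : skwDist _ w (f j) < η / 2 := hw
      have h3 := skwDist_triangle w (f j) z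
      rw [skwDist_comm (f j) z] at h3
      change skwDist _ w z < r + 3 * η
      linarith
    have hmeas := (measure_mono hsub).trans (kernelMeasure_skwBall_le z (by positivity) hR1)
    rw [measure_biUnion_finset (fun i hi j hj hij => disjoint_left.2 fun w h1 h2 => by
        have h3 : skwDist _ w (f i) < η / 2 := h1
        have h4 : skwDist _ w (f j) < η / 2 := h2
        have h5 := hsep i j (hinj i (htf.mem_toFinset.1 hi) j (htf.mem_toFinset.1 hj) hij)
        have h6 := skwDist_triangle (f i) w (f j)
        rw [skwDist_comm (f i) w] at h6
        linarith) (fun j _ => (isOpen_skwBall _ _).measurableSet), ← hLdef] at hmeas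
    have hcard : htf.toFinset.card = N := by
      rw [htf.encard_eq_coe_toFinset_card] at htc
      exact_mod_cast htc
    have h1 : (N : ℝ≥0∞) * c ≤ L := by
      rw [← hcard, ← nsmul_eq_mul, ← Finset.sum_const]
      exact (Finset.sum_le_sum fun j _ => hcb (f j)).trans hmeas
    exact absurd hN (not_lt.2 (ENNReal.le_div_iff_mul_le (Or.inl hc.ne') (Or.inr hL.ne) |>.2 h1))
  · have hdiam : ⨆ j, skwDiam (thullen α hα) (F j) ≤ ENNReal.ofReal (2 * η) := by
      refine iSup_le fun j => iSup₂_le fun z hz => iSup₂_le fun w hw =>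
        ENNReal.ofReal_le_ofReal ?_
      have h1 : skwDist _ z (f j) < η := hFb j hz
      have h2 : skwDist _ w (f j) < η := hFb j hw
      have h3 := skwDist_triangle z (f j) w
      rw [skwDist_comm (f j) w] at h3
      linarith
    refine hdiam.trans_lt ((ENNReal.ofReal_lt_ofReal_iff (by norm_num)).2 ?_)
    rw [hηdef]
    linarith

end Covering

end

/-! ### The approximation theorem -/

theorem proposition4p4 (α : ℝ) (hα : 0 < α) (hα1 : α ≠ 1)
    (T Tstar : kernelSpan (thullen α hα) →ₗ[ℂ] bergmanSpace (thullen α hα))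
    (hadj : ∀ z w : thullen α hα,
      (inner ℂ (normalizedKernel (thullen α hα) w) (T (spanKernel (thullen α hα) z)) : ℂ) =
        inner ℂ (Tstar (spanKernel (thullen α hα) w)) (normalizedKernel (thullen α hα) z))
    (p : ℝ) (hp : 4 < p)
    (hT : translSup α hα p T < ∞) (hTstar : translSup α hα p Tstar < ∞) :
    ∃ Tb : bergmanSpace (thullen α hα) →L[ℂ] bergmanSpace (thullen α hα),
      (∀ f : kernelSpan (thullen α hα), Tb (f : bergmanSpace (thullen α hα)) = T f) ∧
      ∀ ε : ℝ, 0 < ε → ∃ r : ℝ, 0 < r ∧ r < 1 ∧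
        (∃ (N : ℕ) (C : ℝ) (F : ℕ → Set (thullen α hα)),
          C < 1 ∧ IsSkwCovering (thullen α hα) r N C F) ∧
        ∀ (N : ℕ) (C : ℝ) (F : ℕ → Set (thullen α hα)),
          IsSkwCovering (thullen α hα) r N C F →
          ∃ S : bergmanSpace (thullen α hα) →L[ℂ] L2 (thullen α hα),
            (∀ f, HasSum (fun j =>
              localizedOp Tb (F j) (skwThickening (thullen α hα) r (F j)) f) (S f)) ∧
            ‖(bergmanSpace (thullen α hα)).subtypeL ∘L Tb - S‖ < ε := by
  have hadj' : AreAdjoint T Tstar := hadj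
  obtain ⟨Tb, hTb, hrep⟩ := exists_extension hp hadj' hT hTstar
  refine ⟨Tb, hTb, fun ε hε => ?_⟩
  obtain ⟨C, s, hC, hs, hb⟩ := exists_truncated_bound hp hadj' hT hTstar
  have hc := ENNReal.toReal_nonneg (a := C)
  -- With |V|^s ≤ (ε/2)/(C+1), the squared norm bound C |V|^{2s} is at most (ε/2)², because C ≤
  -- (C+1)². The measure threshold is therefore the power 1/s of this number, and ε/2 leaves room
  -- for the strict inequality.
  have hτ : 0 < ε / 2 / (C.toReal + 1) := by positivity
  obtain ⟨r, V, hr0, hr1, hVm, hV, h₁, h₂⟩ := exists_small_slices hα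
    (δ := ENNReal.ofReal (ε / 2 / (C.toReal + 1)) ^ (1 / s))
    (ENNReal.rpow_pos (ENNReal.ofReal_pos.2 hτ) ENNReal.ofReal_ne_top)
  refine ⟨r, hr0, hr1, exists_isSkwCovering hα hr0 hr1, fun N C' F hF => ?_⟩
  have hVs : domainMeasure _ V ^ s ≤ ENNReal.ofReal (ε / 2 / (C.toReal + 1)) := by
    have h := ENNReal.rpow_le_rpow hV.le hs.le
    rwa [← ENNReal.rpow_mul, one_div_mul_cancel hs.ne', ENNReal.rpow_one] at h
  have hsmall : C * (domainMeasure _ V ^ s) ^ 2 ≤ ENNReal.ofReal (ε / 2) ^ 2 := by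
    calc C * (domainMeasure _ V ^ s) ^ 2
        ≤ ENNReal.ofReal C.toReal * ENNReal.ofReal (ε / 2 / (C.toReal + 1)) ^ 2 := by
          rw [ENNReal.ofReal_toReal hC.ne]
          gcongr
      _ = ENNReal.ofReal (C.toReal * (ε / 2 / (C.toReal + 1)) ^ 2) := by
          rw [← ENNReal.ofReal_pow hτ.le, ← ENNReal.ofReal_mul hc]
      _ ≤ ENNReal.ofReal ((ε / 2) ^ 2) := by
          refine ENNReal.ofReal_le_ofReal ?_
          rw [div_pow, mul_div_assoc', div_le_iff₀ (by positivity), mul_comm]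
          gcongr
          nlinarith
      _ = ENNReal.ofReal (ε / 2) ^ 2 := ENNReal.ofReal_pow (by positivity) 2
  -- Without truncation the same estimate supplies the majorant for the convergence of the series.
  have hbu := hb Set.univ Set.univ MeasurableSet.univ MeasurableSet.univ (by simp) (by simp)
  simp only [Set.indicator_univ, Function.uncurry_apply_pair] at hbu
  have hfin : C * (domainMeasure (thullen α hα) Set.univ ^ s) ^ 2 < ∞ := by
    have := ENNReal.rpow_lt_top_of_nonneg hs.le 
      (MeasureTheory.measure_ne_top (domainMeasure (thullen α hα)) Set.univ)
    finiteness
  obtain ⟨S, hS, hSn⟩ := exists_localized_sum hrep hfin hbu (η := ε / 2) (r := r) (by positivity)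
    (fun g hg => (hb _ V (measurableSet_farPairs r) hVm h₁ h₂ g hg).trans (by gcongr))
    hF.measurableSet hF.pairwise_disjoint hF.iUnion_eq
  exact ⟨S, hS, hSn.trans_lt (by linarith)⟩
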